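/- Model. Blocks are mined in a Poisson process of rate $\lambda>0$ starting at time $0$; each block is honest with probability $\rho\in(0,1]$ and adversarial otherwise, independently. Each block extends one earlier block (block $0$, Genesis, is known to all at time $0$), so every block $b$ ends a unique blockchain and has a height $h_b$. An honest block is mined by some honest node (which one is arbitrary), extends a longest blockchain known to that node immediately before, is known to it at once, and reaches all honest nodes within a delay $\Delta\ge 0$; whenever an honest node receives a new longest blockchain at time $t$, all honest nodes receive it by time $t+\Delta$. An adversarial block may extend any earlier block and may be shown to each honest node at any time after it is mined; the adversary also breaks ties, chooses all delays, and may know all future mining times. A target transaction appears in every node's view at time $\tau\ge0$: no block mined by time $\tau$ contains it, no blockchain contains it twice, and the blockchain of every honest block mined after $\tau$ contains it. With confirmation depth $k\ge1$, an honest node commits a block when at least $k-1$ blocks are on top of it in a longest blockchain known to that node. The safety of the transaction is violated if a block containing it and a different block on the same height are each committed by some honest node at some time. The private-mining attack: every adversarial block extends a longest blockchain without the transaction and does not contain the transaction; every honest block's propagation to nodes other than its miner is delayed by exactly $\Delta$; and all adversarial blocks are kept private until the adversary can violate safety by publishing all blocks, which it then does before the next block is mined. Notation. For $\tfrac12<p\le1$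 let $$P_1(i;p)=\Big(\tfrac{1-p}{p}\Big)^{i-1}\Big(1-\tfrac{1-p}{p}\Big),\qquad \overline F_1(i;p)=\Big(\tfrac{1-p}{p}\Big)^{i},$$ $$P_2(j;n,q)=\binom nj q^j(1-q)^{n-j},\qquad \overline F_2(j;n,q)=\sum_{l=j+1}^n P_2(l;n,q),$$ and, for $c\in\{1,2\}$, $$\Phi_c(k;p)=\overline F_1(k;p)+\sum_{i=1}^{k}P_1(i;p)\Big(\overline F_2(k-i;2k+1-i,1-p)+\sum_{j=0}^{k-i}P_2(j;2k+1-i,1-p)\,\overline F_1(2k+c-2i-2j;p)\Big).$$ Theorem. Let $p=\rho e^{-\lambda\Delta}>\frac12$ and $k\ge1$. (1) For every $\tau\ge0$ and every attack, the probability that the safety of the target transaction is violated is at most $\Phi_1(k;p)$. (2) Conversely, the private-mining attack can be carried out for every $\tau\ge 0$, and, once $\tau$ is large, it violates safety with probability at least $\Phi_2(k;\rho)$ in the limit: for every $\varepsilon>0$ there is $\tau_0$ such that for all $\tau\ge\tau_0$ every private-mining attack (however ties are broken) succeeds with probability at least $\Phi_2(k;\rho)-\varepsilon$. If $\Delta=0$,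 its success probability converges to exactly $\Phi_2(k;\rho)$ as $\tau\to\infty$. -/

import Mathlib

open MeasureTheory ProbabilityTheory

namespace Nakamoto

/-! ### Geometric and binomial pmf and tail terms -/

noncomputable section

/-- The geometric pmf `P₁(i;p) = (q/p)^(i-1) (1 - q/p)` for `i = 1, 2, …`, where `q = 1 - p`. -/
def P1 (i : ℕ) (p : ℝ) : ℝ := ((1 - p) / p) ^ (i - 1) * (1 - (1 - p) / p)

/-- The complementary geometric cdf `(q/p)^i`, where `q = 1 - p`. -/
def F1 (i : ℕ) (p : ℝ) : ℝ := ((1 - p) / p) ^ i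

/-- The binomial pmf with parameters `(n, q)`. -/
def P2 (j n : ℕ) (q : ℝ) : ℝ := (n.choose j : ℝ) * q ^ j * (1 - q) ^ (n - j)

/-- The complementary binomial cdf: the probability of more than `j` successes. -/
def F2 (j n : ℕ) (q : ℝ) : ℝ := ∑ l ∈ Finset.Icc (j + 1) n, P2 l n q

/-- The upper bound. All natural subtractions are exact, since `i ≤ k` and `j ≤ k - i`. -/
def upperBound (k : ℕ) (p : ℝ) : ℝ :=
  F1 k p + ∑ i ∈ Finset.Icc 1 k, P1 i p *
    (F2 (k - i) (2 * k + 1 - i) (1 - p) +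
      ∑ j ∈ Finset.Icc 0 (k - i),
        P2 j (2 * k + 1 - i) (1 - p) * F1 (2 * k + 1 - 2 * i - 2 * j) p)

/-- The lower bound. All natural subtractions are exact, since `i ≤ k` and `j ≤ k - i`. -/
def lowerBound (k : ℕ) (r : ℝ) : ℝ :=
  F1 k r + ∑ i ∈ Finset.Icc 1 k, P1 i r *
    (F2 (k - i) (2 * k + 1 - i) (1 - r) +
      ∑ j ∈ Finset.Icc 0 (k - i),
        P2 j (2 * k + 1 - i) (1 - r) * F1 (2 * k + 2 - 2 * i - 2 * j) r)

end

/-! ### Mining -/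

/-- A sample path of the mining process, with set `N` of honest nodes. Blocks are numbered by
mining time, block `0` being the genesis block. -/
structure MiningPath (N : Type*) where
  /-- the mining time of each block -/
  time : ℕ → ℝ
  /-- whether block `j ≥ 1` is mined by an honest node (the value at `0` is irrelevant) -/
  honest : ℕ → Bool
  /-- the honest node that mines block `j` (relevant only for honest blocks) -/
  miner : ℕ → N

/-- Mining is a Poisson process of rate `lam` on `[0, ∞)` (independent exponential inter-arrival
times), each block being honest with probability `ρ`, independently of all else. Which of the
honest nodes mines a given honest block is left completely arbitrary. -/
structure IsPoissonMining {Ω N : Type*} [MeasurableSpace Ω] (P : Measure Ω)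
    (X : Ω → MiningPath N) (lam ρ : ℝ) : Prop where
  time_zero : ∀ ω, (X ω).time 0 = 0
  measurable_gap : ∀ j, Measurable fun ω => (X ω).time (j + 1) - (X ω).time j
  measurable_honest : ∀ j, Measurable fun ω => (X ω).honest (j + 1)
  law : ∀ j : ℕ,
    P.map (fun ω => ((X ω).time (j + 1) - (X ω).time j, (X ω).honest (j + 1))) =
      (expMeasure lam).prod
        (ENNReal.ofReal ρ • Measure.dirac true + ENNReal.ofReal (1 - ρ) • Measure.dirac false)
  indep : iIndepFun
    (fun (j : ℕ) ω => ((X ω).time (j + 1) - (X ω).time j, (X ω).honest (j + 1))) P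

/-! ### Executions of the protocol -/

/-- What happens on a given mining path: the block tree, the blocks that contain the target
transaction, and the time (possibly never, `⊤`) at which each honest node receives each block. -/
structure Execution (N : Type*) where
  /-- the predecessor of block `j + 1`, one of the blocks `0, …, j` -/
  parent : (j : ℕ) → Fin (j + 1)
  /-- block `j` contains the target transaction -/
  hasTx : ℕ → Prop
  /-- the time at which an honest node receives blockchain `j` -/
  recv : N → ℕ → WithTop ℝ

namespace Execution

variable {N : Type*}

/-- The height of a block. -/
def height (E : Execution N) : ℕ → ℕ
  | 0 => 0
  | j + 1 => E.height (E.parent j) + 1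
decreasing_by exact (E.parent j).isLt

/-- `E.InChain b c`: block `b` is one of the blocks of blockchain `c`. -/
inductive InChain (E : Execution N) : ℕ → ℕ → Prop
  | refl (b : ℕ) : InChain E b b
  | step {b j : ℕ} : InChain E b (E.parent j) → InChain E b (j + 1)

/-- Blockchain `c` contains the target transaction. -/
def ChainHasTx (E : Execution N) (c : ℕ) : Prop := ∃ b, E.InChain b c ∧ E.hasTx b

/-- When node `n` receives blockchain `b`, it is a new longest blockchain for that node. -/
def NewLongest (E : Execution N) (n : N) (b : ℕ) : Prop :=
  (∀ d, E.recv n d < E.recv n b → E.height d < E.height b) ∧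
  (∀ d, E.recv n d = E.recv n b → E.height d ≤ E.height b)

/-- The rules of the model: delay bound `Δ`, target transaction appearing at time `τ`. Everything
that the rules leave open (the adversarial blocks, the ties, the times of reception) is up to
the adversary. -/
structure Legal (E : Execution N) (M : MiningPath N) (Δ τ : ℝ) : Prop where
  /-- the genesis block is known to all nodes at time `0` -/
  genesis : ∀ n, E.recv n 0 = ((0 : ℝ) : WithTop ℝ)
  /-- no block is received before it is mined -/
  time_le_recv : ∀ n j, (M.time j : WithTop ℝ) ≤ E.recv n j
  /-- a block is received together with the blockchain below it -/
  recv_parent_le : ∀ n j, E.recv n (E.parent j) ≤ E.recv n (j + 1)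
  /-- an honest block extends a longest blockchain known to its miner immediately before -/
  honest_parent : ∀ j, M.honest (j + 1) = true →
    E.recv (M.miner (j + 1)) (E.parent j) < (M.time (j + 1) : WithTop ℝ) ∧
    ∀ d, E.recv (M.miner (j + 1)) d < (M.time (j + 1) : WithTop ℝ) →
      E.height d ≤ E.height (E.parent j)
  /-- an honest miner knows its own block at once -/
  honest_own : ∀ j, M.honest (j + 1) = true →
    E.recv (M.miner (j + 1)) (j + 1) = (M.time (j + 1) : WithTop ℝ)
  /-- an honest block is published at once, and reaches all nodes within `Δ` -/
  honest_publish : ∀ j n, M.honest (j + 1) = true →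
    E.recv n (j + 1) ≤ ((M.time (j + 1) + Δ : ℝ) : WithTop ℝ)
  /-- a new longest blockchain received by an honest node reaches all nodes within `Δ` -/
  relay : ∀ n m b, E.NewLongest n b → E.recv m b ≤ E.recv n b + (Δ : WithTop ℝ)
  /-- the transaction appears at most once in any blockchain -/
  tx_once : ∀ b c, E.hasTx b → E.hasTx c → E.InChain b c → b = c
  /-- the transaction is unknown, hence in no block, before it appears -/
  tx_after : ∀ b, E.hasTx b → τ < M.time b
  /-- honest nodes include the transaction once it has appeared, unless it is already there -/
  honest_tx : ∀ j, M.honest (j + 1) = true → τ < M.time (j + 1) → E.ChainHasTx (j + 1)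

/-- The `k`-confirmation rule: at time `t`, node `n` commits block `b` if at least `k - 1` blocks
are on top of it in a longest blockchain known to `n`. -/
def Commits (E : Execution N) (k : ℕ) (n : N) (b : ℕ) (t : ℝ) : Prop :=
  ∃ c, E.recv n c ≤ (t : WithTop ℝ) ∧
    (∀ d, E.recv n d ≤ (t : WithTop ℝ) → E.height d ≤ E.height c) ∧
    E.InChain b c ∧ E.height b + k ≤ E.height c + 1

/-- By time `t`, a block with the target transaction and a different block on the same height have
been committed by honest nodes (possibly the same node at different times). -/
def ViolatedBy (E : Execution N) (k : ℕ) (t : ℝ) : Prop :=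
  ∃ b b' : ℕ, E.hasTx b ∧ b ≠ b' ∧ E.height b = E.height b' ∧
    ∃ (n n' : N) (s s' : ℝ), s ≤ t ∧ s' ≤ t ∧ E.Commits k n b s ∧ E.Commits k n' b' s'

/-- The safety of the target transaction is violated. -/
def Violated (E : Execution N) (k : ℕ) : Prop := ∃ t, E.ViolatedBy k t

open Classical in
/-- The execution in which, at time `t`, all blocks mined by then are published to all nodes. -/
noncomputable def publishAt (E : Execution N) (M : MiningPath N) (t : ℝ) : Execution N where
  parent := E.parent
  hasTx := E.hasTx
  recv n j := if M.time j ≤ t then min (E.recv n j) (t : WithTop ℝ) else E.recv n j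

/-- The adversary can violate the safety of the transaction by publishing all blocks at time `t`. -/
def CanViolate (E : Execution N) (M : MiningPath N) (k : ℕ) (t : ℝ) : Prop :=
  (E.publishAt M t).ViolatedBy k t

/-- The private-mining attack. Here `σ` is the time at which the adversary publishes, `⊤` if it
never does. What is left open are the ties and what happens after publication. -/
def IsPrivateMining (E : Execution N) (M : MiningPath N) (Δ : ℝ) (k : ℕ) : Prop :=
  -- every adversarial block extends a longest blockchain without the transaction
  (∀ j, M.honest (j + 1) = false →
    ¬ E.ChainHasTx (j + 1) ∧
    ∀ d, d ≤ j → ¬ E.ChainHasTx d → E.height d ≤ E.height (E.parent j)) ∧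
  ∃ σ : WithTop ℝ,
    -- until publication, the propagation of every honest block is delayed by `Δ`
    (∀ j n, M.honest (j + 1) = true → n ≠ M.miner (j + 1) → (M.time (j + 1) : WithTop ℝ) ≤ σ →
      E.recv n (j + 1) = min ((M.time (j + 1) + Δ : ℝ) : WithTop ℝ) σ) ∧
    -- until publication, all adversarial blocks are private
    (∀ j n, M.honest (j + 1) = false → σ ≤ E.recv n (j + 1)) ∧
    -- at publication, all blocks become known to all nodes
    (∀ j n, (M.time (j + 1) : WithTop ℝ) ≤ σ → E.recv n (j + 1) ≤ σ) ∧
    -- publication happens only when it violates safety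
    (∀ s : ℝ, σ = (s : WithTop ℝ) → E.CanViolate M k s) ∧
    -- and it does happen before the next block is mined once it can violate safety
    (∀ (j : ℕ) (t : ℝ), t < M.time j → (M.time j : WithTop ℝ) ≤ σ → ¬ E.CanViolate M k t)

end Execution

end Nakamoto

/-!
Why the bounds hold.

Call some of the blocks good and all others bad, where every good block is honest and mined more
than `Δ` after its predecessor. A good block is then higher than all honest blocks before it
(`Legal.height_lt_of_lagger`), so good blocks sit on distinct heights. If safety is
violated by blocks `b ≠ b'` on the same height, take for each of them a chain of minimal index that
commits it: its blocks `k` or more levels above `b` are adversarial, as the predecessor of an honest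
block there would be a smaller such chain. Every good block mined since the transaction
appeared then shares its height with a bad block on one of the two chains, except for one that may
still be on its way, and so does each of the `k` heights from that of `b` on. The bad blocks of
earlier times supply at most `lead` many of these heights, where `lead` is the random walk of bad
minus good blocks reflected at `0`. Hence a violation puts the walk after time `τ` into
`winSet 1 k (lead)` (`Legal.shift_mem_winSet_of_violated`).

For private mining, count all honest blocks as good. The honest chain grows by at most one per honest
block, and the longest chain without the transaction by one with each adversarial block, so the
attack succeeds if the walk is in `winSet 0 k (lead)` (`Legal.violated_of_shift_mem_winSet`). Without
delays the honest chain grows by exactly one, and the converse holds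
(`Legal.shift_mem_winSet_of_privateMining`). The attack itself is an explicit recursion along the
mining path (`exists_privateMining`).

On the probabilistic side, a block is good with probability `p = ρ e^{-λΔ}`, independently of the
others. By the memoryless property (`pathLaw_countEq`), the good blocks after time `τ` are
independent of the past, provided that the first of them is required to be mined more than `Δ` after
`τ`. The blocks up to time `τ` are exchangeable; read backwards, they turn the lead at time `τ` into
the running maximum of the free walk (`pathLaw_countEq_le_lead`), which is dominated by, and as
`τ → ∞` increases to, the geometric law of gambler's ruin (`trials_hitSet`). Finally, the
probability of `winSet δ k x` is computed by conditioning on the number of bad blocks among the next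
`2k - x` (`trials_winSet`): the adversary wins by then with `k - x` bad blocks, and has to catch up
otherwise.
-/

namespace Nakamoto

/-! ### Walks driven by a sequence of good and bad blocks -/

/-- The number of good blocks among the first `m`. -/
def good (y : ℕ → Bool) (m : ℕ) : ℕ := Nat.count (fun i => y i = true) m

/-- The number of bad blocks among the first `m`. -/
def bad (y : ℕ → Bool) (m : ℕ) : ℕ := Nat.count (fun i => y i = false) m

/-- The adversary's lead after `n` blocks: a walk reflected at `0`, started at `0`, that goes up
with each bad block and down with each good one. -/
def lead (y : ℕ → Bool) : ℕ → ℕ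
  | 0 => 0
  | n + 1 => if y n = true then lead y n - 1 else lead y n + 1

/-- The sequence of blocks that follow the first `n`. -/
def shift (n : ℕ) (y : ℕ → Bool) : ℕ → Bool := fun i => y (n + i)

/-- The walks that win for the adversary from lead `x`: at some moment the adversary has gained at
least `k` blocks, lead included, and is at most `δ` blocks behind the good blocks. -/
def winSet (δ k x : ℕ) : Set (ℕ → Bool) :=
  {y | ∃ m, k ≤ x + bad y m ∧ good y m ≤ x + bad y m + δ}

@[simp] lemma good_zero (y : ℕ → Bool) : good y 0 = 0 := by simp [good]
@[simp] lemma bad_zero (y : ℕ → Bool) : bad y 0 = 0 := by simp [bad]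

lemma good_succ (y : ℕ → Bool) (m : ℕ) :
    good y (m + 1) = good y m + if y m = true then 1 else 0 := by simp [good, Nat.count_succ]
lemma bad_succ (y : ℕ → Bool) (m : ℕ) :
    bad y (m + 1) = bad y m + if y m = false then 1 else 0 := by simp [bad, Nat.count_succ]

lemma good_add_bad (y : ℕ → Bool) (m : ℕ) : good y m + bad y m = m := by
  induction m with
  | zero => simp
  | succ m ih => rw [good_succ, bad_succ]; cases y m <;> simp <;> omega

lemma good_add (y : ℕ → Bool) (n m : ℕ) : good y (n + m) = good y n + good (shift n y) m := by
  unfold good shift; rw [Nat.count_add]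
lemma bad_add (y : ℕ → Bool) (n m : ℕ) : bad y (n + m) = bad y n + bad (shift n y) m := by
  unfold bad shift; rw [Nat.count_add]

lemma bad_mono (y : ℕ → Bool) : Monotone (bad y) := Nat.count_monotone _

lemma lead_congr {y z : ℕ → Bool} {m : ℕ} (h : ∀ i < m, y i = z i) : lead y m = lead z m := by
  induction m with
  | zero => rfl
  | succ m ih => rw [lead, lead, ih fun i hi => h i (by omega), h m (by omega)]

lemma card_filter_good (y : ℕ → Bool) (n m : ℕ) :
    ((Finset.Ico n (n + m)).filter fun i => y i = true).card = good (shift n y) m := by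
  induction m with
  | zero => simp
  | succ m ih =>
    rw [← Nat.add_assoc, Nat.Ico_succ_right_eq_insert_Ico (by omega), Finset.filter_insert,
      good_succ]
    change _ = _ + if y (n + m) = true then 1 else 0
    split_ifs <;> simp [ih]

lemma card_filter_bad (y : ℕ → Bool) (n m : ℕ) :
    ((Finset.Ico n (n + m)).filter fun i => y i = false).card = bad (shift n y) m := by
  induction m with
  | zero => simp
  | succ m ih =>
    rw [← Nat.add_assoc, Nat.Ico_succ_right_eq_insert_Ico (by omega), Finset.filter_insert,
      bad_succ]
    change _ = _ + if y (n + m) = false then 1 else 0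
    split_ifs <;> simp [ih]

/-- The reflected walk is the maximal increment of the free walk over the final stretches. -/
lemma le_lead_iff {y : ℕ → Bool} {n a : ℕ} :
    a ≤ lead y n ↔ ∃ m ≤ n, good (shift m y) (n - m) + a ≤ bad (shift m y) (n - m) := by
  induction n generalizing a with
  | zero => simp [lead]
  | succ n ih =>
    have key : ∀ m ≤ n, good (shift m y) (n + 1 - m) =
        good (shift m y) (n - m) + (if y n = true then 1 else 0) ∧
        bad (shift m y) (n + 1 - m) =
        bad (shift m y) (n - m) + (if y n = false then 1 else 0) := by
      intro m hm
      have : n + 1 - m = (n - m) + 1 := by omega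
      have h2 : shift m y (n - m) = y n := by simp [shift, Nat.add_sub_cancel' hm]
      rw [this, good_succ, bad_succ, h2]
      exact ⟨rfl, rfl⟩
    constructor
    · intro h
      rcases Nat.eq_zero_or_pos a with rfl | ha
      · exact ⟨n + 1, le_rfl, by simp⟩
      · rw [lead] at h
        split_ifs at h with hy
        · obtain ⟨m, hm, h1⟩ := ih.1 (show a + 1 ≤ lead y n by omega)
          refine ⟨m, by omega, ?_⟩
          rw [(key m hm).1, (key m hm).2]; simp [hy]; omega
        · obtain ⟨m, hm, h1⟩ := ih.1 (show a - 1 ≤ lead y n by omega)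
          refine ⟨m, by omega, ?_⟩
          rw [(key m hm).1, (key m hm).2]; simp [hy]; omega
    · rintro ⟨m, hm, h⟩
      rcases Nat.eq_zero_or_pos a with rfl | ha
      · exact Nat.zero_le _
      rcases Nat.eq_or_lt_of_le hm with rfl | hm
      · simp at h; omega
      · have hm : m ≤ n := by omega
        rw [(key m hm).1, (key m hm).2] at h
        rw [lead]
        split_ifs with hy
        · simp [hy] at h
          have := ih.2 ⟨m, hm, show _ + (a + 1) ≤ _ by omega⟩
          omega
        · simp [hy] at h
          have := ih.2 ⟨m, hm, show _ + (a - 1) ≤ _ by omega⟩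
          omega

lemma winSet_eq_univ {δ k x : ℕ} (h : k ≤ x) : winSet δ k x = Set.univ :=
  Set.eq_univ_of_forall fun _ => ⟨0, by simpa using h, by simp⟩

/-! ### Heights and chains -/

namespace Execution

variable {N : Type*} {E : Execution N}

@[simp] lemma height_zero : E.height 0 = 0 := by rw [height]
lemma height_succ (j : ℕ) : E.height (j + 1) = E.height (E.parent j) + 1 := by rw [height]

lemma height_eq_zero {b : ℕ} (h : E.height b = 0) : b = 0 := by
  cases b with
  | zero => rfl
  | succ j => rw [height_succ] at h; omega

lemma inChain_succ {b j : ℕ} : E.InChain b (j + 1) ↔ b = j + 1 ∨ E.InChain b (E.parent j) := by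
  constructor
  · intro h
    cases h with
    | refl => exact Or.inl rfl
    | step h => exact Or.inr h
  · rintro (rfl | h)
    · exact .refl _
    · exact .step h

lemma inChain_zero {b : ℕ} : E.InChain b 0 ↔ b = 0 := by
  constructor
  · intro h
    generalize hc : 0 = c at h
    cases h with
    | refl => rfl
    | step h => omega
  · rintro rfl; exact .refl _

lemma InChain.trans {a b c : ℕ} (h1 : E.InChain a b) (h2 : E.InChain b c) : E.InChain a c := by
  induction h2 with
  | refl => exact h1
  | step _ ih => exact .step ih

lemma InChain.le {b c : ℕ} (h : E.InChain b c) : b ≤ c := by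
  induction h with
  | refl => exact le_rfl
  | @step j _ ih => have := (E.parent j).isLt; omega

lemma InChain.height_le {b c : ℕ} (h : E.InChain b c) : E.height b ≤ E.height c := by
  induction h with
  | refl => exact le_rfl
  | step _ ih => rw [height_succ]; omega

lemma InChain.height_lt {b c : ℕ} (h : E.InChain b c) (hne : b ≠ c) :
    E.height b < E.height c := by
  cases h with
  | refl => exact absurd rfl hne
  | step h => have := h.height_le; rw [height_succ]; omega

/-- A blockchain passes through every height up to its own. -/
lemma exists_inChain_height {c l : ℕ} (h : l ≤ E.height c) :
    ∃ f, E.InChain f c ∧ E.height f = l := by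
  induction c using Nat.strong_induction_on with
  | _ c ih =>
    rcases Nat.eq_or_lt_of_le h with h | h
    · exact ⟨c, .refl c, h.symm⟩
    · cases c with
      | zero => simp at h
      | succ j =>
        rw [height_succ] at h
        obtain ⟨f, hf, hl⟩ := ih (E.parent j) (E.parent j).isLt (by omega)
        exact ⟨f, .step hf, hl⟩

/-- Two blocks of one chain are comparable, in the order of their heights. -/
lemma InChain.of_height_le {a b c : ℕ} (ha : E.InChain a c) (hb : E.InChain b c)
    (h : E.height a ≤ E.height b) : E.InChain a b := by
  induction hb with
  | refl => exact ha
  | @step j hb ih =>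
    rcases inChain_succ.1 ha with rfl | ha
    · have := hb.height_le
      rw [height_succ] at h; omega
    · exact ih ha

lemma InChain.eq_of_height_eq {a b c : ℕ} (ha : E.InChain a c) (hb : E.InChain b c)
    (h : E.height a = E.height b) : a = b := by
  by_contra hne
  have := (ha.of_height_le hb h.le).height_lt hne
  omega

lemma ChainHasTx.mono {b c : ℕ} (hb : E.ChainHasTx b) (h : E.InChain b c) : E.ChainHasTx c := by
  obtain ⟨a, h1, h2⟩ := hb
  exact ⟨a, h1.trans h, h2⟩

/-! ### Consequences of the rules -/

variable {M : MiningPath N} {Δ τ : ℝ}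

lemma Legal.recv_le_of_inChain (hE : E.Legal M Δ τ) {b c : ℕ} (h : E.InChain b c) (n : N) :
    E.recv n b ≤ E.recv n c := by
  induction h with
  | refl => exact le_rfl
  | step _ ih => exact ih.trans (hE.recv_parent_le n _)

lemma Legal.time_le_of_recv_le (hE : E.Legal M Δ τ) {n : N} {b : ℕ} {t : ℝ}
    (h : E.recv n b ≤ (t : WithTop ℝ)) : M.time b ≤ t :=
  WithTop.coe_le_coe.1 ((hE.time_le_recv n b).trans h)

/-- An honest block mined more than `Δ` after its predecessor is higher than all honest blocks
mined before it. -/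
lemma Legal.height_lt_of_lagger (hE : E.Legal M Δ τ) (hΔ : 0 ≤ Δ) (ht : StrictMono M.time)
    (h0 : M.time 0 = 0) {j : ℕ} (hj : M.honest (j + 1) = true)
    (hgap : M.time j + Δ < M.time (j + 1)) {i : ℕ} (hij : i ≤ j)
    (hi : i = 0 ∨ M.honest i = true) : E.height i < E.height (j + 1) := by
  have hlt : E.recv (M.miner (j + 1)) i < (M.time (j + 1) : WithTop ℝ) := by
    cases i with
    | zero =>
      rw [hE.genesis, WithTop.coe_lt_coe]
      have := ht.monotone (Nat.zero_le j); linarith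
    | succ i =>
      refine (hE.honest_publish i _ (by simpa using hi)).trans_lt (WithTop.coe_lt_coe.2 ?_)
      have := ht.monotone hij; linarith
  rw [height_succ]
  exact Nat.lt_succ_of_le ((hE.honest_parent j hj).2 i hlt)

lemma Legal.chain_no_tx_below (hE : E.Legal M Δ τ) {b f : ℕ} (hb : E.hasTx b)
    (hf : E.InChain f b) (hne : f ≠ b) : ¬ E.ChainHasTx f := by
  rintro ⟨a, ha, hta⟩
  have := hE.tx_once a b hta hb (ha.trans hf)
  subst this
  exact hne (le_antisymm hf.le ha.le)

end Execution
end Nakamoto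

namespace Nakamoto
namespace Execution

/-! ### Every violation is a win for the adversary -/

variable {N : Type*} {E : Execution N} {M : MiningPath N} {Δ τ : ℝ}

/-- Among the longest chains by which an honest node ever commits `b`, one with minimal index has
only adversarial blocks from height `h_b + k` on: the predecessor of an honest block there would
commit `b` as well, in the view of its miner. -/
lemma Legal.exists_minimal_commit (hE : E.Legal M Δ τ) {k : ℕ} (hk : 1 ≤ k) {n : N} {b : ℕ}
    {t : ℝ} (h : E.Commits k n b t) :
    ∃ (c : ℕ) (n : N) (t : ℝ), E.recv n c ≤ (t : WithTop ℝ) ∧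
      (∀ d, E.recv n d ≤ (t : WithTop ℝ) → E.height d ≤ E.height c) ∧ E.InChain b c ∧
      E.height b + k ≤ E.height c + 1 ∧
      ∀ j, E.InChain (j + 1) c → E.height b + k ≤ E.height (j + 1) →
        M.honest (j + 1) = false := by
  have hex : ∃ (c : ℕ) (n : N) (t : ℝ), E.recv n c ≤ (t : WithTop ℝ) ∧
      (∀ d, E.recv n d ≤ (t : WithTop ℝ) → E.height d ≤ E.height c) ∧ E.InChain b c ∧
      E.height b + k ≤ E.height c + 1 := by
    obtain ⟨c, h⟩ := h
    exact ⟨c, n, t, h⟩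
  classical
  obtain ⟨n, t, h1, h2, h3, h4⟩ := Nat.find_spec hex
  refine ⟨Nat.find hex, n, t, h1, h2, h3, h4, fun j hj hjk => ?_⟩
  by_contra hhon
  have hhon : M.honest (j + 1) = true := by simpa using hhon
  obtain ⟨hp1, hp2⟩ := hE.honest_parent j hhon
  obtain ⟨r, hr⟩ := WithTop.ne_top_iff_exists.1 hp1.ne_top
  have hb : E.InChain b (j + 1) := h3.of_height_le hj (by omega)
  have hb' : E.InChain b (E.parent j) := by
    rcases inChain_succ.1 hb with rfl | hb
    · omega
    · exact hb
  have hmin := Nat.find_min' hex (m := (E.parent j : ℕ)) ⟨M.miner (j + 1), r, hr.ge,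
    fun d hd => hp2 d (hd.trans_lt (hr ▸ hp1)), hb', by rw [height_succ] at hjk; omega⟩
  have := hj.le
  have := (E.parent j).isLt
  omega

/-- Every block mined so far is at most the adversary's lead above the last good block. -/
lemma Legal.exists_height_le_add_lead (hE : E.Legal M Δ τ) (hΔ : 0 ≤ Δ)
    (ht : StrictMono M.time) (h0 : M.time 0 = 0) {G : ℕ → Bool}
    (hG : ∀ j, G j = true → M.honest (j + 1) = true ∧ M.time j + Δ < M.time (j + 1)) (n : ℕ) :
    ∃ a ≤ n, (a = 0 ∨ M.honest a = true) ∧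
      ∀ d ≤ n, E.height d ≤ E.height a + lead G n := by
  induction n with
  | zero => exact ⟨0, le_rfl, Or.inl rfl, fun d hd => by simp [Nat.le_zero.1 hd]⟩
  | succ n ih =>
    obtain ⟨a, han, ha, hd⟩ := ih
    have hpar := hd (E.parent n) (Nat.lt_succ_iff.1 (E.parent n).isLt)
    rw [lead]
    split_ifs with hy
    · have hlt := hE.height_lt_of_lagger hΔ ht h0 (hG n hy).1 (hG n hy).2 han ha
      refine ⟨n + 1, le_rfl, Or.inr (hG n hy).1, fun d hdn => ?_⟩
      rcases Nat.eq_or_lt_of_le hdn with rfl | hdn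
      · omega
      · have := hd d (by omega); omega
    · refine ⟨a, by omega, ha, fun d hdn => ?_⟩
      rcases Nat.eq_or_lt_of_le hdn with rfl | hdn
      · rw [height_succ]; omega
      · have := hd d (by omega); omega

lemma exists_last_index {t : ℕ → ℝ} (ht : StrictMono t)
    (hlim : Filter.Tendsto t Filter.atTop Filter.atTop) {n : ℕ} {T : ℝ} (hn : t n ≤ T) :
    ∃ m, t (n + m) ≤ T ∧ T < t (n + m + 1) := by
  classical
  have hex : ∃ q, T < t q := (hlim.eventually_gt_atTop T).exists
  have h1 := Nat.find_spec hex
  have h2 : n < Nat.find hex := ht.lt_iff_lt.1 (hn.trans_lt h1)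
  have h3 := Nat.find_min hex (m := Nat.find hex - 1) (by omega)
  refine ⟨Nat.find hex - 1 - n, ?_, ?_⟩
  · rw [show n + (Nat.find hex - 1 - n) = Nat.find hex - 1 by omega]; exact not_lt.1 h3
  · rw [show n + (Nat.find hex - 1 - n) + 1 = Nat.find hex by omega]; exact h1

/-- If some blocks, all honest and mined more than `Δ` after their predecessors, are called good
and all others bad, then a violation of safety needs a win of the bad blocks, up to one good block
that may still be on its way. Each good block mined since the transaction appeared, and each of the
`k` heights from that of the disputed block on, is matched with a bad block on the same height. -/
theorem Legal.shift_mem_winSet_of_violated (hE : E.Legal M Δ τ) (hΔ : 0 ≤ Δ)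
    (ht : StrictMono M.time) (h0 : M.time 0 = 0)
    (hlim : Filter.Tendsto M.time Filter.atTop Filter.atTop) {G : ℕ → Bool}
    (hG : ∀ j, G j = true → M.honest (j + 1) = true ∧ M.time j + Δ < M.time (j + 1))
    {k : ℕ} (hk : 1 ≤ k) {n : ℕ} (hn : M.time n ≤ τ) (hn' : τ < M.time (n + 1))
    (hv : E.Violated k) : shift n G ∈ winSet 1 k (lead G n) := by
  classical
  obtain ⟨_, b, b', hbtx, hne, hbb', v, v', s, s', _, _, hc, hc'⟩ := hv
  obtain ⟨c, v, s, hc1, hc2, hc3, hc4, hc5⟩ := hE.exists_minimal_commit hk hc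
  obtain ⟨c', v', s', hc1', hc2', hc3', hc4', hc5'⟩ := hE.exists_minimal_commit hk hc'
  rw [← hbb'] at hc4' hc5'
  set h := E.height b with hh
  have htb : τ < M.time b := hE.tx_after b hbtx
  have htc : M.time c ≤ s := hE.time_le_of_recv_le hc1
  have htc' : M.time c' ≤ s' := hE.time_le_of_recv_le hc1'
  have hbc : M.time b ≤ M.time c := ht.monotone hc3.le
  obtain ⟨m, hm, hm'⟩ := exists_last_index ht hlim (n := n) (T := max s s')
    (by have := le_max_left s s'; linarith)
  -- good blocks have distinct heights, increasing in time
  have hinc : ∀ i j, G j = true → i ≤ j → (i = 0 ∨ M.honest i = true) →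
      E.height i < E.height (j + 1) := fun i j hj hij hi =>
    hE.height_lt_of_lagger hΔ ht h0 (hG j hj).1 (hG j hj).2 hij hi
  have huniq : ∀ i j, G i = true → G j = true → E.height (i + 1) = E.height (j + 1) → i = j := by
    intro i j hi hj hij
    rcases lt_trichotomy i j with hlt | heq | hlt
    · have := hinc (i + 1) j hj (by omega) (Or.inr (hG i hi).1); omega
    · exact heq
    · have := hinc (j + 1) i hi (by omega) (Or.inr (hG j hj).1); omega
  have hidx : ∀ f, E.InChain f c ∨ E.InChain f c' → f ≤ n + m := by
    intro f hf
    have : M.time f < M.time (n + m + 1) := by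
      rcases hf with hf | hf
      · have := ht.monotone hf.le; have := le_max_left s s'; linarith
      · have := ht.monotone hf.le; have := le_max_right s s'; linarith
    have := ht.lt_iff_lt.1 this
    omega
  -- every height of a good block mined after the transaction appeared has a bad block, too
  have hmatch : ∀ g, n ≤ g → G g = true →
      (E.height (g + 1) ≤ E.height c ∨ E.height (g + 1) ≤ E.height c') →
      ∃ f, (E.InChain (f + 1) c ∨ E.InChain (f + 1) c') ∧ G f = false ∧
        E.height (f + 1) = E.height (g + 1) := by
    intro g hg hGg hle
    have hpos : 0 < E.height (g + 1) := by rw [height_succ]; omega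
    have hbad : ∀ f, (E.InChain f c ∨ E.InChain f c') → E.height f = E.height (g + 1) →
        f ≠ g + 1 → ∃ f, (E.InChain (f + 1) c ∨ E.InChain (f + 1) c') ∧ G f = false ∧
        E.height (f + 1) = E.height (g + 1) := by
      intro f hf hfh hfg
      cases f with
      | zero => simp at hfh; omega
      | succ f =>
        refine ⟨f, hf, ?_, hfh⟩
        by_contra hGf
        exact hfg (by rw [huniq f g (by simpa using hGf) hGg hfh])
    rcases lt_or_ge (E.height (g + 1)) h with hlt | hge
    · -- below the disputed height: a proper ancestor of `b`, hence without the transaction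
      obtain ⟨f, hf, hfh⟩ := exists_inChain_height (E := E) (c := b) hlt.le
      refine hbad f (Or.inl (hf.trans hc3)) hfh ?_
      rintro rfl
      refine hE.chain_no_tx_below hbtx hf (by rintro rfl; omega)
        (hE.honest_tx g (hG g hGg).1 (hn'.trans_le (ht.monotone (by omega))))
    by_cases h1 : E.height (g + 1) ≤ E.height c
    · by_cases h2 : E.height (g + 1) ≤ E.height c'
      · -- both chains reach this height, and they are disjoint there
        obtain ⟨f, hf, hfh⟩ := exists_inChain_height (E := E) h1
        obtain ⟨f', hf', hfh'⟩ := exists_inChain_height (E := E) h2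
        by_cases hfg : f = g + 1
        · refine hbad f' (Or.inr hf') hfh' ?_
          intro hfg'
          have e1 : E.InChain b f := hc3.of_height_le hf (by omega)
          have e2 : E.InChain b' f := hc3'.of_height_le (hfg.trans hfg'.symm ▸ hf') (by omega)
          exact hne (e1.eq_of_height_eq e2 hbb')
        · exact hbad f (Or.inl hf) hfh hfg
      · obtain ⟨f, hf, hfh⟩ := exists_inChain_height (E := E) h1
        refine hbad f (Or.inl hf) hfh ?_
        rintro rfl
        have := hc5 g hf (by omega)
        rw [(hG g hGg).1] at this; simp at this
    · obtain ⟨f, hf, hfh⟩ := exists_inChain_height (E := E) (hle.resolve_left h1)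
      refine hbad f (Or.inr hf) hfh ?_
      rintro rfl
      have := hc5' g hf (by omega)
      rw [(hG g hGg).1] at this; simp at this
  obtain ⟨a, han, ha, had⟩ := hE.exists_height_le_add_lead hΔ ht h0 hG n
  set Gs := (Finset.Ico n (n + m)).filter fun i => G i = true with hGs
  set S₀ := Gs.filter fun i => E.height (i + 1) ≤ E.height c ∨ E.height (i + 1) ≤ E.height c'
    with hS₀
  -- at most one good block exceeds both chains: all but the last are known by then
  have hcard1 : Gs.card ≤ S₀.card + 1 := by
    have : (Gs.filter fun i =>
        ¬ (E.height (i + 1) ≤ E.height c ∨ E.height (i + 1) ≤ E.height c')).card ≤ 1 := by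
      have hlt : ∀ i ∈ Gs, ∀ j ∈ Gs, i < j →
          E.height (i + 1) ≤ E.height c ∨ E.height (i + 1) ≤ E.height c' := by
        intro i hi j hj hij
        simp only [hGs, Finset.mem_filter, Finset.mem_Ico] at hi hj
        have e1 : M.time (i + 1) ≤ M.time j := ht.monotone (by omega)
        have e2 : M.time (j + 1) ≤ M.time (n + m) := ht.monotone (by omega)
        have e3 := (hG j hj.2).2
        have e4 : ∀ v, E.recv v (i + 1) ≤ ((M.time (i + 1) + Δ : ℝ) : WithTop ℝ) :=
          fun v => hE.honest_publish i v (hG i hi.2).1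
        rcases le_total s s' with hss | hss
        · rw [max_eq_right hss] at hm
          exact Or.inr (hc2' _ ((e4 v').trans (WithTop.coe_le_coe.2 (by linarith))))
        · rw [max_eq_left hss] at hm
          exact Or.inl (hc2 _ ((e4 v).trans (WithTop.coe_le_coe.2 (by linarith))))
      refine Finset.card_le_one.2 fun i hi j hj => ?_
      rw [Finset.mem_filter] at hi hj
      rcases lt_trichotomy i j with hij | hij | hij
      · exact absurd (hlt i hi.1 j hj.1 hij) hi.2
      · exact hij
      · exact absurd (hlt j hj.1 i hi.1 hij) hj.2
    have h2 := Finset.card_filter_add_card_filter_not (s := Gs)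
      (fun i => E.height (i + 1) ≤ E.height c ∨ E.height (i + 1) ≤ E.height c')
    rw [← hS₀] at h2
    omega
  -- the heights available to bad blocks: those within the lead, and those of later bad blocks
  set Bs := (Finset.Ico n (n + m)).filter fun i => G i = false with hBs
  set U := Finset.Ioc (E.height a) (E.height a + lead G n) ∪
    Bs.image (fun i => E.height (i + 1)) with hU
  have hUcard : U.card ≤ lead G n + bad (shift n G) m := by
    refine (Finset.card_union_le _ _).trans ?_
    have hBc : Bs.card = bad (shift n G) m := card_filter_bad G n m
    rw [Nat.card_Ioc, ← hBc]
    have : (Bs.image (fun i => E.height (i + 1))).card ≤ Bs.card := Finset.card_image_le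
    omega
  have hmemU : ∀ f, (E.InChain (f + 1) c ∨ E.InChain (f + 1) c') → G f = false →
      (n ≤ f ∨ ∃ g, n ≤ g ∧ G g = true ∧ E.height (f + 1) = E.height (g + 1)) →
      E.height (f + 1) ∈ U := by
    intro f hf hGf hfn
    rcases le_or_gt n f with hnf | hnf
    · refine Finset.mem_union_right _ (Finset.mem_image.2 ⟨f, ?_, rfl⟩)
      have := hidx _ hf
      simp only [hBs, Finset.mem_filter, Finset.mem_Ico]
      exact ⟨⟨hnf, by omega⟩, hGf⟩
    · obtain ⟨g, hg, hGg, hfg⟩ := hfn.resolve_left (by omega)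
      refine Finset.mem_union_left _ (Finset.mem_Ioc.2 ⟨?_, had _ (by omega)⟩)
      have := hinc a g hGg (by omega) ha
      omega
  have hsub1 : S₀.image (fun i => E.height (i + 1)) ⊆ U := by
    intro l hl
    obtain ⟨g, hg, rfl⟩ := Finset.mem_image.1 hl
    simp only [hS₀, hGs, Finset.mem_filter, Finset.mem_Ico] at hg
    obtain ⟨f, hf, hGf, hfg⟩ := hmatch g hg.1.1.1 hg.1.2 hg.2
    exact hfg ▸ hmemU f hf hGf (Or.inr ⟨g, hg.1.1.1, hg.1.2, hfg⟩)
  have hsub2 : Finset.Ico h (h + k) ⊆ U := by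
    intro l hl
    rw [Finset.mem_Ico] at hl
    obtain ⟨f, hf, hfl⟩ := exists_inChain_height (E := E) (c := c) (l := l) (by omega)
    have hbf : E.InChain b f := hc3.of_height_le hf (by omega)
    have hnf : n < f := ht.lt_iff_lt.1
      (by have := ht.monotone hbf.le; linarith)
    obtain ⟨f, rfl⟩ : ∃ f', f = f' + 1 := ⟨f - 1, by omega⟩
    cases hGf : G f with
    | false => exact hfl ▸ hmemU f (Or.inl hf) hGf (Or.inl (by omega))
    | true =>
      obtain ⟨e, he, hGe, hef⟩ := hmatch f (by omega) hGf (Or.inl (by omega))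
      exact (hef.trans hfl) ▸ hmemU e he hGe (Or.inr ⟨f, by omega, hGf, hef⟩)
  have hk1 : k ≤ lead G n + bad (shift n G) m := by
    have := Finset.card_le_card hsub2
    rw [Nat.card_Ico] at this
    omega
  refine ⟨m, hk1, ?_⟩
  have h3 := Finset.card_le_card hsub1
  rw [Finset.card_image_of_injOn] at h3
  · have hGc : Gs.card = good (shift n G) m := card_filter_good G n m
    omega
  · intro i hi j hj hij
    simp only [hS₀, hGs, Finset.coe_filter, Finset.mem_filter, Set.mem_ofPred_eq] at hi hj
    exact huniq i j hi.1.2 hj.1.2 hij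

end Execution
end Nakamoto

namespace Nakamoto
namespace Execution

/-! ### Publication of all blocks -/

variable {N : Type*} {E E' : Execution N} {M : MiningPath N} {Δ τ : ℝ}

lemma height_congr {t : ℝ} (ht : Monotone M.time)
    (hpar : ∀ j, M.time (j + 1) ≤ t → E.parent j = E'.parent j) {c : ℕ} (hc : M.time c ≤ t) :
    E.height c = E'.height c := by
  induction c using Nat.strong_induction_on with
  | _ c ih =>
    cases c with
    | zero => simp
    | succ j =>
      have hlt := (E.parent j).isLt
      rw [height_succ, height_succ, ← hpar j hc, ih _ hlt ((ht hlt.le).trans hc)]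

lemma inChain_congr {t : ℝ} (ht : Monotone M.time)
    (hpar : ∀ j, M.time (j + 1) ≤ t → E.parent j = E'.parent j) {b c : ℕ} (hc : M.time c ≤ t) :
    E.InChain b c ↔ E'.InChain b c := by
  induction c using Nat.strong_induction_on with
  | _ c ih =>
    cases c with
    | zero => rw [inChain_zero, inChain_zero]
    | succ j =>
      have hlt := (E.parent j).isLt
      rw [inChain_succ, inChain_succ, ← hpar j hc, ih _ hlt ((ht hlt.le).trans hc)]

/-- Whether safety is violated by time `t` depends only on the blocks mined by then and on what is
received by then. -/
lemma ViolatedBy.congr {k : ℕ} {t : ℝ} (ht : Monotone M.time)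
    (hpar : ∀ j, M.time (j + 1) ≤ t → E.parent j = E'.parent j)
    (htx : ∀ j, M.time j ≤ t → (E.hasTx j ↔ E'.hasTx j))
    (hrecv : ∀ n j (s : ℝ), s ≤ t →
      (E.recv n j ≤ (s : WithTop ℝ) ↔ E'.recv n j ≤ (s : WithTop ℝ)))
    (htime : ∀ n j, (M.time j : WithTop ℝ) ≤ E.recv n j)
    (h : E.ViolatedBy k t) : E'.ViolatedBy k t := by
  have hle : ∀ {n j} {s : ℝ}, s ≤ t → E.recv n j ≤ (s : WithTop ℝ) → M.time j ≤ t :=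
    fun hs h => (WithTop.coe_le_coe.1 ((htime _ _).trans h)).trans hs
  have hcom : ∀ {n b} {s : ℝ}, s ≤ t → E.Commits k n b s →
      M.time b ≤ t ∧ E'.Commits k n b s := by
    rintro n b s hs ⟨c, h1, h2, h3, h4⟩
    have hc := hle hs h1
    have hb := (ht h3.le).trans hc
    refine ⟨hb, c, (hrecv _ _ _ hs).1 h1, fun d hd => ?_, (inChain_congr ht hpar hc).1 h3, ?_⟩
    · have hd := (hrecv _ _ _ hs).2 hd
      rw [← height_congr ht hpar (hle hs hd), ← height_congr ht hpar hc]
      exact h2 d hd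
    · rwa [← height_congr ht hpar hb, ← height_congr ht hpar hc]
  obtain ⟨b, b', h1, h2, h3, n, n', s, s', hs, hs', hc, hc'⟩ := h
  obtain ⟨hb, hc⟩ := hcom hs hc
  obtain ⟨hb', hc'⟩ := hcom hs' hc'
  refine ⟨b, b', (htx b hb).1 h1, h2, ?_, n, n', s, s', hs, hs', hc, hc'⟩
  rwa [← height_congr ht hpar hb, ← height_congr ht hpar hb']

@[simp] lemma height_publishAt (t : ℝ) (c : ℕ) : (E.publishAt M t).height c = E.height c := by
  induction c using Nat.strong_induction_on with
  | _ c ih =>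
    cases c with
    | zero => simp
    | succ j => rw [height_succ, height_succ]; exact congrArg (· + 1) (ih _ (E.parent j).isLt)

@[simp] lemma inChain_publishAt {t : ℝ} {b c : ℕ} :
    (E.publishAt M t).InChain b c ↔ E.InChain b c := by
  induction c using Nat.strong_induction_on with
  | _ c ih =>
    cases c with
    | zero => rw [inChain_zero, inChain_zero]
    | succ j => rw [inChain_succ, inChain_succ]; exact or_congr_right (ih _ (E.parent j).isLt)

lemma recv_publishAt_le_of_lt {t s : ℝ} (hs : s < t) {n : N} {j : ℕ} :
    (E.publishAt M t).recv n j ≤ (s : WithTop ℝ) ↔ E.recv n j ≤ (s : WithTop ℝ) := by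
  have : ¬ (t : WithTop ℝ) ≤ s := by simpa using hs
  unfold publishAt
  dsimp only
  split_ifs <;> simp [this]

lemma recv_publishAt_le_self {t : ℝ} (ht : ∀ n j, (M.time j : WithTop ℝ) ≤ E.recv n j) {n : N}
    {j : ℕ} : (E.publishAt M t).recv n j ≤ (t : WithTop ℝ) ↔ M.time j ≤ t := by
  unfold publishAt
  dsimp only
  split_ifs with h
  · simp [h]
  · simp only [h, iff_false]
    intro h2
    exact h (WithTop.coe_le_coe.1 ((ht n j).trans h2))

lemma time_le_recv_publishAt {t : ℝ} (ht : ∀ n j, (M.time j : WithTop ℝ) ≤ E.recv n j) (n : N)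
    (j : ℕ) : (M.time j : WithTop ℝ) ≤ (E.publishAt M t).recv n j := by
  unfold publishAt
  dsimp only
  split_ifs with h
  · exact le_min (ht n j) (WithTop.coe_le_coe.2 h)
  · exact ht n j

/-- Once all blocks mined by time `s` have been published at time `s`, what the adversary could
violate by doing so is violated. -/
lemma Legal.violated_of_canViolate (hE : E.Legal M Δ τ) (ht : Monotone M.time)
    (h0 : M.time 0 = 0) {k : ℕ} {s : ℝ}
    (hpub : ∀ j n, (M.time (j + 1) : WithTop ℝ) ≤ (s : WithTop ℝ) →
      E.recv n (j + 1) ≤ (s : WithTop ℝ)) (h : E.CanViolate M k s) : E.Violated k := by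
  refine ⟨s, ViolatedBy.congr ht (E := E.publishAt M s) (fun _ _ => rfl) (fun _ _ => Iff.rfl) ?_
    (time_le_recv_publishAt hE.time_le_recv) h⟩
  intro n j s' hs'
  rcases hs'.lt_or_eq with hs' | rfl
  · exact recv_publishAt_le_of_lt hs'
  · rw [recv_publishAt_le_self hE.time_le_recv]
    refine ⟨fun hj => ?_, hE.time_le_of_recv_le⟩
    cases j with
    | zero => rw [hE.genesis]; simpa [h0] using hj
    | succ j => exact hpub j n (WithTop.coe_le_coe.2 hj)

/-! ### Private mining succeeds when the adversary wins the walk -/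

open Classical in
/-- The greatest height among the blocks `0, …, j` that satisfy `p`. -/
noncomputable def maxHeight (E : Execution N) (p : ℕ → Prop) (j : ℕ) : ℕ :=
  ((Finset.range (j + 1)).filter p).sup E.height

lemma le_maxHeight {p : ℕ → Prop} {i j : ℕ} (hij : i ≤ j) (hi : p i) :
    E.height i ≤ E.maxHeight p j := by
  classical
  exact Finset.le_sup (f := E.height)
    (Finset.mem_filter.2 ⟨Finset.mem_range.2 (Nat.lt_succ_of_le hij), hi⟩)

lemma maxHeight_le {p : ℕ → Prop} {j a : ℕ} (h : ∀ i ≤ j, p i → E.height i ≤ a) :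
    E.maxHeight p j ≤ a := by
  classical
  refine Finset.sup_le fun i hi => ?_
  rw [Finset.mem_filter, Finset.mem_range] at hi
  exact h i (Nat.lt_succ_iff.1 hi.1) hi.2

lemma exists_height_eq_maxHeight {p : ℕ → Prop} (h0 : p 0) (j : ℕ) :
    ∃ i ≤ j, p i ∧ E.height i = E.maxHeight p j := by
  classical
  obtain ⟨i, hi, h⟩ := Finset.exists_mem_eq_sup ((Finset.range (j + 1)).filter p)
    ⟨0, by simp [h0]⟩ E.height
  rw [Finset.mem_filter, Finset.mem_range] at hi
  exact ⟨i, Nat.lt_succ_iff.1 hi.1, hi.2, h.symm⟩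

lemma maxHeight_mono (p : ℕ → Prop) : Monotone (E.maxHeight p) := fun _ _ hij =>
  maxHeight_le fun _ hi hp => le_maxHeight (hi.trans hij) hp

lemma Legal.not_chainHasTx (hE : E.Legal M Δ τ) (ht : Monotone M.time) {j : ℕ}
    (hj : M.time j ≤ τ) : ¬ E.ChainHasTx j := by
  rintro ⟨b, hb, htx⟩
  have := hE.tx_after b htx
  have := ht hb.le
  linarith

/-- If the mined blocks are such that the adversary wins the walk, then private mining violates
safety. Delays only slow down the honest chain: its height grows by at most one per honest block,
whereas the longest chain without the transaction grows with every adversarial block. -/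
theorem Legal.violated_of_shift_mem_winSet (hE : E.Legal M Δ τ) {k : ℕ}
    (hP : E.IsPrivateMining M Δ k) (hk : 1 ≤ k) (hΔ : 0 ≤ Δ) (ht : StrictMono M.time)
    (h0 : M.time 0 = 0)
    (hlag : ∀ i, ∃ j ≥ i, M.honest (j + 1) = true ∧ M.time j + Δ < M.time (j + 1))
    {n : ℕ} (hn : M.time n ≤ τ) (hn' : τ < M.time (n + 1))
    (hw : shift n (fun j => M.honest (j + 1)) ∈
      winSet 0 k (lead (fun j => M.honest (j + 1)) n)) : E.Violated k := by
  by_contra hv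
  obtain ⟨hadv, σ, -, hpriv, hpub, hcan, hnot⟩ := hP
  -- without a violation, nothing is ever published
  obtain rfl : σ = ⊤ := by
    by_contra hσ
    obtain ⟨s, rfl⟩ := WithTop.ne_top_iff_exists.1 hσ
    exact hv (hE.violated_of_canViolate ht.monotone h0 hpub (hcan s rfl))
  set η : ℕ → Bool := fun j => M.honest (j + 1) with hη
  set hon : ℕ → Prop := fun i => i = 0 ∨ M.honest i = true with hhon
  have hknown : ∀ v d, E.recv v d < ⊤ → hon d := by
    intro v d hd
    cases d with
    | zero => exact Or.inl rfl
    | succ d =>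
      by_contra hh
      have hf : M.honest (d + 1) = false := by simpa [hhon] using hh
      exact absurd (hpriv d v hf) (not_le.2 hd)
  set D := E.maxHeight hon with hD
  set A := E.maxHeight (fun d => ¬ E.ChainHasTx d) with hA
  have hpre : ∀ {j}, M.time j ≤ τ → ¬ E.ChainHasTx j := fun hj =>
    hE.not_chainHasTx ht.monotone hj
  have hfree0 : ¬ E.ChainHasTx 0 := hpre ((ht.monotone (Nat.zero_le n)).trans hn)
  have hparent : ∀ j, M.honest (j + 1) = true → hon (E.parent j) ∧ (E.parent j : ℕ) ≤ j :=
    fun j hj => ⟨hknown _ _ ((hE.honest_parent j hj).1.trans (WithTop.coe_lt_top _)),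
      Nat.lt_succ_iff.1 (E.parent j).isLt⟩
  have hDsucc : ∀ j, D (j + 1) ≤ D j + if η j = true then 1 else 0 := by
    intro j
    refine maxHeight_le fun i hi hp => ?_
    rcases Nat.eq_or_lt_of_le hi with rfl | hi
    · have hj : M.honest (j + 1) = true := hp.resolve_left (by omega)
      have := le_maxHeight (E := E) (hparent j hj).2 (hparent j hj).1
      change _ ≤ D j at this
      rw [height_succ, if_pos (show η j = true from hj)]
      omega
    · exact (le_maxHeight (by omega) hp).trans (Nat.le_add_right _ _)
  have hAsucc : ∀ j, η j = false → A j + 1 ≤ A (j + 1) := by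
    intro j hj
    obtain ⟨d, hd, hdf, hdh⟩ := exists_height_eq_maxHeight (E := E)
      (p := fun d => ¬ E.ChainHasTx d) hfree0 j
    have h1 := (hadv j hj).2 d hd hdf
    have h2 := le_maxHeight (E := E) (p := fun d => ¬ E.ChainHasTx d) le_rfl (hadv j hj).1
    rw [height_succ] at h2
    change _ = A j at hdh
    change _ ≤ A (j + 1) at h2
    omega
  have hAmono : Monotone A := maxHeight_mono _
  have hbefore : ∀ j ≤ n, D j + lead η j ≤ A j := by
    intro j hj
    have hDA : ∀ j ≤ n, D j ≤ A j := fun j hj => maxHeight_le fun i hi _ =>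
      le_maxHeight hi (hpre ((ht.monotone (hi.trans hj)).trans hn))
    induction j with
    | zero => simpa [lead] using hDA 0 hj
    | succ j ih =>
      have h1 := ih (by omega)
      have h2 := hDsucc j
      have h3 := hDA (j + 1) hj
      have h4 := hAmono (Nat.le_succ j)
      rw [Nat.succ_eq_add_one] at h4
      rw [lead]
      split_ifs with hy
      · rw [if_pos hy] at h2; omega
      · rw [if_neg hy] at h2
        have := hAsucc j (by simpa using hy)
        omega
  have hafter : ∀ m, D n + lead η n + bad (shift n η) m ≤ A (n + m) ∧
      D (n + m) ≤ D n + good (shift n η) m := by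
    intro m
    induction m with
    | zero => simpa using hbefore n le_rfl
    | succ m ih =>
      have h2 := hDsucc (n + m)
      have h4 := hAmono (Nat.le_succ (n + m))
      rw [Nat.succ_eq_add_one] at h4
      have hs : shift n η m = η (n + m) := rfl
      rw [good_succ, bad_succ, hs, ← Nat.add_assoc n m 1]
      cases hy : η (n + m) with
      | true => simp [hy] at h2 ⊢; omega
      | false =>
        have := hAsucc _ hy
        simp [hy] at h2 ⊢; omega
  -- the honest chain grows without bound, one level at a time
  have hunb : ∀ K, ∃ q, K ≤ D q := by
    intro K
    induction K with
    | zero => exact ⟨0, Nat.zero_le _⟩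
    | succ K ih =>
      obtain ⟨q, hq⟩ := ih
      obtain ⟨j, hj, hjh, hjt⟩ := hlag q
      refine ⟨j + 1, ?_⟩
      obtain ⟨i, hi, hip, hih⟩ := exists_height_eq_maxHeight (E := E) (p := hon) (Or.inl rfl) q
      have h1 := hE.height_lt_of_lagger hΔ ht h0 hjh hjt (hi.trans hj) hip
      have h2 := le_maxHeight (E := E) (p := hon) le_rfl (Or.inr hjh)
      change _ = D q at hih
      change _ ≤ D (j + 1) at h2
      omega
  obtain ⟨q, hq1, hq2⟩ : ∃ q, D n + k ≤ D q ∧ D q ≤ A q := by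
    classical
    obtain ⟨m, hm1, hm2⟩ := hw
    obtain ⟨ha, hd⟩ := hafter m
    rcases le_or_gt (D n + k) (D (n + m)) with h | h
    · exact ⟨n + m, h, by omega⟩
    · have hex := hunb (D n + k)
      refine ⟨Nat.find hex, Nat.find_spec hex, ?_⟩
      have h1 : n + m < Nat.find hex := by
        by_contra hcon
        have := maxHeight_mono (E := E) hon (not_lt.1 hcon)
        have h2 := Nat.find_spec hex
        change D _ ≤ D _ at this
        omega
      have h2 := Nat.find_min hex (m := Nat.find hex - 1) (by omega)
      have h3 := hDsucc (Nat.find hex - 1)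
      have h4 := hAmono h1.le
      rw [Nat.sub_add_cancel (by omega)] at h3
      split_ifs at h3 <;> omega
  -- the first honest block of height `D n + k` commits the transaction
  obtain ⟨c, hcq, hchon, hck, hcmin⟩ : ∃ c ≤ q, hon c ∧ D n + k ≤ E.height c ∧
      ∀ d, hon d → d < c → E.height d < D n + k := by
    classical
    obtain ⟨i, hi, hip, hih⟩ := exists_height_eq_maxHeight (E := E) (p := hon) (Or.inl rfl) q
    have hex : ∃ c, hon c ∧ D n + k ≤ E.height c := ⟨i, hip, by rw [hih]; exact hq1⟩
    refine ⟨Nat.find hex, (Nat.find_min' hex ⟨hip, by rw [hih]; exact hq1⟩).trans hi,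
      (Nat.find_spec hex).1, (Nat.find_spec hex).2, fun d hd hdc => ?_⟩
    by_contra hcon
    exact Nat.find_min hex hdc ⟨hd, not_lt.1 hcon⟩
  have hlate : ∀ i, hon i → D n < E.height i → M.honest i = true ∧ τ < M.time i := by
    intro i hi hlt
    have h1 : n < i := by
      by_contra hcon
      have := le_maxHeight (E := E) (not_lt.1 hcon) hi
      change _ ≤ D n at this
      omega
    exact ⟨hi.resolve_left (by omega), hn'.trans_le (ht.monotone h1)⟩
  obtain ⟨j, rfl⟩ : ∃ j, c = j + 1 := ⟨c - 1, by
    have : c ≠ 0 := by rintro rfl; simp at hck; omega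
    omega⟩
  obtain ⟨hcH, hcτ⟩ := hlate _ hchon (by omega)
  obtain ⟨b, hbc, hbtx⟩ := hE.honest_tx j hcH hcτ
  -- a block of the honest chain above height `D n` already has the transaction in its chain
  have hbh : E.height b ≤ D n + 1 := by
    by_contra hcon
    obtain ⟨i, rfl⟩ : ∃ i, b = i + 1 := ⟨b - 1, by
      have : b ≠ 0 := by rintro rfl; simp at hcon
      omega⟩
    have hbhon : hon (i + 1) := hknown (M.miner (j + 1)) _
      ((hE.recv_le_of_inChain hbc _).trans_lt
        (by rw [hE.honest_own j hcH]; exact WithTop.coe_lt_top _))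
    have hbH : M.honest (i + 1) = true := hbhon.resolve_left (by omega)
    rw [height_succ] at hcon
    obtain ⟨hpH, hpτ⟩ := hlate _ (hparent i hbH).1 (by omega)
    have hpi := (hparent i hbH).2
    have hp0 : (E.parent i : ℕ) ≠ 0 := by
      intro hp0; rw [hp0] at hcon; simp at hcon
    obtain ⟨l, hl⟩ : ∃ l, (E.parent i : ℕ) = l + 1 := ⟨(E.parent i : ℕ) - 1, by omega⟩
    refine hE.chain_no_tx_below hbtx (InChain.step (InChain.refl _)) (by omega) ?_
    rw [hl] at hpH hpτ ⊢
    exact hE.honest_tx l hpH hpτ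
  -- on publication, a longest chain without the transaction is longest of all
  obtain ⟨a, haq, hafree, hah⟩ := exists_height_eq_maxHeight (E := E)
    (p := fun d => ¬ E.ChainHasTx d) hfree0 q
  change _ = A q at hah
  obtain ⟨b', hb'a, hb'h⟩ := exists_inChain_height (E := E) (c := a) (l := E.height b) (by omega)
  have hbb' : b ≠ b' := by
    rintro rfl
    exact hafree ⟨b, hb'a, hbtx⟩
  obtain ⟨t, hqt, htq⟩ := exists_between (ht (Nat.lt_succ_self q))
  refine hnot (q + 1) t htq le_top ?_
  have hct : M.time (j + 1) < t := (ht.monotone hcq).trans_lt hqt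
  refine ⟨b, b', hbtx, hbb', by simpa using hb'h.symm, M.miner (j + 1), M.miner (j + 1),
    M.time (j + 1), t, hct.le, le_rfl, ⟨j + 1, ?_, fun d hd => ?_, ?_, ?_⟩,
    ⟨a, ?_, fun d hd => ?_, ?_, ?_⟩⟩
  · exact (recv_publishAt_le_of_lt hct).2 (hE.honest_own j hcH).le
  · rw [recv_publishAt_le_of_lt hct] at hd
    rw [height_publishAt, height_publishAt]
    have hd1 := hknown _ _ (hd.trans_lt (WithTop.coe_lt_top _))
    have hd2 : d ≤ j + 1 := ht.le_iff_le.1 (hE.time_le_of_recv_le hd)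
    rcases Nat.eq_or_lt_of_le hd2 with rfl | hd2
    · exact le_rfl
    · exact (hcmin d hd1 hd2).le.trans hck
  · simpa using hbc
  · simp only [height_publishAt]; omega
  · exact (recv_publishAt_le_self hE.time_le_recv).2 ((ht.monotone haq).trans hqt.le)
  · rw [recv_publishAt_le_self hE.time_le_recv] at hd
    rw [height_publishAt, height_publishAt]
    have hdq : d ≤ q := by
      have := ht.lt_iff_lt.1 (hd.trans_lt htq); omega
    by_cases hdf : E.ChainHasTx d
    · have hdhon : hon d := by
        cases d with
        | zero => exact Or.inl rfl
        | succ d =>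
          by_contra hcon
          have hf : M.honest (d + 1) = false := by simpa [hhon] using hcon
          exact (hadv d hf).1 hdf
      have := le_maxHeight (E := E) hdq hdhon
      change _ ≤ D q at this
      omega
    · have := le_maxHeight (E := E) (p := fun d => ¬ E.ChainHasTx d) hdq hdf
      change _ ≤ A q at this
      omega
  · simpa using hb'a
  · simp only [height_publishAt]; omega

end Execution
end Nakamoto

namespace Nakamoto
namespace Execution

/-! ### Without delays, private mining succeeds only if the adversary wins the walk -/

variable {N : Type*} {E : Execution N} {M : MiningPath N} {τ : ℝ}

/-- Without delays, the honest blocks mined before the publication time `σ` form a chain. -/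
lemma Legal.inChain_of_honest (hE : E.Legal M 0 τ) (ht : StrictMono M.time) (h0 : M.time 0 = 0)
    {σ : WithTop ℝ} (hknown : ∀ v d, E.recv v d < σ → d = 0 ∨ M.honest d = true) {i j : ℕ}
    (hi : M.honest (i + 1) = true) (hj : j = 0 ∨ M.honest j = true) (hij : i + 1 ≤ j)
    (hσ : (M.time j : WithTop ℝ) ≤ σ) : E.InChain (i + 1) j := by
  induction j using Nat.strong_induction_on with
  | _ j ih =>
    rcases Nat.eq_or_lt_of_le hij with rfl | hlt
    · exact .refl _
    obtain ⟨j, rfl⟩ : ∃ j', j = j' + 1 := ⟨j - 1, by omega⟩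
    have hj : M.honest (j + 1) = true := hj.resolve_left (by omega)
    obtain ⟨hp1, hp2⟩ := hE.honest_parent j hj
    have hpar := hknown _ _ (hp1.trans_le hσ)
    have hpj := (E.parent j).isLt
    have hknow : E.recv (M.miner (j + 1)) (i + 1) < (M.time (j + 1) : WithTop ℝ) := by
      refine (hE.honest_publish i _ hi).trans_lt (WithTop.coe_lt_coe.2 ?_)
      rw [add_zero]; exact ht hlt
    have hh := hp2 _ hknow
    refine .step (ih _ hpj hpar ?_ ((WithTop.coe_le_coe.2 (ht.monotone hpj.le)).trans hσ))
    by_contra hcon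
    have := hE.height_lt_of_lagger le_rfl ht h0 hi (by rw [add_zero]; exact ht (Nat.lt_succ_self i))
      (Nat.lt_succ_iff.1 (not_le.1 hcon)) hpar
    omega

/-- Without delays, a violation by private mining needs a win of the adversary in the walk. -/
theorem Legal.shift_mem_winSet_of_privateMining (hE : E.Legal M 0 τ) {k : ℕ}
    (hP : E.IsPrivateMining M 0 k) (ht : StrictMono M.time) (h0 : M.time 0 = 0)
    (hlim : Filter.Tendsto M.time Filter.atTop Filter.atTop)
    {n : ℕ} (hn : M.time n ≤ τ) (hn' : τ < M.time (n + 1)) (hv : E.Violated k) :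
    shift n (fun j => M.honest (j + 1)) ∈ winSet 0 k (lead (fun j => M.honest (j + 1)) n) := by
  obtain ⟨hadv, σ, -, hpriv, -, hcan, -⟩ := hP
  set η : ℕ → Bool := fun j => M.honest (j + 1) with hη
  set hon : ℕ → Prop := fun i => i = 0 ∨ M.honest i = true with hhon
  have hknown : ∀ v d, E.recv v d < σ → hon d := by
    intro v d hd
    cases d with
    | zero => exact Or.inl rfl
    | succ d =>
      by_contra hh
      have hf : M.honest (d + 1) = false := by simpa [hhon] using hh
      exact absurd (hpriv d v hf) (not_le.2 hd)
  have hinc : ∀ i j, M.honest (j + 1) = true → i ≤ j → hon i → E.height i < E.height (j + 1) :=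
    fun i j hj hij hi => hE.height_lt_of_lagger le_rfl ht h0 hj
      (by rw [add_zero]; exact ht (Nat.lt_succ_self j)) hij hi
  have hτ0 : M.time 0 ≤ τ := (ht.monotone (Nat.zero_le n)).trans hn
  have htxhon : ∀ b, E.hasTx b → b ≠ 0 ∧ M.honest b = true := by
    intro b hb
    cases b with
    | zero => exact absurd (hE.tx_after 0 hb) (not_lt.2 hτ0)
    | succ b =>
      refine ⟨by omega, ?_⟩
      by_contra hf
      exact (hadv b (by simpa using hf)).1 ⟨_, .refl _, hb⟩
  -- one of two blocks on the same height is adversarial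
  have hadvb : ∀ b b', E.hasTx b → b ≠ b' → E.height b = E.height b' →
      ∃ j, b' = j + 1 ∧ M.honest (j + 1) = false := by
    intro b b' hb hne hh
    obtain ⟨hb0, hbh⟩ := htxhon b hb
    cases b' with
    | zero => simp at hh; exact absurd (height_eq_zero hh) hb0
    | succ j =>
      refine ⟨j, rfl, ?_⟩
      by_contra hf
      have hf : M.honest (j + 1) = true := by simpa using hf
      obtain ⟨i, rfl⟩ : ∃ i, b = i + 1 := ⟨b - 1, by omega⟩
      rcases lt_trichotomy i j with hlt | heq | hlt
      · have := hinc (i + 1) j hf (by omega) (Or.inr hbh); omega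
      · exact hne (by rw [heq])
      · have := hinc (j + 1) i hbh (by omega) (Or.inr hf); omega
  obtain ⟨s, rfl⟩ : ∃ s : ℝ, (s : WithTop ℝ) = σ := by
    refine WithTop.ne_top_iff_exists.1 ?_
    rintro rfl
    obtain ⟨_, b, b', hb, hne, hh, v, v', t, t', -, -, -, c', h1, -, h3, -⟩ := hv
    obtain ⟨j, rfl, hj⟩ := hadvb b b' hb hne hh
    have := (hE.recv_le_of_inChain h3 v').trans h1
    exact absurd ((hpriv j v' hj).trans this) (not_le.2 (WithTop.coe_lt_top _))
  obtain ⟨b, b', hb, hne, hh, v, v', t, t', ht1, ht2, ⟨c, hc1, -, hc3, -⟩,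
    ⟨c', h1, h2, h3, h4⟩⟩ := hcan s rfl
  simp only [height_publishAt, inChain_publishAt] at hh h2 h3 h4 hc3
  change E.hasTx b at hb
  obtain ⟨j, rfl, hj⟩ := hadvb b b' hb hne hh
  have hcs : M.time c ≤ s := (WithTop.coe_le_coe.1
    ((time_le_recv_publishAt hE.time_le_recv v c).trans hc1)).trans ht1
  -- the other block is known to honest nodes only after publication
  obtain rfl : t' = s := by
    by_contra hts
    rw [recv_publishAt_le_of_lt (lt_of_le_of_ne ht2 hts)] at h1
    have := (hpriv j v' hj).trans ((hE.recv_le_of_inChain h3 v').trans h1)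
    exact hts (le_antisymm ht2 (WithTop.coe_le_coe.1 this))
  have hcs' : M.time c' ≤ t' := (recv_publishAt_le_self hE.time_le_recv).1 h1
  have h2 : ∀ d, M.time d ≤ t' → E.height d ≤ E.height c' := fun d hd =>
    h2 d ((recv_publishAt_le_self hE.time_le_recv).2 hd)
  have hbs : M.time b ≤ t' := (ht.monotone hc3.le).trans hcs
  -- the transaction is in one block only, so `c'` does not contain it
  have hc'tx : ¬ E.ChainHasTx c' := by
    rintro ⟨b₀, hb₀c, hb₀⟩
    have hb₀s : M.time b₀ ≤ t' := (ht.monotone hb₀c.le).trans hcs'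
    have hchain : ∀ x y, E.hasTx x → E.hasTx y → x ≤ y → M.time y ≤ t' → x = y := by
      intro x y hx hy hxy hys
      obtain ⟨hx0, hxh⟩ := htxhon x hx
      obtain ⟨i, rfl⟩ : ∃ i, x = i + 1 := ⟨x - 1, by omega⟩
      exact hE.tx_once _ _ hx hy (hE.inChain_of_honest ht h0 hknown hxh
        (Or.inr (htxhon y hy).2) hxy (WithTop.coe_le_coe.2 hys))
    have : b₀ = b := by
      rcases le_total b₀ b with hle | hle
      · exact hchain _ _ hb₀ hb hle hbs
      · exact (hchain _ _ hb hb₀ hle hb₀s).symm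
    subst this
    exact hne (hb₀c.eq_of_height_eq h3 hh)
  have hlow : ∀ j, ∃ a ≤ j, hon a ∧ good η j ≤ E.height a := by
    intro j
    induction j with
    | zero => exact ⟨0, le_rfl, Or.inl rfl, by simp⟩
    | succ j ih =>
      obtain ⟨a, haj, ha, hga⟩ := ih
      rw [good_succ]
      cases hy : η j with
      | false => exact ⟨a, by omega, ha, by simpa using hga⟩
      | true =>
        have := hinc a j hy haj ha
        exact ⟨j + 1, le_rfl, Or.inr hy, by simp; omega⟩
  have hhigh : ∀ j, ∀ d ≤ j, M.time d ≤ t' → hon d → E.height d ≤ good η j := by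
    intro j
    induction j with
    | zero => intro d hd _ _; simp [Nat.le_zero.1 hd]
    | succ j ih =>
      intro d hd hds hdh
      rw [good_succ]
      rcases Nat.eq_or_lt_of_le hd with rfl | hd
      · have hjh : M.honest (j + 1) = true := hdh.resolve_left (by omega)
        have hpl := (E.parent j).isLt
        have hph := hknown _ _ ((hE.honest_parent j hjh).1.trans_le (WithTop.coe_le_coe.2 hds))
        have := ih (E.parent j) (by omega) ((ht.monotone hpl.le).trans hds) hph
        rw [height_succ, if_pos (show η j = true from hjh)]
        omega
      · have := ih d (by omega) hds hdh
        omega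
  have hbefore : ∀ j, ∀ d ≤ j, M.time d ≤ t' → E.height d ≤ good η j + lead η j := by
    intro j
    induction j with
    | zero => intro d hd _; simp [Nat.le_zero.1 hd]
    | succ j ih =>
      intro d hd hds
      by_cases hdh : hon d
      · exact (hhigh (j + 1) d hd hds hdh).trans (Nat.le_add_right _ _)
      rw [good_succ, lead]
      rcases Nat.eq_or_lt_of_le hd with rfl | hd
      · have hpl := (E.parent j).isLt
        have := ih (E.parent j) (by omega) ((ht.monotone hpl.le).trans hds)
        have hy : η j = false := by
          by_contra hf; exact hdh (Or.inr (by simpa using hf))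
        rw [height_succ]; simp [hy]; omega
      · have := ih d (by omega) hds
        cases hy : η j with
        | false => simp; omega
        | true => simp; omega
  have hafter : ∀ m, ∀ d ≤ n + m, M.time d ≤ t' → ¬ E.ChainHasTx d →
      E.height d ≤ good η n + lead η n + bad (shift n η) m := by
    intro m
    induction m with
    | zero => intro d hd hds _; simpa using hbefore n d hd hds
    | succ m ih =>
      intro d hd hds hdf
      rw [bad_succ]
      rcases Nat.eq_or_lt_of_le hd with rfl | hd
      · rw [← Nat.add_assoc] at hdf hds ⊢
        have hy : shift n η m = false := by
          by_contra hf
          exact hdf (hE.honest_tx (n + m) (by simpa [shift, hη] using hf)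
            (hn'.trans_le (ht.monotone (by omega))))
        have hpl := (E.parent (n + m)).isLt
        have := ih (E.parent (n + m)) (by omega) ((ht.monotone hpl.le).trans hds)
          fun hcon => hdf (hcon.mono (.step (.refl _)))
        rw [height_succ, if_pos hy]; omega
      · have := ih d (by omega) hds hdf; omega
  have hbτ := hE.tx_after b hb
  obtain ⟨m, hm, hm'⟩ := exists_last_index ht hlim (n := n) (T := t') (by linarith)
  refine ⟨m, ?_, ?_⟩
  · obtain ⟨a, han, ha, hga⟩ := hlow n
    obtain ⟨hb0, hbh⟩ := htxhon b hb
    obtain ⟨i, rfl⟩ : ∃ i, b = i + 1 := ⟨b - 1, by omega⟩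
    have hni : n < i + 1 := ht.lt_iff_lt.1 (by linarith)
    have h5 := hinc a i hbh (by omega) ha
    have h6 := hafter m c' (by have := ht.lt_iff_lt.1 (hcs'.trans_lt hm'); omega) hcs' hc'tx
    omega
  · obtain ⟨a, han, ha, hga⟩ := hlow (n + m)
    have h5 := h2 a ((ht.monotone han).trans hm)
    have h6 := hafter m c' (by have := ht.lt_iff_lt.1 (hcs'.trans_lt hm'); omega) hcs' hc'tx
    rw [good_add] at hga
    omega

end Execution
end Nakamoto

namespace Nakamoto
namespace Execution

/-! ### Carrying out the private-mining attack -/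

variable {N : Type*} {M : MiningPath N} {Δ τ : ℝ}

open Classical in
/-- When the nodes receive the blocks under private mining with publication at time `σ`. After
publication, every block is received by all nodes as soon as it is mined. -/
noncomputable def attackRecv (M : MiningPath N) (Δ : ℝ) (σ : WithTop ℝ) (n : N) (j : ℕ) :
    WithTop ℝ :=
  if j = 0 then ((0 : ℝ) : WithTop ℝ)
  else if M.honest j = true ∧ n = M.miner j then (M.time j : WithTop ℝ)
  else if (M.time j : WithTop ℝ) ≤ σ then
    if M.honest j = true then min ((M.time j + Δ : ℝ) : WithTop ℝ) σ else σ
  else (M.time j : WithTop ℝ)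

open Classical in
/-- A block among `0, …, j` of maximal height among those that satisfy `C`, where `f` lists the
heights; the genesis block if no block satisfies `C`. -/
noncomputable def highest {j : ℕ} (f : Fin (j + 1) → ℕ) (C : Fin (j + 1) → Prop) : Fin (j + 1) :=
  if h : ∃ p, C p ∧ ∀ q, C q → f q ≤ f p then h.choose else 0

lemma highest_spec {j : ℕ} (f : Fin (j + 1) → ℕ) {C : Fin (j + 1) → Prop} (h : ∃ p, C p) :
    C (highest f C) ∧ ∀ q, C q → f q ≤ f (highest f C) := by
  classical
  have hex : ∃ p, C p ∧ ∀ q, C q → f q ≤ f p := by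
    obtain ⟨p₀, hp₀⟩ := h
    obtain ⟨p, hp, hmax⟩ := Finset.exists_max_image (Finset.univ.filter C) f ⟨p₀, by simpa⟩
    exact ⟨p, by simpa using hp, fun q hq => hmax q (by simpa using hq)⟩
  rw [highest, dif_pos hex]
  exact hex.choose_spec

open Classical in
/-- The predecessor of block `j + 1` under private mining, given the heights of the blocks
`0, …, j` and whether their chains contain the transaction. -/
noncomputable def attackParent (M : MiningPath N) (Δ : ℝ) (σ : WithTop ℝ) (j : ℕ)
    (f : Fin (j + 1) → ℕ × Prop) : Fin (j + 1) :=
  highest (fun d => (f d).1) fun d =>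
    if M.honest (j + 1) = true then
      attackRecv M Δ σ (M.miner (j + 1)) d < (M.time (j + 1) : WithTop ℝ)
    else ¬ (f d).2

/-- The height of each block under private mining, and whether its chain contains the
transaction. -/
noncomputable def attackData (M : MiningPath N) (Δ τ : ℝ) (σ : WithTop ℝ) : ℕ → ℕ × Prop
  | 0 => (0, False)
  | j + 1 =>
    let p := attackData M Δ τ σ (attackParent M Δ σ j fun d => attackData M Δ τ σ d)
    (p.1 + 1, p.2 ∨ (M.honest (j + 1) = true ∧ τ < M.time (j + 1)))
decreasing_by all_goals exact Fin.isLt _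

/-- Private mining with publication at time `σ`. -/
noncomputable def attack (M : MiningPath N) (Δ τ : ℝ) (σ : WithTop ℝ) : Execution N where
  parent j := attackParent M Δ σ j fun d => attackData M Δ τ σ d
  hasTx b := match b with
    | 0 => False
    | j + 1 => M.honest (j + 1) = true ∧ τ < M.time (j + 1) ∧
        ¬ (attackData M Δ τ σ (attackParent M Δ σ j fun d => attackData M Δ τ σ d)).2
  recv := attackRecv M Δ σ

variable {σ : WithTop ℝ}

lemma attackData_zero : attackData M Δ τ σ 0 = (0, False) := by rw [attackData]

lemma attackData_succ (j : ℕ) : attackData M Δ τ σ (j + 1) =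
    ((attackData M Δ τ σ ((attack M Δ τ σ).parent j)).1 + 1,
      (attackData M Δ τ σ ((attack M Δ τ σ).parent j)).2 ∨
        (M.honest (j + 1) = true ∧ τ < M.time (j + 1))) := by rw [attackData]; rfl

lemma hasTx_attack_succ (j : ℕ) : (attack M Δ τ σ).hasTx (j + 1) ↔
    M.honest (j + 1) = true ∧ τ < M.time (j + 1) ∧
      ¬ (attackData M Δ τ σ ((attack M Δ τ σ).parent j)).2 := Iff.rfl

lemma height_attack (c : ℕ) : (attack M Δ τ σ).height c = (attackData M Δ τ σ c).1 := by
  induction c using Nat.strong_induction_on with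
  | _ c ih =>
    cases c with
    | zero => rw [height_zero, attackData_zero]
    | succ j => rw [height_succ, attackData_succ, ih _ ((attack M Δ τ σ).parent j).isLt]

lemma chainHasTx_attack (c : ℕ) :
    (attack M Δ τ σ).ChainHasTx c ↔ (attackData M Δ τ σ c).2 := by
  induction c using Nat.strong_induction_on with
  | _ c ih =>
    cases c with
    | zero =>
      rw [attackData_zero]
      simp only [iff_false]
      rintro ⟨b, hb, htx⟩
      rw [inChain_zero] at hb
      subst hb
      exact htx
    | succ j =>
      have hi := ih _ ((attack M Δ τ σ).parent j).isLt
      have : (attack M Δ τ σ).ChainHasTx (j + 1) ↔ (attack M Δ τ σ).hasTx (j + 1) ∨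
          (attack M Δ τ σ).ChainHasTx ((attack M Δ τ σ).parent j) := by
        constructor
        · rintro ⟨b, hb, htx⟩
          rcases inChain_succ.1 hb with rfl | hb
          · exact Or.inl htx
          · exact Or.inr ⟨b, hb, htx⟩
        · rintro (h | h)
          · exact ⟨_, .refl _, h⟩
          · exact h.mono (.step (.refl _))
      rw [this, hi, attackData_succ, hasTx_attack_succ]
      tauto

lemma time_nonneg (ht : StrictMono M.time) (h0 : M.time 0 = 0) (j : ℕ) : 0 ≤ M.time j :=
  h0 ▸ ht.monotone (Nat.zero_le j)

@[simp] lemma attackRecv_zero (n : N) : attackRecv M Δ σ n 0 = ((0 : ℝ) : WithTop ℝ) := by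
  simp [attackRecv]

lemma attackRecv_own {j : ℕ} (hj : M.honest (j + 1) = true) :
    attackRecv M Δ σ (M.miner (j + 1)) (j + 1) = (M.time (j + 1) : WithTop ℝ) := by
  simp [attackRecv, hj]

lemma attackRecv_honest {j : ℕ} (hj : M.honest (j + 1) = true) {n : N}
    (hn : n ≠ M.miner (j + 1)) (hσ : (M.time (j + 1) : WithTop ℝ) ≤ σ) :
    attackRecv M Δ σ n (j + 1) = min ((M.time (j + 1) + Δ : ℝ) : WithTop ℝ) σ := by
  simp [attackRecv, hj, hn, hσ]

lemma attackRecv_adversarial {j : ℕ} (hj : M.honest (j + 1) = false) (n : N)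
    (hσ : (M.time (j + 1) : WithTop ℝ) ≤ σ) : attackRecv M Δ σ n (j + 1) = σ := by
  simp [attackRecv, hj, hσ]

lemma attackRecv_late {j : ℕ} (n : N) (hσ : ¬ (M.time (j + 1) : WithTop ℝ) ≤ σ) :
    attackRecv M Δ σ n (j + 1) = (M.time (j + 1) : WithTop ℝ) := by
  simp [attackRecv, hσ]

lemma time_le_attackRecv (hΔ : 0 ≤ Δ) (h0 : M.time 0 = 0) (n : N) (j : ℕ) :
    (M.time j : WithTop ℝ) ≤ attackRecv M Δ σ n j := by
  cases j with
  | zero => simp [h0]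
  | succ j =>
    by_cases hσ : (M.time (j + 1) : WithTop ℝ) ≤ σ
    · cases hj : M.honest (j + 1) with
      | false => rwa [attackRecv_adversarial hj n hσ]
      | true =>
        by_cases hn : n = M.miner (j + 1)
        · subst hn; rw [attackRecv_own hj]
        · rw [attackRecv_honest hj hn hσ]
          exact le_min (WithTop.coe_le_coe.2 (by linarith)) hσ
    · rw [attackRecv_late n hσ]

lemma attackRecv_le_add (hΔ : 0 ≤ Δ) {j : ℕ} (hj : M.honest (j + 1) = true) (n : N) :
    attackRecv M Δ σ n (j + 1) ≤ ((M.time (j + 1) + Δ : ℝ) : WithTop ℝ) := by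
  have h : (M.time (j + 1) : WithTop ℝ) ≤ ((M.time (j + 1) + Δ : ℝ) : WithTop ℝ) :=
    WithTop.coe_le_coe.2 (by linarith)
  by_cases hn : n = M.miner (j + 1)
  · subst hn; rw [attackRecv_own hj]; exact h
  · by_cases hσ : (M.time (j + 1) : WithTop ℝ) ≤ σ
    · rw [attackRecv_honest hj hn hσ]; exact min_le_left _ _
    · rw [attackRecv_late n hσ]; exact h

lemma attackRecv_le (j : ℕ) (n : N) (hσ : (M.time (j + 1) : WithTop ℝ) ≤ σ) :
    attackRecv M Δ σ n (j + 1) ≤ σ := by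
  cases hj : M.honest (j + 1) with
  | false => rw [attackRecv_adversarial hj n hσ]
  | true =>
    by_cases hn : n = M.miner (j + 1)
    · subst hn; rwa [attackRecv_own hj]
    · rw [attackRecv_honest hj hn hσ]; exact min_le_right _ _

/-- Before the publication time, the views are as if nothing were ever published. -/
lemma attackRecv_le_iff (hΔ : 0 ≤ Δ) (h0 : M.time 0 = 0) {s : ℝ} (hs : (s : WithTop ℝ) < σ)
    (n : N) (j : ℕ) :
    attackRecv M Δ σ n j ≤ (s : WithTop ℝ) ↔ attackRecv M Δ ⊤ n j ≤ (s : WithTop ℝ) := by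
  cases j with
  | zero => simp
  | succ j =>
    by_cases hσ : (M.time (j + 1) : WithTop ℝ) ≤ σ
    · cases hj : M.honest (j + 1) with
      | false =>
        rw [attackRecv_adversarial hj n hσ, attackRecv_adversarial hj n le_top]
        simp [not_le.2 hs]
      | true =>
        by_cases hn : n = M.miner (j + 1)
        · subst hn; rw [attackRecv_own hj, attackRecv_own hj]
        · rw [attackRecv_honest hj hn hσ, attackRecv_honest hj hn le_top]
          simp only [min_le_iff, not_le.2 hs, or_false]
          simp
    · have h := hs.trans (not_le.1 hσ)
      refine iff_of_false ?_ ?_ <;> intro hle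
      · exact absurd ((time_le_attackRecv hΔ h0 n (j + 1)).trans hle) (not_le.2 h)
      · exact absurd ((time_le_attackRecv hΔ h0 n (j + 1)).trans hle) (not_le.2 h)

lemma attackRecv_lt_iff (hΔ : 0 ≤ Δ) (h0 : M.time 0 = 0) {t : ℝ} (ht : (t : WithTop ℝ) ≤ σ)
    (n : N) (j : ℕ) :
    attackRecv M Δ σ n j < (t : WithTop ℝ) ↔ attackRecv M Δ ⊤ n j < (t : WithTop ℝ) := by
  have key : ∀ x : WithTop ℝ, x < (t : WithTop ℝ) ↔ ∃ s : ℝ, s < t ∧ x ≤ (s : WithTop ℝ) := by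
    intro x
    constructor
    · intro h
      obtain ⟨s, rfl⟩ := WithTop.ne_top_iff_exists.1 h.ne_top
      exact ⟨s, WithTop.coe_lt_coe.1 h, le_rfl⟩
    · rintro ⟨s, h1, h2⟩
      exact h2.trans_lt (WithTop.coe_lt_coe.2 h1)
  rw [key, key]
  refine exists_congr fun s => and_congr_right fun hs => ?_
  exact attackRecv_le_iff hΔ h0 ((WithTop.coe_lt_coe.2 hs).trans_le ht) n j

lemma attackParent_congr (hΔ : 0 ≤ Δ) (h0 : M.time 0 = 0) {j : ℕ}
    {f : Fin (j + 1) → ℕ × Prop} (hσ : (M.time (j + 1) : WithTop ℝ) ≤ σ) :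
    attackParent M Δ σ j f = attackParent M Δ ⊤ j f := by
  unfold attackParent
  simp only [attackRecv_lt_iff hΔ h0 hσ]

lemma attackData_congr (hΔ : 0 ≤ Δ) (ht : StrictMono M.time) (h0 : M.time 0 = 0) {c : ℕ}
    (hσ : (M.time c : WithTop ℝ) ≤ σ) :
    attackData M Δ τ σ c = attackData M Δ τ ⊤ c := by
  induction c using Nat.strong_induction_on with
  | _ c ih =>
    cases c with
    | zero => rw [attackData_zero, attackData_zero]
    | succ j =>
      have hd : ∀ d : Fin (j + 1), attackData M Δ τ σ d = attackData M Δ τ ⊤ d := fun d =>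
        ih d d.isLt ((WithTop.coe_le_coe.2 (ht.monotone d.isLt.le)).trans hσ)
      rw [attackData, attackData]
      simp only [hd, attackParent_congr hΔ h0 hσ]

lemma parent_attack_congr (hΔ : 0 ≤ Δ) (ht : StrictMono M.time) (h0 : M.time 0 = 0) {j : ℕ}
    (hσ : (M.time (j + 1) : WithTop ℝ) ≤ σ) :
    (attack M Δ τ σ).parent j = (attack M Δ τ ⊤).parent j := by
  have hd : ∀ d : Fin (j + 1), attackData M Δ τ σ d = attackData M Δ τ ⊤ d := fun d =>
    attackData_congr hΔ ht h0 ((WithTop.coe_le_coe.2 (ht.monotone d.isLt.le)).trans hσ)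
  simp only [attack, hd, attackParent_congr hΔ h0 hσ]

lemma hasTx_attack_congr (hΔ : 0 ≤ Δ) (ht : StrictMono M.time) (h0 : M.time 0 = 0) {c : ℕ}
    (hσ : (M.time c : WithTop ℝ) ≤ σ) :
    (attack M Δ τ σ).hasTx c ↔ (attack M Δ τ ⊤).hasTx c := by
  cases c with
  | zero => exact Iff.rfl
  | succ j =>
    rw [hasTx_attack_succ, hasTx_attack_succ, parent_attack_congr hΔ ht h0 hσ,
      attackData_congr hΔ ht h0 ((WithTop.coe_le_coe.2 (ht.monotone (Fin.isLt _).le)).trans hσ)]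

lemma canViolate_attack_congr (hΔ : 0 ≤ Δ) (ht : StrictMono M.time) (h0 : M.time 0 = 0) {k : ℕ}
    {t : ℝ} (hσ : (t : WithTop ℝ) ≤ σ) :
    (attack M Δ τ σ).CanViolate M k t ↔ (attack M Δ τ ⊤).CanViolate M k t := by
  have hle : ∀ {j}, M.time j ≤ t → (M.time j : WithTop ℝ) ≤ σ := fun h =>
    (WithTop.coe_le_coe.2 h).trans hσ
  have hr : ∀ n j (s : ℝ), s ≤ t →
      (((attack M Δ τ σ).publishAt M t).recv n j ≤ (s : WithTop ℝ) ↔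
        ((attack M Δ τ ⊤).publishAt M t).recv n j ≤ (s : WithTop ℝ)) := by
    intro n j s hs
    rcases hs.lt_or_eq with hs | rfl
    · rw [recv_publishAt_le_of_lt hs, recv_publishAt_le_of_lt hs]
      exact attackRecv_le_iff hΔ h0 ((WithTop.coe_lt_coe.2 hs).trans_le hσ) n j
    · rw [recv_publishAt_le_self (time_le_attackRecv hΔ h0),
        recv_publishAt_le_self (time_le_attackRecv hΔ h0)]
  constructor
  · exact ViolatedBy.congr ht.monotone (fun j hj => parent_attack_congr hΔ ht h0 (hle hj))
      (fun j hj => hasTx_attack_congr hΔ ht h0 (hle hj)) hr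
      (time_le_recv_publishAt (time_le_attackRecv hΔ h0))
  · exact ViolatedBy.congr ht.monotone (fun j hj => (parent_attack_congr hΔ ht h0 (hle hj)).symm)
      (fun j hj => (hasTx_attack_congr hΔ ht h0 (hle hj)).symm)
      (fun n j s hs => (hr n j s hs).symm)
      (time_le_recv_publishAt (time_le_attackRecv hΔ h0))

lemma parent_attack_honest (ht : StrictMono M.time) (h0 : M.time 0 = 0) {j : ℕ}
    (hj : M.honest (j + 1) = true) :
    attackRecv M Δ σ (M.miner (j + 1)) ((attack M Δ τ σ).parent j) <
      (M.time (j + 1) : WithTop ℝ) ∧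
    ∀ d ≤ j, attackRecv M Δ σ (M.miner (j + 1)) d < (M.time (j + 1) : WithTop ℝ) →
      (attack M Δ τ σ).height d ≤ (attack M Δ τ σ).height ((attack M Δ τ σ).parent j) := by
  obtain ⟨h1, h2⟩ := highest_spec (j := j) (fun d => (attackData M Δ τ σ d).1)
    (C := fun d => if M.honest (j + 1) = true then
      attackRecv M Δ σ (M.miner (j + 1)) d < (M.time (j + 1) : WithTop ℝ)
    else ¬ (attackData M Δ τ σ d).2) ⟨0, by
      rw [if_pos hj]
      simpa [← h0] using ht (Nat.succ_pos j)⟩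
  simp only [if_pos hj] at h1 h2
  refine ⟨?_, fun d hd hr => ?_⟩
  · simpa [attack, attackParent, hj] using h1
  · rw [height_attack, height_attack]
    simpa [attack, attackParent, hj] using h2 ⟨d, Nat.lt_succ_of_le hd⟩ hr

lemma parent_attack_adversarial {j : ℕ} (hj : M.honest (j + 1) = false) :
    ¬ (attackData M Δ τ σ ((attack M Δ τ σ).parent j)).2 ∧
    ∀ d ≤ j, ¬ (attackData M Δ τ σ d).2 →
      (attack M Δ τ σ).height d ≤ (attack M Δ τ σ).height ((attack M Δ τ σ).parent j) := by
  have hj' : ¬ M.honest (j + 1) = true := by simp [hj]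
  obtain ⟨h1, h2⟩ := highest_spec (j := j) (fun d => (attackData M Δ τ σ d).1)
    (C := fun d => if M.honest (j + 1) = true then
      attackRecv M Δ σ (M.miner (j + 1)) d < (M.time (j + 1) : WithTop ℝ)
    else ¬ (attackData M Δ τ σ d).2) ⟨0, by
      rw [if_neg hj']
      simp [attackData_zero]⟩
  simp only [if_neg hj'] at h1 h2
  refine ⟨?_, fun d hd hr => ?_⟩
  · simpa [attack, attackParent, hj] using h1
  · rw [height_attack, height_attack]
    simpa [attack, attackParent, hj] using h2 ⟨d, Nat.lt_succ_of_le hd⟩ hr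

lemma attackRecv_parent_le (hΔ : 0 ≤ Δ) (ht : StrictMono M.time) (h0 : M.time 0 = 0) (n : N)
    (j : ℕ) : attackRecv M Δ σ n ((attack M Δ τ σ).parent j) ≤ attackRecv M Δ σ n (j + 1) := by
  have hlt := ((attack M Δ τ σ).parent j).isLt
  have hhon := parent_attack_honest (Δ := Δ) (τ := τ) (σ := σ) ht h0 (j := j)
  generalize ((attack M Δ τ σ).parent j : ℕ) = p at *
  have htp : M.time p ≤ M.time (j + 1) := ht.monotone hlt.le
  cases p with
  | zero =>
    rw [attackRecv_zero]
    exact (WithTop.coe_le_coe.2 (time_nonneg ht h0 _)).trans (time_le_attackRecv hΔ h0 n (j + 1))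
  | succ p =>
    by_cases hσ : (M.time (j + 1) : WithTop ℝ) ≤ σ
    · have hpσ := (WithTop.coe_le_coe.2 htp).trans hσ
      cases hj : M.honest (j + 1) with
      | false => rw [attackRecv_adversarial hj n hσ]; exact attackRecv_le p n hpσ
      | true =>
        have hlt := (hhon hj).1
        by_cases hn : n = M.miner (j + 1)
        · subst hn; rw [attackRecv_own hj]; exact hlt.le
        · rw [attackRecv_honest hj hn hσ]
          refine le_min ?_ (attackRecv_le p n hpσ)
          have hp : M.honest (p + 1) = true := by
            by_contra hf
            rw [attackRecv_adversarial (by simpa using hf) _ hpσ] at hlt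
            exact absurd hσ (not_le.2 hlt)
          exact (attackRecv_le_add hΔ hp n).trans (WithTop.coe_le_coe.2 (by linarith))
    · rw [attackRecv_late n hσ]
      by_cases hpσ : (M.time (p + 1) : WithTop ℝ) ≤ σ
      · exact (attackRecv_le p n hpσ).trans (not_le.1 hσ).le
      · rw [attackRecv_late n hpσ]; exact WithTop.coe_le_coe.2 htp

/-- The rules hold whatever the publication time. -/
theorem attack_legal (hΔ : 0 ≤ Δ) (ht : StrictMono M.time) (h0 : M.time 0 = 0) :
    (attack M Δ τ σ).Legal M Δ τ where
  genesis n := attackRecv_zero (M := M) (Δ := Δ) (σ := σ) n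
  time_le_recv := time_le_attackRecv hΔ h0
  recv_parent_le := attackRecv_parent_le hΔ ht h0
  honest_parent j hj := by
    obtain ⟨h1, h2⟩ := parent_attack_honest (Δ := Δ) (τ := τ) (σ := σ) ht h0 hj
    refine ⟨h1, fun d hd => h2 d ?_ hd⟩
    have := ht.lt_iff_lt.1 (WithTop.coe_lt_coe.1 ((time_le_attackRecv hΔ h0 _ d).trans_lt hd))
    omega
  honest_own j hj := attackRecv_own hj
  honest_publish j n hj := attackRecv_le_add hΔ hj n
  relay n m b _ := by
    change attackRecv M Δ σ m b ≤ attackRecv M Δ σ n b + (Δ : WithTop ℝ)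
    have hself : ∀ x : WithTop ℝ, x ≤ x + (Δ : WithTop ℝ) := fun x =>
      le_add_of_nonneg_right (by exact_mod_cast hΔ)
    cases b with
    | zero => rw [attackRecv_zero, attackRecv_zero]; exact hself _
    | succ b =>
      cases hb : M.honest (b + 1) with
      | true =>
        refine (attackRecv_le_add hΔ hb m).trans ?_
        rw [WithTop.coe_add]
        gcongr
        exact time_le_attackRecv hΔ h0 n (b + 1)
      | false =>
        by_cases hσ : (M.time (b + 1) : WithTop ℝ) ≤ σ
        · rw [attackRecv_adversarial hb m hσ, attackRecv_adversarial hb n hσ]; exact hself _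
        · rw [attackRecv_late m hσ, attackRecv_late n hσ]; exact hself _
  tx_once b c hb hc hbc := by
    cases c with
    | zero => exact inChain_zero.1 hbc
    | succ j =>
      rcases inChain_succ.1 hbc with h | h
      · exact h
      · exact absurd ((chainHasTx_attack _).1 ⟨b, h, hb⟩) ((hasTx_attack_succ j).1 hc).2.2
  tx_after b hb := by
    cases b with
    | zero => exact hb.elim
    | succ j => exact ((hasTx_attack_succ j).1 hb).2.1
  honest_tx j hj hτ := by
    rw [chainHasTx_attack, attackData_succ]
    exact Or.inr ⟨hj, hτ⟩

/-- Private mining can be carried out on every path without simultaneous blocks. The publication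
time is the first opportunity of the execution in which nothing is ever published. -/
theorem exists_privateMining (hΔ : 0 ≤ Δ) (ht : StrictMono M.time) (h0 : M.time 0 = 0) (k : ℕ)
    (τ : ℝ) : ∃ E : Execution N, E.Legal M Δ τ ∧ E.IsPrivateMining M Δ k := by
  classical
  have hmine : ∀ σ : WithTop ℝ,
      (∀ s : ℝ, σ = (s : WithTop ℝ) → (attack M Δ τ ⊤).CanViolate M k s) →
      (∀ (j : ℕ) (t : ℝ), t < M.time j → (M.time j : WithTop ℝ) ≤ σ →
        ¬ (attack M Δ τ ⊤).CanViolate M k t) →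
      ∃ E : Execution N, E.Legal M Δ τ ∧ E.IsPrivateMining M Δ k := by
    intro σ h1 h2
    refine ⟨attack M Δ τ σ, attack_legal hΔ ht h0, fun j hj => ⟨?_, fun d hd hdf => ?_⟩, σ,
      fun j n hj hn hσ => attackRecv_honest hj hn hσ, fun j n hj => ?_,
      fun j n hσ => attackRecv_le j n hσ, fun s hs => ?_, fun j t htj hσ => ?_⟩
    · rw [chainHasTx_attack, attackData_succ]
      have := (parent_attack_adversarial (Δ := Δ) (τ := τ) (σ := σ) hj).1
      simp [this, hj]
    · rw [chainHasTx_attack] at hdf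
      exact (parent_attack_adversarial hj).2 d hd hdf
    · change σ ≤ attackRecv M Δ σ n (j + 1)
      by_cases hσ : (M.time (j + 1) : WithTop ℝ) ≤ σ
      · rw [attackRecv_adversarial hj n hσ]
      · rw [attackRecv_late n hσ]; exact (not_le.1 hσ).le
    · exact (canViolate_attack_congr hΔ ht h0 hs.ge).2 (h1 s hs)
    · rw [canViolate_attack_congr hΔ ht h0 ((WithTop.coe_le_coe.2 htj.le).trans hσ)]
      exact h2 j t htj hσ
  -- an opportunity before block `j` is mined lies between two successive earlier blocks
  have hslot : ∀ (j : ℕ) (t : ℝ), t < M.time j → (attack M Δ τ ⊤).CanViolate M k t →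
      ∃ i < j, M.time i ≤ t ∧ t < M.time (i + 1) := by
    intro j t htj hcan
    have hex : ∃ q, t < M.time q := ⟨j, htj⟩
    have hq : Nat.find hex ≠ 0 := by
      intro hz
      have hneg := Nat.find_spec hex
      rw [hz, h0] at hneg
      obtain ⟨_, _, -, -, -, n, _, s, _, hs, -, ⟨c, hc, -⟩, -⟩ := hcan
      have h5 := time_le_recv_publishAt (E := attack M Δ τ ⊤) (t := t) (time_le_attackRecv hΔ h0) n c
      have h6 := WithTop.coe_le_coe.1 (h5.trans hc)
      have := time_nonneg ht h0 c
      linarith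
    refine ⟨Nat.find hex - 1, ?_, ?_, ?_⟩
    · have := Nat.find_min' hex htj; omega
    · exact not_lt.1 (Nat.find_min hex (by omega))
    · rw [Nat.sub_add_cancel (by omega)]; exact Nat.find_spec hex
  by_cases hex : ∃ m, ∃ t, M.time m ≤ t ∧ t < M.time (m + 1) ∧
      (attack M Δ τ ⊤).CanViolate M k t
  · obtain ⟨t, h1, h2, h3⟩ := Nat.find_spec hex
    refine hmine t (fun s hs => WithTop.coe_injective hs ▸ h3) fun j t' ht' hj hcan => ?_
    obtain ⟨i, hij, hi1, hi2⟩ := hslot j t' ht' hcan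
    have := ht.lt_iff_lt.1 ((WithTop.coe_le_coe.1 hj).trans_lt h2)
    exact Nat.find_min hex (m := i) (by omega) ⟨t', hi1, hi2, hcan⟩
  · refine hmine ⊤ (fun s hs => absurd hs WithTop.top_ne_coe) fun j t' ht' _ hcan => ?_
    obtain ⟨i, -, hi1, hi2⟩ := hslot j t' ht' hcan
    exact hex ⟨i, t', hi1, hi2, hcan⟩

end Execution
end Nakamoto

namespace Nakamoto

/-! ### Sequences of independent trials -/

open Measure Finset

/-- The sequence `z, x 0, x 1, …`. -/
def consSeq {X : Type*} (z : X) (x : ℕ → X) : ℕ → X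
  | 0 => z
  | n + 1 => x n

@[simp] lemma consSeq_zero {X : Type*} (z : X) (x : ℕ → X) : consSeq z x 0 = z := rfl
@[simp] lemma consSeq_succ {X : Type*} (z : X) (x : ℕ → X) (n : ℕ) :
    consSeq z x (n + 1) = x n := rfl

lemma measurable_consSeq {X : Type*} [MeasurableSpace X] :
    Measurable fun a : X × (ℕ → X) => consSeq a.1 a.2 := by
  refine measurable_pi_iff.2 fun n => ?_
  cases n with
  | zero => exact measurable_fst
  | succ n => exact (measurable_pi_apply n).comp measurable_snd

lemma map_consSeq {X : Type*} [MeasurableSpace X] (μ : Measure X) [IsProbabilityMeasure μ] :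
    (μ.prod (infinitePi fun _ : ℕ => μ)).map (fun a => consSeq a.1 a.2) =
      infinitePi fun _ : ℕ => μ := by
  classical
  refine eq_infinitePi _ fun s t ht => ?_
  set t' : ℕ → Set X := fun i => if i ∈ s then t i else Set.univ with ht'
  have hmt' : ∀ i, MeasurableSet (t' i) := fun i => by
    rw [ht']; dsimp only; split_ifs
    exacts [ht i, .univ]
  obtain ⟨n, hn⟩ := s.exists_nat_subset_range
  have hprod : ∏ i ∈ s, μ (t i) = ∏ i ∈ range (n + 1), μ (t' i) := by
    rw [← Finset.prod_subset (hn.trans (range_subset_range.2 (Nat.le_succ n)))]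
    · exact Finset.prod_congr rfl fun i hi => by simp [ht', hi]
    · intro i _ hi; simp [ht', hi]
  have hset : (fun a : X × (ℕ → X) => consSeq a.1 a.2) ⁻¹' Set.pi s t =
      t' 0 ×ˢ Set.pi (range n : Set ℕ) fun i => t' (i + 1) := by
    ext ⟨z, x⟩
    simp only [Set.mem_preimage, Set.mem_pi, Finset.mem_coe, Set.mem_prod, ht']
    constructor
    · intro h
      refine ⟨?_, fun i _ => ?_⟩
      · split_ifs with h0
        exacts [h 0 h0, trivial]
      · split_ifs with h0
        exacts [h (i + 1) h0, trivial]
    · rintro ⟨h1, h2⟩ i hi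
      cases i with
      | zero => simpa [hi] using h1
      | succ i =>
        have := h2 i (mem_range.2 (by have := mem_range.1 (hn hi); omega))
        simpa [hi] using this
  rw [Measure.map_apply measurable_consSeq (.pi s.countable_toSet fun i _ => ht i), hset,
    prod_prod, infinitePi_pi _ fun i _ => hmt' _, hprod, prod_range_succ', mul_comm]

/-- Conditioning an i.i.d. sequence on its first term. -/
lemma infinitePi_apply_consSeq {X : Type*} [MeasurableSpace X] (μ : Measure X)
    [IsProbabilityMeasure μ] {S : Set (ℕ → X)} (hS : MeasurableSet S) :
    (infinitePi fun _ : ℕ => μ) S =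
      ∫⁻ z, (infinitePi fun _ : ℕ => μ) (consSeq z ⁻¹' S) ∂μ := by
  conv_lhs => rw [← map_consSeq μ, Measure.map_apply measurable_consSeq hS,
    Measure.prod_apply (measurable_consSeq hS)]
  rfl

lemma measurable_consSeq_right {X : Type*} [MeasurableSpace X] (z : X) :
    Measurable (consSeq z : (ℕ → X) → ℕ → X) :=
  measurable_consSeq.comp measurable_prodMk_left

/-- The Bernoulli law: `true` with probability `p`, `false` with probability `1 - p`. -/
noncomputable def bernoulli (p : ℝ) : Measure Bool :=
  ENNReal.ofReal p • dirac true + ENNReal.ofReal (1 - p) • dirac false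

lemma isProbabilityMeasure_bernoulli {p : ℝ} (h0 : 0 ≤ p) (h1 : p ≤ 1) :
    IsProbabilityMeasure (bernoulli p) := by
  constructor
  simp [bernoulli, ← ENNReal.ofReal_add h0 (sub_nonneg.2 h1)]

/-- Infinitely many independent Bernoulli trials. -/
noncomputable def trials (p : ℝ) : Measure (ℕ → Bool) := infinitePi fun _ : ℕ => bernoulli p

lemma isProbabilityMeasure_trials {p : ℝ} (h0 : 0 ≤ p) (h1 : p ≤ 1) :
    IsProbabilityMeasure (trials p) := by
  have := isProbabilityMeasure_bernoulli h0 h1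
  unfold trials; infer_instance

lemma trials_apply {p : ℝ} (h0 : 0 ≤ p) (h1 : p ≤ 1) {S : Set (ℕ → Bool)}
    (hS : MeasurableSet S) :
    trials p S = ENNReal.ofReal p * trials p (consSeq true ⁻¹' S) +
      ENNReal.ofReal (1 - p) * trials p (consSeq false ⁻¹' S) := by
  have := isProbabilityMeasure_bernoulli h0 h1
  conv_lhs => rw [trials, infinitePi_apply_consSeq _ hS, bernoulli]
  simp [trials, bernoulli]

lemma trials_real {p : ℝ} (h0 : 0 ≤ p) (h1 : p ≤ 1) {S : Set (ℕ → Bool)}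
    (hS : MeasurableSet S) :
    (trials p).real S = p * (trials p).real (consSeq true ⁻¹' S) +
      (1 - p) * (trials p).real (consSeq false ⁻¹' S) := by
  have := isProbabilityMeasure_trials h0 h1
  rw [Measure.real, trials_apply h0 h1 hS, ENNReal.toReal_add (by finiteness) (by finiteness),
    ENNReal.toReal_mul, ENNReal.toReal_mul, ENNReal.toReal_ofReal h0,
    ENNReal.toReal_ofReal (by linarith)]
  rfl

/-! ### Measurability of the walks -/

lemma measurableSet_term_eq (m : ℕ) (e : Bool) : MeasurableSet {y : ℕ → Bool | y m = e} :=
  measurableSet_eq_fun (measurable_pi_apply m) measurable_const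

lemma measurable_good (m : ℕ) : Measurable fun y : ℕ → Bool => good y m := by
  induction m with
  | zero => simp
  | succ m ih =>
    simp only [good_succ]
    exact ih.add (Measurable.ite (measurableSet_term_eq m true)
      measurable_const measurable_const)

lemma measurable_bad (m : ℕ) : Measurable fun y : ℕ → Bool => bad y m := by
  induction m with
  | zero => simp
  | succ m ih =>
    simp only [bad_succ]
    exact ih.add (Measurable.ite (measurableSet_term_eq m false)
      measurable_const measurable_const)

lemma measurable_lead (m : ℕ) : Measurable fun y : ℕ → Bool => lead y m := by
  induction m with
  | zero => simp [lead]
  | succ m ih =>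
    simp only [lead]
    exact Measurable.ite (measurableSet_term_eq m true)
      (ih.sub measurable_const) (ih.add measurable_const)

lemma measurable_shift (n : ℕ) : Measurable (shift n) :=
  measurable_pi_iff.2 fun i => measurable_pi_apply (n + i)

lemma measurableSet_winSet (δ k x : ℕ) : MeasurableSet (winSet δ k x) := by
  have : winSet δ k x = ⋃ m, ({y | k ≤ x + bad y m} ∩ {y | good y m ≤ x + bad y m + δ}) := by
    ext y; simp [winSet]
  rw [this]
  refine .iUnion fun m => .inter ?_ ?_
  · exact measurableSet_le measurable_const ((measurable_bad m).const_add x)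
  · exact measurableSet_le (measurable_good m) (((measurable_bad m).const_add x).add_const δ)

/-! ### The hitting probability of the walk -/

/-- The walks in which the bad blocks ever get `d` ahead of the good ones. -/
def hitSet (d : ℕ) : Set (ℕ → Bool) := {y | ∃ m, good y m + d ≤ bad y m}

/-- The walks in which the bad blocks get `d` ahead of the good ones among the first `n` blocks. -/
def hitSetBy (n d : ℕ) : Set (ℕ → Bool) := {y | ∃ m ≤ n, good y m + d ≤ bad y m}

lemma measurableSet_hitSetBy (n d : ℕ) : MeasurableSet (hitSetBy n d) := by
  have : hitSetBy n d = ⋃ m, ⋃ _ : m ≤ n, {y | good y m + d ≤ bad y m} := by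
    ext y; simp [hitSetBy]
  rw [this]
  exact .iUnion fun m => .iUnion fun _ =>
    measurableSet_le ((measurable_good m).add_const d) (measurable_bad m)

lemma hitSet_eq_iUnion (d : ℕ) : hitSet d = ⋃ n, hitSetBy n d := by
  ext y
  simp only [hitSet, hitSetBy, Set.mem_iUnion]
  exact ⟨fun ⟨m, h⟩ => ⟨m, m, le_rfl, h⟩, fun ⟨_, m, _, h⟩ => ⟨m, h⟩⟩

lemma measurableSet_hitSet (d : ℕ) : MeasurableSet (hitSet d) := by
  rw [hitSet_eq_iUnion]
  exact .iUnion fun n => measurableSet_hitSetBy n d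

lemma shift_one_consSeq (e : Bool) (y : ℕ → Bool) : shift 1 (consSeq e y) = y := by
  funext i; simp [shift, Nat.add_comm 1 i]

lemma good_consSeq (e : Bool) (y : ℕ → Bool) (m : ℕ) :
    good (consSeq e y) (m + 1) = good y m + if e = true then 1 else 0 := by
  rw [Nat.add_comm m 1, good_add, shift_one_consSeq, good_succ,
    good_zero, zero_add, Nat.add_comm]
  rfl

lemma bad_consSeq (e : Bool) (y : ℕ → Bool) (m : ℕ) :
    bad (consSeq e y) (m + 1) = bad y m + if e = false then 1 else 0 := by
  rw [Nat.add_comm m 1, bad_add, shift_one_consSeq, bad_succ,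
    bad_zero, zero_add, Nat.add_comm]
  rfl

lemma hitSet_zero : hitSet 0 = Set.univ :=
  Set.eq_univ_of_forall fun _ => ⟨0, by simp⟩

lemma consSeq_true_mem_hitSetBy {n d : ℕ} {y : ℕ → Bool} :
    consSeq true y ∈ hitSetBy (n + 1) (d + 1) ↔ y ∈ hitSetBy n (d + 2) := by
  constructor
  · rintro ⟨m, hm, h⟩
    cases m with
    | zero => simp at h
    | succ m =>
      rw [good_consSeq, bad_consSeq] at h
      exact ⟨m, by omega, by simp at h; omega⟩
  · rintro ⟨m, hm, h⟩
    exact ⟨m + 1, by omega, by rw [good_consSeq, bad_consSeq]; simp; omega⟩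

lemma consSeq_false_mem_hitSetBy {n d : ℕ} {y : ℕ → Bool} :
    consSeq false y ∈ hitSetBy (n + 1) (d + 1) ↔ y ∈ hitSetBy n d := by
  constructor
  · rintro ⟨m, hm, h⟩
    cases m with
    | zero => simp at h
    | succ m =>
      rw [good_consSeq, bad_consSeq] at h
      exact ⟨m, by omega, by simp at h; omega⟩
  · rintro ⟨m, hm, h⟩
    exact ⟨m + 1, by omega, by rw [good_consSeq, bad_consSeq]; simp; omega⟩

lemma consSeq_mem_hitSet {e : Bool} {d : ℕ} {y : ℕ → Bool} :
    consSeq e y ∈ hitSet (d + 1) ↔ y ∈ hitSet (if e = true then d + 2 else d) := by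
  have key : ∀ n, consSeq e y ∈ hitSetBy (n + 1) (d + 1) ↔
      y ∈ hitSetBy n (if e = true then d + 2 else d) := fun n => by
    cases e with
    | true => exact consSeq_true_mem_hitSetBy
    | false => exact consSeq_false_mem_hitSetBy
  constructor
  · rintro ⟨m, h⟩
    obtain ⟨m', -, h'⟩ := (key m).1 ⟨m, by omega, h⟩
    exact ⟨m', h'⟩
  · rintro ⟨m, h⟩
    obtain ⟨m', -, h'⟩ := (key m).2 ⟨m, le_rfl, h⟩
    exact ⟨m', h'⟩

/-- Hitting level `d` within finitely many blocks has at most the gambler's-ruin probability. -/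
lemma trials_hitSetBy_le {p : ℝ} (hp : 0 < p) (h1 : p ≤ 1) (n d : ℕ) :
    (trials p).real (hitSetBy n d) ≤ F1 d p := by
  have := isProbabilityMeasure_trials hp.le h1
  have hq : 0 ≤ 1 - p := by linarith
  induction n generalizing d with
  | zero =>
    cases d with
    | zero => rw [F1, pow_zero]; exact measureReal_le_one
    | succ d =>
      have : hitSetBy 0 (d + 1) = ∅ := by
        ext y; simp [hitSetBy]
      rw [this, measureReal_empty]
      unfold F1; positivity
  | succ n ih =>
    cases d with
    | zero => rw [F1, pow_zero]; exact measureReal_le_one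
    | succ d =>
      rw [trials_real hp.le h1 (measurableSet_hitSetBy _ _)]
      have e1 : consSeq true ⁻¹' hitSetBy (n + 1) (d + 1) = hitSetBy n (d + 2) :=
        Set.ext fun y => consSeq_true_mem_hitSetBy
      have e2 : consSeq false ⁻¹' hitSetBy (n + 1) (d + 1) = hitSetBy n d :=
        Set.ext fun y => consSeq_false_mem_hitSetBy
      rw [e1, e2]
      have h2 := mul_le_mul_of_nonneg_left (ih (d + 2)) hp.le
      have h3 := mul_le_mul_of_nonneg_left (ih d) hq
      have h4 : p * F1 (d + 2) p + (1 - p) * F1 d p = F1 (d + 1) p := by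
        unfold F1; rw [pow_add, pow_add]; field_simp; ring
      linarith

/-- Gambler's ruin: with good blocks in the majority, the bad blocks ever get `d` ahead with
probability `((1 - p) / p) ^ d`. -/
theorem trials_hitSet {p : ℝ} (hp : 1 / 2 < p) (h1 : p ≤ 1) (d : ℕ) :
    (trials p).real (hitSet d) = F1 d p := by
  have hp0 : 0 < p := by linarith
  have := isProbabilityMeasure_trials hp0.le h1
  set r := (1 - p) / p with hr
  have hr0 : 0 ≤ r := div_nonneg (by linarith) hp0.le
  have hr1 : r < 1 := by rw [hr, div_lt_one hp0]; linarith
  have hpr : p * r = 1 - p := by rw [hr]; field_simp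
  set h : ℕ → ℝ := fun d => (trials p).real (hitSet d) with hh
  have hle : ∀ d, h d ≤ r ^ d := by
    intro d
    have hmono : Monotone fun n => hitSetBy n d := fun a b hab y ⟨m, hm, hy⟩ =>
      ⟨m, hm.trans hab, hy⟩
    have hlim := tendsto_measure_iUnion_atTop (μ := trials p) hmono
    rw [← hitSet_eq_iUnion] at hlim
    have hlim' := (ENNReal.tendsto_toReal (measure_ne_top _ _)).comp hlim
    exact le_of_tendsto' hlim' fun n => trials_hitSetBy_le hp0 h1 n d
  have hrec : ∀ d, h (d + 1) = p * h (d + 2) + (1 - p) * h d := by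
    intro d
    have e1 : consSeq true ⁻¹' hitSet (d + 1) = hitSet (d + 2) :=
      Set.ext fun y => consSeq_mem_hitSet
    have e2 : consSeq false ⁻¹' hitSet (d + 1) = hitSet d :=
      Set.ext fun y => consSeq_mem_hitSet
    simp only [hh]
    rw [trials_real hp0.le h1 (measurableSet_hitSet _), e1, e2]
  have h00 : h 0 = 1 := by simp [hh, hitSet_zero]
  -- the recursion determines `h` up to the multiple of `1 - r ^ d`, which must vanish at infinity
  have hdiff : ∀ d, h d - h (d + 1) = r ^ d * (1 - h 1) := by
    intro d
    induction d with
    | zero => simp [h00]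
    | succ d ih =>
      have e : p * (h (d + 1) - h (d + 2)) = p * (r * (h d - h (d + 1))) := by
        rw [← mul_assoc, hpr]; linarith [hrec d]
      rw [mul_left_cancel₀ hp0.ne' e, ih]; ring
  have hsol : ∀ d, (1 - r) * (1 - h d) = (1 - r ^ d) * (1 - h 1) := by
    intro d
    induction d with
    | zero => simp [h00]
    | succ d ih =>
      have := hdiff d
      have e : h (d + 1) = h d - r ^ d * (1 - h 1) := by linarith
      rw [e]; ring_nf at ih ⊢; linarith
  have hpow : Filter.Tendsto (fun d => r ^ d) Filter.atTop (nhds 0) :=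
    tendsto_pow_atTop_nhds_zero_of_lt_one hr0 hr1
  have hlim : Filter.Tendsto h Filter.atTop (nhds 0) :=
    squeeze_zero (fun d => measureReal_nonneg) hle hpow
  have heq : (1 - r) * (1 - 0) = (1 - 0) * (1 - h 1) := by
    refine tendsto_nhds_unique (f := fun d => (1 - r) * (1 - h d)) (l := Filter.atTop)
      ((tendsto_const_nhds.sub hlim).const_mul _) ?_
    simp only [hsol]
    exact (tendsto_const_nhds.sub hpow).mul_const _
  have hfin := hsol d
  have h1r : 1 - h 1 = 1 - r := by linarith
  rw [h1r, mul_comm] at hfin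
  have := mul_right_cancel₀ (by linarith : (1 - r) ≠ 0) hfin
  change h d = r ^ d
  linarith

end Nakamoto

namespace Nakamoto

open Measure Finset

/-! ### The probability of a win from a given lead -/

lemma P2_succ_succ (j n : ℕ) (q : ℝ) :
    P2 (j + 1) (n + 1) q = q * P2 j n q + (1 - q) * P2 (j + 1) n q := by
  unfold P2
  rw [Nat.choose_succ_succ, Nat.add_sub_add_right]
  push_cast
  rcases Nat.lt_or_ge j n with h | h
  · have e : n - j = (n - (j + 1)) + 1 := by omega
    rw [e]; ring
  · rw [Nat.choose_eq_zero_of_lt (show n < j + 1 by omega)]; push_cast; ring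

lemma P2_zero_succ (n : ℕ) (q : ℝ) : P2 0 (n + 1) q = (1 - q) * P2 0 n q := by
  simp [P2, pow_succ, mul_comm]

lemma P2_eq_zero {j n : ℕ} (h : n < j) (q : ℝ) : P2 j n q = 0 := by
  simp [P2, Nat.choose_eq_zero_of_lt h]

lemma shift_succ_consSeq (e : Bool) (y : ℕ → Bool) (n : ℕ) :
    shift (n + 1) (consSeq e y) = shift n y := by
  funext i
  have : n + 1 + i = (n + i) + 1 := by omega
  simp [shift, this]

lemma measurableSet_shift_mem {C : ℕ → Set (ℕ → Bool)} (hC : ∀ j, MeasurableSet (C j)) (n : ℕ) :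
    MeasurableSet {y : ℕ → Bool | shift n y ∈ C (bad y n)} := by
  have : {y : ℕ → Bool | shift n y ∈ C (bad y n)} =
      ⋃ j, ({y | bad y n = j} ∩ shift n ⁻¹' C j) := by
    ext y; simp
  rw [this]
  exact .iUnion fun j => (measurableSet_eq_fun (measurable_bad n) measurable_const).inter
    (measurable_shift n (hC j))

/-- Conditioning on the number of bad blocks among the first `n`, which is binomial and
independent of what follows. -/
lemma trials_shift_mem {p : ℝ} (h0 : 0 ≤ p) (h1 : p ≤ 1) {C : ℕ → Set (ℕ → Bool)}
    (hC : ∀ j, MeasurableSet (C j)) (n : ℕ) :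
    (trials p).real {y | shift n y ∈ C (bad y n)} =
      ∑ j ∈ range (n + 1), P2 j n (1 - p) * (trials p).real (C j) := by
  induction n generalizing C with
  | zero =>
    have : {y : ℕ → Bool | shift 0 y ∈ C (bad y 0)} = C 0 := by
      ext y
      have : shift 0 y = y := by funext i; simp [shift]
      simp [this]
    rw [this]; simp [P2]
  | succ n ih =>
    have e1 : consSeq true ⁻¹' {y : ℕ → Bool | shift (n + 1) y ∈ C (bad y (n + 1))} =
        {y | shift n y ∈ C (bad y n)} := by
      ext y; simp [shift_succ_consSeq, bad_consSeq]
    have e2 : consSeq false ⁻¹' {y : ℕ → Bool | shift (n + 1) y ∈ C (bad y (n + 1))} =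
        {y | shift n y ∈ C (bad y n + 1)} := by
      ext y; simp [shift_succ_consSeq, bad_consSeq]
    rw [trials_real h0 h1 (measurableSet_shift_mem hC _), e1, e2, ih hC,
      ih (C := fun j => C (j + 1)) fun j => hC _, sum_range_succ' _ (n + 1)]
    have e3 : ∑ j ∈ range (n + 1), P2 j n (1 - p) * (trials p).real (C j) =
        ∑ j ∈ range (n + 1), P2 (j + 1) n (1 - p) * (trials p).real (C (j + 1)) +
          P2 0 n (1 - p) * (trials p).real (C 0) := by
      rw [← sum_range_succ' (fun j => P2 j n (1 - p) * (trials p).real (C j)) (n + 1),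
        sum_range_succ _ (n + 1), P2_eq_zero (Nat.lt_succ_self n)]
      simp
    simp only [P2_succ_succ, P2_zero_succ]
    rw [e3]
    simp only [add_mul, sum_add_distrib, mul_assoc, ← mul_sum]
    ring

lemma winSet_eq_shift {δ k x : ℕ} (hδ : δ ≤ 1) (hx : x < k) :
    winSet δ k x = {y | shift (2 * k - x) y ∈ (fun j => if k ≤ x + j then Set.univ
      else hitSet (2 * k - 2 * x - 2 * j - δ)) (bad y (2 * k - x))} := by
  ext y
  set n := 2 * k - x with hn
  have hgb := good_add_bad y n
  simp only [winSet, Set.mem_ofPred_eq]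
  split_ifs with hk
  · simp only [Set.mem_univ, iff_true]
    exact ⟨n, hk, by omega⟩
  · simp only [hitSet, Set.mem_ofPred_eq]
    constructor
    · rintro ⟨m, h1, h2⟩
      have hnm : n ≤ m := by
        by_contra hcon
        have := bad_mono y (not_le.1 hcon).le
        omega
      obtain ⟨l, rfl⟩ := Nat.exists_eq_add_of_le hnm
      rw [good_add, bad_add] at h2
      exact ⟨l, by omega⟩
    · rintro ⟨l, h⟩
      have h3 := good_add y n l
      have h4 := bad_add y n l
      exact ⟨n + l, by omega, by omega⟩

lemma trials_winSet {p : ℝ} (hp : 1 / 2 < p) (h1 : p ≤ 1) {δ k i : ℕ} (hδ : δ ≤ 1)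
    (hi : 1 ≤ i) (hik : i ≤ k) :
    (trials p).real (winSet δ k (i - 1)) = F2 (k - i) (2 * k + 1 - i) (1 - p) +
      ∑ j ∈ Icc 0 (k - i),
        P2 j (2 * k + 1 - i) (1 - p) * F1 (2 * k + 2 - δ - 2 * i - 2 * j) p := by
  have hp0 : 0 ≤ p := by linarith
  have := isProbabilityMeasure_trials hp0 h1
  have hn : 2 * k - (i - 1) = 2 * k + 1 - i := by omega
  have hC : ∀ j, MeasurableSet ((fun j => if k ≤ i - 1 + j then Set.univ
      else hitSet (2 * k - 2 * (i - 1) - 2 * j - δ)) j) := by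
    intro j
    dsimp only
    split_ifs
    exacts [.univ, measurableSet_hitSet _]
  rw [winSet_eq_shift hδ (show i - 1 < k by omega), trials_shift_mem hp0 h1 hC, hn]
  · have hsplit : range (2 * k + 1 - i + 1) = Icc 0 (k - i) ∪ Icc (k - i + 1) (2 * k + 1 - i) := by
      ext a; simp only [mem_range, mem_union, mem_Icc]; omega
    rw [hsplit, sum_union, add_comm, F2]
    · congr 1
      · refine sum_congr rfl fun j hj => ?_
        rw [mem_Icc] at hj
        rw [if_pos (by omega), probReal_univ, mul_one]
      · refine sum_congr rfl fun j hj => ?_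
        rw [mem_Icc] at hj
        rw [if_neg (by omega), trials_hitSet hp h1]
        congr 2; omega
    · rw [Finset.disjoint_left]
      intro a; simp only [mem_Icc]; omega

/-- The probability of a win when the lead is geometric, `P (lead ≥ x) = ((1 - p) / p) ^ x`. -/
noncomputable def winProb (δ k : ℕ) (p : ℝ) : ℝ :=
  F1 k p + ∑ i ∈ Icc 1 k, P1 i p * (trials p).real (winSet δ k (i - 1))

lemma winProb_one {p : ℝ} (hp : 1 / 2 < p) (h1 : p ≤ 1) (k : ℕ) :
    winProb 1 k p = upperBound k p := by
  unfold winProb upperBound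
  congr 1
  refine sum_congr rfl fun i hi => ?_
  rw [mem_Icc] at hi
  rw [trials_winSet hp h1 le_rfl hi.1 hi.2]
  rfl

lemma winProb_zero {p : ℝ} (hp : 1 / 2 < p) (h1 : p ≤ 1) (k : ℕ) :
    winProb 0 k p = lowerBound k p := by
  unfold winProb lowerBound
  congr 1
  refine sum_congr rfl fun i hi => ?_
  rw [mem_Icc] at hi
  rw [trials_winSet hp h1 zero_le_one hi.1 hi.2]
  rfl

/-- Summation by parts: the probability of a win, as a function of the tail probabilities `T` of
the lead, has nonnegative coefficients if `w` is monotone. -/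
lemma sum_tail_sub_mul (T w : ℕ → ℝ) (k : ℕ) :
    ∑ x ∈ range k, (T x - T (x + 1)) * w x + T k * w k =
      T 0 * w 0 + ∑ x ∈ range k, T (x + 1) * (w (x + 1) - w x) := by
  induction k with
  | zero => simp
  | succ k ih =>
    rw [sum_range_succ, sum_range_succ]
    linear_combination ih

lemma winProb_eq_sum (δ k : ℕ) {p : ℝ} (hp : 0 < p) (h1 : p ≤ 1) : winProb δ k p =
    ∑ x ∈ range k, (F1 x p - F1 (x + 1) p) * (trials p).real (winSet δ k x) +
      F1 k p * (trials p).real (winSet δ k k) := by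
  have := isProbabilityMeasure_trials hp.le h1
  rw [winProb, winSet_eq_univ le_rfl, probReal_univ, mul_one, add_comm]
  congr 1
  rw [← Finset.Ico_add_one_right_eq_Icc, sum_Ico_eq_sum_range]
  refine sum_congr (by simp) fun i _ => ?_
  have e : 1 + i - 1 = i := by omega
  rw [e, P1, e, F1, F1, pow_succ]
  ring

lemma winSet_mono (δ k : ℕ) : Monotone (winSet δ k) := fun _ _ hxy _ ⟨m, h1, h2⟩ =>
  ⟨m, by omega, by omega⟩

end Nakamoto

namespace Nakamoto

open Measure

/-! ### The Poisson process of blocks -/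

/-- The law of a gap between blocks and of the type of the block that ends it. -/
noncomputable def blockLaw (lam ρ : ℝ) : Measure (ℝ × Bool) :=
  (expMeasure lam).prod (bernoulli ρ)

/-- The law of the sequence of gaps and block types. -/
noncomputable def pathLaw (lam ρ : ℝ) : Measure (ℕ → ℝ × Bool) :=
  infinitePi fun _ : ℕ => blockLaw lam ρ

/-- The time at which the `n`-th block is mined. -/
def arrival (x : ℕ → ℝ × Bool) (n : ℕ) : ℝ := ∑ i ∈ Finset.range n, (x i).1

/-- The honest blocks mined more than `Δ` after their predecessors. -/
noncomputable def laggers (Δ : ℝ) (x : ℕ → ℝ × Bool) : ℕ → Bool :=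
  fun j => (x j).2 && decide (Δ < (x j).1)

/-- The paths on which exactly `n` blocks are mined by time `τ`. -/
def countEq (τ : ℝ) (n : ℕ) : Set (ℕ → ℝ × Bool) :=
  {x | arrival x n ≤ τ ∧ τ < arrival x (n + 1)}

/-- The laggers among the blocks after the first `n`, where the first of them has to be mined more
than `Δ` after time `τ` instead of after its predecessor. With `n` blocks mined by time `τ`, these
are independent of the past by the memoryless property. -/
noncomputable def laggersAfter (Δ τ : ℝ) (n : ℕ) (x : ℕ → ℝ × Bool) : ℕ → Bool :=
  fun i => if i = 0 then (x n).2 && decide (Δ < arrival x (n + 1) - τ) else laggers Δ x (n + i)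

lemma isProbabilityMeasure_blockLaw {lam ρ : ℝ} (hlam : 0 < lam) (h0 : 0 ≤ ρ) (h1 : ρ ≤ 1) :
    IsProbabilityMeasure (blockLaw lam ρ) := by
  have := isProbabilityMeasure_bernoulli h0 h1
  have := isProbabilityMeasure_expMeasure hlam
  unfold blockLaw; infer_instance

lemma expMeasure_Ioi {lam a : ℝ} (hlam : 0 < lam) (ha : 0 ≤ a) :
    expMeasure lam (Set.Ioi a) = ENNReal.ofReal (Real.exp (-(lam * a))) := by
  have := isProbabilityMeasure_expMeasure hlam
  have h := ofReal_cdf (expMeasure lam) a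
  rw [cdf_expMeasure_eq hlam, if_pos ha] at h
  rw [← Set.compl_Iic, prob_compl_eq_one_sub measurableSet_Iic, ← h, ← ENNReal.ofReal_one,
    ← ENNReal.ofReal_sub _ (by simpa using mul_nonneg hlam.le ha)]
  congr 1; ring

lemma blockLaw_gap {lam ρ a : ℝ} (hlam : 0 < lam) (h0 : 0 ≤ ρ) (h1 : ρ ≤ 1) (ha : 0 ≤ a) :
    blockLaw lam ρ {z | a < z.1} = ENNReal.ofReal (Real.exp (-(lam * a))) := by
  have := isProbabilityMeasure_bernoulli h0 h1
  have := isProbabilityMeasure_expMeasure hlam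
  have e : {z : ℝ × Bool | a < z.1} = Set.Ioi a ×ˢ Set.univ := by ext z; simp
  rw [blockLaw, e, prod_prod, measure_univ, mul_one, expMeasure_Ioi hlam ha]

lemma blockLaw_lagger {lam ρ a : ℝ} (hlam : 0 < lam) (h0 : 0 ≤ ρ) (h1 : ρ ≤ 1) (ha : 0 ≤ a) :
    blockLaw lam ρ {z | z.2 = true ∧ a < z.1} =
      ENNReal.ofReal (Real.exp (-(lam * a)) * ρ) := by
  have := isProbabilityMeasure_bernoulli h0 h1
  have := isProbabilityMeasure_expMeasure hlam
  have e : {z : ℝ × Bool | z.2 = true ∧ a < z.1} = Set.Ioi a ×ˢ {true} := by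
    ext z; simp [and_comm]
  rw [blockLaw, e, prod_prod, expMeasure_Ioi hlam ha, ENNReal.ofReal_mul (by positivity)]
  simp [bernoulli]

lemma measurableSet_lagger (a : ℝ) :
    MeasurableSet {z : ℝ × Bool | z.2 = true ∧ a < z.1} :=
  (measurableSet_eq_fun measurable_snd measurable_const).inter
    (measurableSet_lt measurable_const measurable_fst)

lemma measurable_arrival (n : ℕ) : Measurable fun x => arrival x n :=
  Finset.measurable_sum _ fun i _ => measurable_fst.comp (measurable_pi_apply i)

lemma measurableSet_countEq (τ : ℝ) (n : ℕ) : MeasurableSet (countEq τ n) :=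
  (measurableSet_le (measurable_arrival n) measurable_const).inter
    (measurableSet_lt measurable_const (measurable_arrival (n + 1)))

lemma measurable_and_decide {α : Type*} [MeasurableSpace α] {f : α → Bool} {g : α → ℝ}
    (hf : Measurable f) (hg : Measurable g) (a : ℝ) :
    Measurable fun x => f x && decide (a < g x) := by
  refine measurable_to_bool ?_
  have : (fun x => f x && decide (a < g x)) ⁻¹' {true} = {x | f x = true} ∩ {x | a < g x} := by
    ext x; simp
  rw [this]
  exact (measurableSet_eq_fun hf measurable_const).inter (measurableSet_lt measurable_const hg)

lemma measurable_laggers (Δ : ℝ) : Measurable (laggers Δ) :=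
  measurable_pi_iff.2 fun j => measurable_and_decide
    (measurable_snd.comp (measurable_pi_apply j)) (measurable_fst.comp (measurable_pi_apply j)) Δ

lemma measurable_laggersAfter (Δ τ : ℝ) (n : ℕ) : Measurable (laggersAfter Δ τ n) := by
  refine measurable_pi_iff.2 fun i => ?_
  by_cases hi : i = 0
  · simp only [laggersAfter, if_pos hi]
    exact measurable_and_decide (measurable_snd.comp (measurable_pi_apply n))
      ((measurable_arrival (n + 1)).sub_const τ) Δ
  · simp only [laggersAfter, if_neg hi]
    exact (measurable_pi_apply (n + i)).comp (measurable_laggers Δ)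

/-- The laggers are independent, each with probability `ρ e^{-λΔ}`. -/
lemma map_laggers {lam ρ Δ : ℝ} (hlam : 0 < lam) (h0 : 0 ≤ ρ) (h1 : ρ ≤ 1) (hΔ : 0 ≤ Δ) :
    (pathLaw lam ρ).map (laggers Δ) = trials (ρ * Real.exp (-(lam * Δ))) := by
  have := isProbabilityMeasure_blockLaw hlam h0 h1
  set f : ℝ × Bool → Bool := fun z => z.2 && decide (Δ < z.1) with hf
  have hfm : Measurable f := measurable_and_decide measurable_snd measurable_fst Δ
  have hexp : Real.exp (-(lam * Δ)) ≤ 1 := by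
    rw [Real.exp_le_one_iff]; have := mul_nonneg hlam.le hΔ; linarith
  have hp0 : 0 ≤ ρ * Real.exp (-(lam * Δ)) := by positivity
  have hp1 : ρ * Real.exp (-(lam * Δ)) ≤ 1 := mul_le_one₀ h1 (by positivity) hexp
  have hmap : (blockLaw lam ρ).map f = bernoulli (ρ * Real.exp (-(lam * Δ))) := by
    have := isProbabilityMeasure_bernoulli hp0 hp1
    have := isProbabilityMeasure_map (μ := blockLaw lam ρ) hfm.aemeasurable
    have htrue : (blockLaw lam ρ).map f {true} =
        bernoulli (ρ * Real.exp (-(lam * Δ))) {true} := by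
      have e : f ⁻¹' {true} = {z | z.2 = true ∧ Δ < z.1} := by ext z; simp [hf]
      rw [Measure.map_apply hfm (measurableSet_singleton _), e, blockLaw_lagger hlam h0 h1 hΔ,
        mul_comm]
      simp [bernoulli]
    have hc : ({false} : Set Bool) = {true}ᶜ := by ext b; cases b <;> simp
    refine Measure.ext_of_singleton fun b => ?_
    cases b with
    | true => exact htrue
    | false =>
      rw [hc, prob_compl_eq_one_sub (measurableSet_singleton _),
        prob_compl_eq_one_sub (measurableSet_singleton _), htrue]
  have h := infinitePi_map_pi (fun _ : ℕ => blockLaw lam ρ) (f := fun _ => f) fun _ => hfm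
  simp only [hmap] at h
  exact h

@[simp] lemma arrival_zero (x : ℕ → ℝ × Bool) : arrival x 0 = 0 := by simp [arrival]

lemma arrival_succ (x : ℕ → ℝ × Bool) (n : ℕ) : arrival x (n + 1) = arrival x n + (x n).1 := by
  simp [arrival, Finset.sum_range_succ]

lemma arrival_consSeq (z : ℝ × Bool) (x : ℕ → ℝ × Bool) (n : ℕ) :
    arrival (consSeq z x) (n + 1) = z.1 + arrival x n := by
  simp [arrival, Finset.sum_range_succ', add_comm]

lemma laggersAfter_zero_consSeq (Δ τ : ℝ) (z : ℝ × Bool) (x : ℕ → ℝ × Bool) :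
    laggersAfter Δ τ 0 (consSeq z x) =
      consSeq (z.2 && decide (Δ < z.1 - τ)) (laggers Δ x) := by
  funext i
  cases i with
  | zero => simp [laggersAfter, arrival_consSeq]
  | succ i => simp [laggersAfter, laggers]

lemma laggersAfter_succ_consSeq (Δ τ : ℝ) (n : ℕ) (z : ℝ × Bool) (x : ℕ → ℝ × Bool) :
    laggersAfter Δ τ (n + 1) (consSeq z x) = laggersAfter Δ (τ - z.1) n x := by
  funext i
  have e1 : z.1 + arrival x (n + 1) - τ = arrival x (n + 1) - (τ - z.1) := by ring
  have e2 : n + 1 + i = n + i + 1 := by omega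
  simp [laggersAfter, arrival_consSeq, laggers, e1, e2]

/-- The memoryless property at the time `τ ≥ 0` when no block has been mined by then. -/
lemma pathLaw_countEq_zero {lam ρ Δ τ : ℝ} (hlam : 0 < lam) (h0 : 0 ≤ ρ) (h1 : ρ ≤ 1)
    (hΔ : 0 ≤ Δ) (hτ : 0 ≤ τ) {S : Set (ℕ → Bool)} (hS : MeasurableSet S) :
    pathLaw lam ρ (countEq τ 0 ∩ laggersAfter Δ τ 0 ⁻¹' S) =
      pathLaw lam ρ (countEq τ 0) * trials (ρ * Real.exp (-(lam * Δ))) S := by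
  have := isProbabilityMeasure_blockLaw hlam h0 h1
  have hπ : IsProbabilityMeasure (pathLaw lam ρ) := by unfold pathLaw; infer_instance
  set p := ρ * Real.exp (-(lam * Δ)) with hp
  have hexp : Real.exp (-(lam * Δ)) ≤ 1 := by
    rw [Real.exp_le_one_iff]; have := mul_nonneg hlam.le hΔ; linarith
  have hp0 : 0 ≤ p := by positivity
  have hp1 : p ≤ 1 := mul_le_one₀ h1 (by positivity) hexp
  set E₁ : Set (ℝ × Bool) := {z | z.2 = true ∧ τ + Δ < z.1} with hE₁
  set E₀ : Set (ℝ × Bool) := {z | τ < z.1} with hE₀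
  have hE₁m : MeasurableSet E₁ := measurableSet_lagger _
  have hE₀m : MeasurableSet E₀ := measurableSet_lt measurable_const measurable_fst
  have hsub : E₁ ⊆ E₀ := fun z hz => by
    have := hz.2
    change τ < z.1
    linarith
  have hm₁ : blockLaw lam ρ E₁ = ENNReal.ofReal (Real.exp (-(lam * τ)) * p) := by
    rw [blockLaw_lagger hlam h0 h1 (by positivity), hp]
    congr 1
    rw [mul_add, neg_add, Real.exp_add]; ring
  have hm₀ : blockLaw lam ρ E₀ = ENNReal.ofReal (Real.exp (-(lam * τ))) :=
    blockLaw_gap hlam h0 h1 hτ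
  have hm₂ : blockLaw lam ρ (E₀ \ E₁) = ENNReal.ofReal (Real.exp (-(lam * τ)) * (1 - p)) := by
    rw [measure_sdiff hsub hE₁m.nullMeasurableSet (measure_ne_top _ _), hm₀, hm₁,
      ← ENNReal.ofReal_sub _ (by positivity)]
    congr 1; ring
  have htail : ∀ S' : Set (ℕ → Bool), MeasurableSet S' →
      pathLaw lam ρ (laggers Δ ⁻¹' S') = trials p S' := fun S' hS' => by
    rw [← map_laggers hlam h0 h1 hΔ, Measure.map_apply (measurable_laggers Δ) hS']
  have hcount : ∀ (z : ℝ × Bool) (x : ℕ → ℝ × Bool), consSeq z x ∈ countEq τ 0 ↔ z ∈ E₀ := by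
    intro z x
    simp [countEq, arrival_consSeq, hE₀, hτ]
  have hint : ∀ z, pathLaw lam ρ (consSeq z ⁻¹' (countEq τ 0 ∩ laggersAfter Δ τ 0 ⁻¹' S)) =
      E₁.indicator (fun _ => trials p (consSeq true ⁻¹' S)) z +
        (E₀ \ E₁).indicator (fun _ => trials p (consSeq false ⁻¹' S)) z := by
    intro z
    have hlag : (z.2 && decide (Δ < z.1 - τ)) = true ↔ z ∈ E₁ := by
      simp only [hE₁, Bool.and_eq_true, decide_eq_true_eq, Set.mem_ofPred_eq, lt_sub_iff_add_lt']
    by_cases hz0 : z ∈ E₀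
    · have hset : consSeq z ⁻¹' (countEq τ 0 ∩ laggersAfter Δ τ 0 ⁻¹' S) =
          laggers Δ ⁻¹' (consSeq (z.2 && decide (Δ < z.1 - τ)) ⁻¹' S) := by
        ext x
        simp only [Set.mem_preimage, Set.mem_inter_iff, hcount, hz0, true_and,
          laggersAfter_zero_consSeq]
      rw [hset, htail _ (measurable_consSeq_right _ hS)]
      by_cases hz1 : z ∈ E₁
      · simp [hz1, hlag.2 hz1]
      · have : (z.2 && decide (Δ < z.1 - τ)) = false := by
          rw [← Bool.not_eq_true, hlag]; exact hz1
        rw [this]; simp [hz1, hz0]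
    · have hset : consSeq z ⁻¹' (countEq τ 0 ∩ laggersAfter Δ τ 0 ⁻¹' S) = ∅ := by
        ext x
        simp only [Set.mem_preimage, Set.mem_inter_iff, hcount, hz0, false_and,
          Set.mem_empty_iff_false]
      have hz1 : z ∉ E₁ := fun h => hz0 (hsub h)
      rw [hset, measure_empty]; simp [hz0, hz1]
  have hcount0 : pathLaw lam ρ (countEq τ 0) = ENNReal.ofReal (Real.exp (-(lam * τ))) := by
    rw [pathLaw, infinitePi_apply_consSeq _ (measurableSet_countEq τ 0), ← hm₀,
      ← lintegral_indicator_one hE₀m]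
    refine lintegral_congr fun z => ?_
    by_cases hz0 : z ∈ E₀
    · have : consSeq z ⁻¹' countEq τ 0 = Set.univ := by ext x; simp [hcount, hz0]
      rw [this, measure_univ]; simp [hz0]
    · have : consSeq z ⁻¹' countEq τ 0 = ∅ := by ext x; simp [hcount, hz0]
      rw [this, measure_empty]; simp [hz0]
  have hmeas := (measurableSet_countEq τ 0).inter (measurable_laggersAfter Δ τ 0 hS)
  have hmain : pathLaw lam ρ (countEq τ 0 ∩ laggersAfter Δ τ 0 ⁻¹' S) =
      ∫⁻ z, pathLaw lam ρ (consSeq z ⁻¹' (countEq τ 0 ∩ laggersAfter Δ τ 0 ⁻¹' S))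
        ∂(blockLaw lam ρ) := infinitePi_apply_consSeq _ hmeas
  rw [ENNReal.ofReal_mul (Real.exp_pos _).le] at hm₁ hm₂
  rw [hmain, lintegral_congr hint, lintegral_add_left (measurable_const.indicator hE₁m),
    lintegral_indicator_const hE₁m, lintegral_indicator_const (hE₀m.diff hE₁m), hm₁, hm₂,
    hcount0, trials_apply hp0 hp1 hS]
  ring

/-- The memoryless property: given the past up to time `τ`, the laggers after time `τ` are
independent trials. -/
theorem pathLaw_countEq {lam ρ Δ : ℝ} (hlam : 0 < lam) (h0 : 0 ≤ ρ) (h1 : ρ ≤ 1)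
    (hΔ : 0 ≤ Δ) (τ : ℝ) (n : ℕ) {A : Set (ℕ → ℝ × Bool)} (hAm : MeasurableSet A)
    (hA : ∀ x y : ℕ → ℝ × Bool, (∀ i < n, x i = y i) → (x ∈ A ↔ y ∈ A))
    {S : Set (ℕ → Bool)} (hS : MeasurableSet S) :
    pathLaw lam ρ (countEq τ n ∩ A ∩ laggersAfter Δ τ n ⁻¹' S) =
      pathLaw lam ρ (countEq τ n ∩ A) * trials (ρ * Real.exp (-(lam * Δ))) S := by
  have := isProbabilityMeasure_blockLaw hlam h0 h1
  induction n generalizing τ A with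
  | zero =>
    rcases A.eq_empty_or_nonempty with rfl | ⟨a, ha⟩
    · simp
    obtain rfl : A = Set.univ := Set.eq_univ_of_forall fun x => (hA a x (by simp)).1 ha
    rcases lt_or_ge τ 0 with hτ | hτ
    · have : countEq τ 0 = ∅ := by
        ext x; simp [countEq, not_le.2 hτ]
      simp [this]
    · simp only [Set.inter_univ]
      exact pathLaw_countEq_zero hlam h0 h1 hΔ hτ hS
  | succ n ih =>
    have hcount : ∀ z : ℝ × Bool, consSeq z ⁻¹' countEq τ (n + 1) = countEq (τ - z.1) n := by
      intro z
      ext x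
      simp only [countEq, Set.mem_preimage, Set.mem_ofPred_eq, arrival_consSeq]
      constructor <;> rintro ⟨ha, hb⟩ <;> constructor <;> linarith
    have hafter : ∀ z : ℝ × Bool, consSeq z ⁻¹' (laggersAfter Δ τ (n + 1) ⁻¹' S) =
        laggersAfter Δ (τ - z.1) n ⁻¹' S := by
      intro z
      ext x
      simp only [Set.mem_preimage, laggersAfter_succ_consSeq]
    have hCA := (measurableSet_countEq τ (n + 1)).inter hAm
    have e1 : pathLaw lam ρ (countEq τ (n + 1) ∩ A ∩ laggersAfter Δ τ (n + 1) ⁻¹' S) =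
        ∫⁻ z, pathLaw lam ρ (countEq (τ - z.1) n ∩ consSeq z ⁻¹' A ∩
          laggersAfter Δ (τ - z.1) n ⁻¹' S) ∂(blockLaw lam ρ) := by
      rw [pathLaw, infinitePi_apply_consSeq _ (hCA.inter (measurable_laggersAfter Δ τ (n + 1) hS))]
      simp only [Set.preimage_inter, hcount, hafter]
    have e2 : pathLaw lam ρ (countEq τ (n + 1) ∩ A) =
        ∫⁻ z, pathLaw lam ρ (countEq (τ - z.1) n ∩ consSeq z ⁻¹' A) ∂(blockLaw lam ρ) := by
      rw [pathLaw, infinitePi_apply_consSeq _ hCA]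
      simp only [Set.preimage_inter, hcount]
    have hp0 : 0 ≤ ρ * Real.exp (-(lam * Δ)) := by positivity
    have hexp : Real.exp (-(lam * Δ)) ≤ 1 := by
      rw [Real.exp_le_one_iff]; have := mul_nonneg hlam.le hΔ; linarith
    have := isProbabilityMeasure_trials hp0 (mul_le_one₀ h1 (by positivity) hexp)
    rw [e1, e2, ← lintegral_mul_const' _ _ (measure_ne_top _ _)]
    refine lintegral_congr fun z => ih (τ - z.1) (measurable_consSeq_right z hAm) ?_
    intro x y hxy
    refine hA _ _ fun i hi => ?_
    cases i with
    | zero => rfl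
    | succ i => exact hxy i (by omega)

end Nakamoto

namespace Nakamoto

open Measure Filter

/-! ### Almost sure properties of the mining process -/

lemma isProbabilityMeasure_pathLaw {lam ρ : ℝ} (hlam : 0 < lam) (h0 : 0 ≤ ρ) (h1 : ρ ≤ 1) :
    IsProbabilityMeasure (pathLaw lam ρ) := by
  have := isProbabilityMeasure_blockLaw hlam h0 h1
  unfold pathLaw; infer_instance

lemma mul_exp_le_one {lam ρ Δ : ℝ} (hlam : 0 < lam) (h1 : ρ ≤ 1) (hΔ : 0 ≤ Δ) :
    ρ * Real.exp (-(lam * Δ)) ≤ 1 := by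
  have hexp : Real.exp (-(lam * Δ)) ≤ 1 := by
    rw [Real.exp_le_one_iff]; have := mul_nonneg hlam.le hΔ; linarith
  exact mul_le_one₀ h1 (by positivity) hexp

lemma ae_pathLaw_gap_pos {lam ρ : ℝ} (hlam : 0 < lam) (h0 : 0 ≤ ρ) (h1 : ρ ≤ 1) :
    ∀ᵐ x ∂(pathLaw lam ρ), ∀ j, 0 < (x j).1 := by
  have := isProbabilityMeasure_blockLaw hlam h0 h1
  rw [ae_all_iff]
  intro j
  have hae : ∀ᵐ z ∂(blockLaw lam ρ), 0 < z.1 := by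
    refine (mem_ae_iff_prob_eq_one (measurableSet_lt measurable_const measurable_fst)).2 ?_
    rw [blockLaw_gap hlam h0 h1 le_rfl]; simp
  rw [← infinitePi_map_eval (fun _ : ℕ => blockLaw lam ρ) j] at hae
  exact ae_of_ae_map (measurable_pi_apply j).aemeasurable hae

/-- An event of positive probability occurs at infinitely many blocks. -/
lemma ae_pathLaw_frequently {lam ρ : ℝ} (hlam : 0 < lam) (h0 : 0 ≤ ρ) (h1 : ρ ≤ 1)
    {B : Set (ℝ × Bool)} (hB : MeasurableSet B) (hpos : blockLaw lam ρ B ≠ 0) :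
    ∀ᵐ x ∂(pathLaw lam ρ), ∀ i, ∃ j ≥ i, x j ∈ B := by
  have := isProbabilityMeasure_blockLaw hlam h0 h1
  have hπ := isProbabilityMeasure_pathLaw hlam h0 h1
  set s : ℕ → Set (ℕ → ℝ × Bool) := fun j => (fun x => x j) ⁻¹' B with hs
  have hsm : ∀ j, MeasurableSet (s j) := fun j => measurable_pi_apply j hB
  have hmeas : ∀ j, pathLaw lam ρ (s j) = blockLaw lam ρ B := fun j => by
    conv_rhs => rw [← infinitePi_map_eval (fun _ : ℕ => blockLaw lam ρ) j,
      Measure.map_apply (measurable_pi_apply j) hB]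
    rfl
  have hind : iIndepSet s (pathLaw lam ρ) := by
    refine (iIndepSet_iff_meas_biInter hsm).2 fun t => ?_
    have e : ⋂ i ∈ t, s i = Set.pi (t : Set ℕ) fun _ => B := by ext x; simp [hs, Set.mem_pi]
    rw [e, pathLaw, infinitePi_pi _ fun _ _ => hB]
    exact Finset.prod_congr rfl fun i _ => (hmeas i).symm
  have hone := measure_limsup_eq_one hsm hind (by
    simp only [hmeas]; exact ENNReal.tsum_const_eq_top_of_ne_zero hpos)
  filter_upwards [(mem_ae_iff_prob_eq_one (MeasurableSet.measurableSet_limsup hsm)).2 hone]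
    with x hx i
  exact frequently_atTop.1 (mem_limsup_iff_frequently_mem.1 hx) i

/-- The properties of a path that hold almost surely: no simultaneous blocks, no accumulation of
blocks, and infinitely many laggers. -/
structure IsRegular (Δ : ℝ) (x : ℕ → ℝ × Bool) : Prop where
  gap_pos : ∀ j, 0 < (x j).1
  tendsto : Tendsto (arrival x) atTop atTop
  exists_lagger : ∀ i, ∃ j ≥ i, (x j).2 = true ∧ Δ < (x j).1

lemma IsRegular.strictMono {Δ : ℝ} {x : ℕ → ℝ × Bool} (h : IsRegular Δ x) :
    StrictMono (arrival x) :=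
  strictMono_nat_of_lt_succ fun n => by rw [arrival_succ]; linarith [h.gap_pos n]

lemma tendsto_arrival {x : ℕ → ℝ × Bool} (hpos : ∀ j, 0 < (x j).1)
    (hbig : ∀ i, ∃ j ≥ i, 1 < (x j).1) : Tendsto (arrival x) atTop atTop := by
  have hmono : Monotone (arrival x) :=
    monotone_nat_of_le_succ fun n => by rw [arrival_succ]; linarith [hpos n]
  have hunb : ∀ K : ℕ, ∃ n, (K : ℝ) ≤ arrival x n := by
    intro K
    induction K with
    | zero => exact ⟨0, by simp⟩
    | succ K ih =>
      obtain ⟨n, hn⟩ := ih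
      obtain ⟨j, hj, hj1⟩ := hbig n
      refine ⟨j + 1, ?_⟩
      rw [arrival_succ]
      have := hmono hj
      push_cast; linarith
  refine tendsto_atTop_atTop.2 fun b => ?_
  obtain ⟨n, hn⟩ := hunb ⌈b⌉₊
  exact ⟨n, fun m hm => (Nat.le_ceil b).trans (hn.trans (hmono hm))⟩

lemma ae_isRegular {lam ρ Δ : ℝ} (hlam : 0 < lam) (h0 : 0 < ρ) (h1 : ρ ≤ 1) (hΔ : 0 ≤ Δ) :
    ∀ᵐ x ∂(pathLaw lam ρ), IsRegular Δ x := by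
  have e1 : blockLaw lam ρ {z | 1 < z.1} ≠ 0 := by
    rw [blockLaw_gap hlam h0.le h1 zero_le_one]; simp [Real.exp_pos]
  have e2 : blockLaw lam ρ {z | z.2 = true ∧ Δ < z.1} ≠ 0 := by
    rw [blockLaw_lagger hlam h0.le h1 hΔ]
    simp only [ne_eq, ENNReal.ofReal_eq_zero, not_le]; positivity
  filter_upwards [ae_pathLaw_gap_pos hlam h0.le h1,
    ae_pathLaw_frequently hlam h0.le h1 (measurableSet_lt measurable_const measurable_fst) e1,
    ae_pathLaw_frequently hlam h0.le h1 (measurableSet_lagger Δ) e2] with x hx1 hx2 hx3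
  exact ⟨hx1, tendsto_arrival hx1 hx2, hx3⟩

lemma aedisjoint_countEq {lam ρ : ℝ} (hlam : 0 < lam) (h0 : 0 < ρ) (h1 : ρ ≤ 1) (τ : ℝ) :
    Pairwise fun m n => AEDisjoint (pathLaw lam ρ) (countEq τ m) (countEq τ n) := by
  have key : ∀ m n, m < n → AEDisjoint (pathLaw lam ρ) (countEq τ m) (countEq τ n) := by
    intro m n hmn
    refine measure_mono_null (t := {x | IsRegular 0 x}ᶜ) ?_ (ae_isRegular hlam h0 h1 le_rfl)
    rintro x ⟨⟨-, hx1⟩, ⟨hx2, -⟩⟩ hx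
    have := hx.strictMono.monotone (show m + 1 ≤ n from hmn)
    linarith
  intro m n hmn
  rcases hmn.lt_or_gt with h | h
  · exact key m n h
  · exact (key n m h).symm

/-! ### The adversary's lead at time `τ` -/

/-- The reversal of the first `n` indices. -/
def revFirst (n i : ℕ) : ℕ := if i < n then n - 1 - i else i

lemma revFirst_injective (n : ℕ) : Function.Injective (revFirst n) := by
  intro i j hij
  unfold revFirst at hij
  split_ifs at hij <;> omega

lemma good_eq_sum (y : ℕ → Bool) (m : ℕ) :
    good y m = ∑ i ∈ Finset.range m, if y i = true then 1 else 0 := by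
  induction m with
  | zero => simp
  | succ m ih => rw [good_succ, Finset.sum_range_succ, ih]

lemma bad_eq_sum (y : ℕ → Bool) (m : ℕ) :
    bad y m = ∑ i ∈ Finset.range m, if y i = false then 1 else 0 := by
  induction m with
  | zero => simp
  | succ m ih => rw [bad_succ, Finset.sum_range_succ, ih]

/-- Reading the first `n` blocks backwards turns the reflected walk into a running maximum. -/
lemma le_lead_revFirst_iff {y : ℕ → Bool} {n a : ℕ} :
    a ≤ lead (fun i => y (revFirst n i)) n ↔ y ∈ hitSetBy n a := by
  have key : ∀ m ≤ n, good (shift m fun i => y (revFirst n i)) (n - m) = good y (n - m) ∧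
      bad (shift m fun i => y (revFirst n i)) (n - m) = bad y (n - m) := by
    intro m hm
    have e : ∀ i ∈ Finset.range (n - m),
        (shift m fun i => y (revFirst n i)) i = y (n - m - 1 - i) := by
      intro i hi
      rw [Finset.mem_range] at hi
      have : revFirst n (m + i) = n - m - 1 - i := by
        rw [revFirst, if_pos (by omega)]; omega
      simp [shift, this]
    constructor
    · rw [good_eq_sum, good_eq_sum, ← Finset.sum_range_reflect]
      refine Finset.sum_congr rfl fun i hi => ?_
      rw [e _ (by rw [Finset.mem_range] at hi ⊢; omega)]
      rw [Finset.mem_range] at hi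
      congr 3; omega
    · rw [bad_eq_sum, bad_eq_sum, ← Finset.sum_range_reflect]
      refine Finset.sum_congr rfl fun i hi => ?_
      rw [e _ (by rw [Finset.mem_range] at hi ⊢; omega)]
      rw [Finset.mem_range] at hi
      congr 3; omega
  rw [le_lead_iff]
  constructor
  · rintro ⟨m, hm, h⟩
    rw [(key m hm).1, (key m hm).2] at h
    exact ⟨n - m, by omega, h⟩
  · rintro ⟨m, hm, h⟩
    refine ⟨n - m, by omega, ?_⟩
    rw [(key (n - m) (by omega)).1, (key (n - m) (by omega)).2, Nat.sub_sub_self hm]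
    exact h

lemma arrival_revFirst (x : ℕ → ℝ × Bool) (n : ℕ) :
    arrival (fun i => x (revFirst n i)) n = arrival x n := by
  unfold arrival
  rw [← Finset.sum_range_reflect (fun i => (x i).1)]
  refine Finset.sum_congr rfl fun i hi => ?_
  rw [Finset.mem_range] at hi
  simp [revFirst, hi]

lemma measurableSet_le_lead (Δ : ℝ) (n a : ℕ) :
    MeasurableSet {x : ℕ → ℝ × Bool | a ≤ lead (laggers Δ x) n} :=
  measurableSet_le measurable_const ((measurable_lead n).comp (measurable_laggers Δ))

/-- The blocks mined by time `τ` are exchangeable, so they can be read backwards. -/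
lemma pathLaw_countEq_le_lead {lam ρ Δ : ℝ} (hlam : 0 < lam) (h0 : 0 ≤ ρ) (h1 : ρ ≤ 1)
    (τ : ℝ) (n a : ℕ) :
    pathLaw lam ρ (countEq τ n ∩ {x | a ≤ lead (laggers Δ x) n}) =
      pathLaw lam ρ (countEq τ n ∩ laggers Δ ⁻¹' hitSetBy n a) := by
  have := isProbabilityMeasure_blockLaw hlam h0 h1
  have hmap := map_infinitePi_infinitePi_of_inj (P := fun _ : ℕ => blockLaw lam ρ)
    (revFirst_injective n)
  have hm : Measurable fun (x : ℕ → ℝ × Bool) i => x (revFirst n i) :=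
    measurable_pi_iff.2 fun i => measurable_pi_apply _
  conv_lhs => rw [pathLaw, ← hmap, Measure.map_apply hm
    ((measurableSet_countEq τ n).inter (measurableSet_le_lead Δ n a))]
  congr 1
  ext x
  have e1 : arrival (fun i => x (revFirst n i)) (n + 1) = arrival x (n + 1) := by
    rw [arrival_succ, arrival_succ, arrival_revFirst]
    simp [revFirst]
  have e2 : laggers Δ (fun i => x (revFirst n i)) = fun i => laggers Δ x (revFirst n i) := rfl
  simp only [Set.mem_preimage, Set.mem_inter_iff, countEq, Set.mem_ofPred_eq, arrival_revFirst,
    e1, e2, le_lead_revFirst_iff]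

/-- The probability that the adversary's lead at time `τ` is at least `a`. -/
noncomputable def leadTail (lam ρ Δ τ : ℝ) (a : ℕ) : ℝ :=
  (pathLaw lam ρ).real (⋃ n, countEq τ n ∩ {x | a ≤ lead (laggers Δ x) n})

lemma aedisjoint_countEq_inter {lam ρ : ℝ} (hlam : 0 < lam) (h0 : 0 < ρ) (h1 : ρ ≤ 1) (τ : ℝ)
    (B : ℕ → Set (ℕ → ℝ × Bool)) :
    Pairwise fun m n => AEDisjoint (pathLaw lam ρ) (countEq τ m ∩ B m) (countEq τ n ∩ B n) :=
  fun _ _ hmn => (aedisjoint_countEq hlam h0 h1 τ hmn).mono Set.inter_subset_left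
    Set.inter_subset_left

lemma pathLaw_iUnion_countEq {lam ρ : ℝ} (hlam : 0 < lam) (h0 : 0 < ρ) (h1 : ρ ≤ 1) (τ : ℝ)
    {B : ℕ → Set (ℕ → ℝ × Bool)} (hB : ∀ n, MeasurableSet (B n)) :
    pathLaw lam ρ (⋃ n, countEq τ n ∩ B n) = ∑' n, pathLaw lam ρ (countEq τ n ∩ B n) :=
  measure_iUnion₀ (aedisjoint_countEq_inter hlam h0 h1 τ B) fun n =>
    ((measurableSet_countEq τ n).inter (hB n)).nullMeasurableSet

lemma leadTail_eq {lam ρ Δ : ℝ} (hlam : 0 < lam) (h0 : 0 < ρ) (h1 : ρ ≤ 1) (τ : ℝ) (a : ℕ) :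
    leadTail lam ρ Δ τ a =
      (pathLaw lam ρ).real (⋃ n, countEq τ n ∩ laggers Δ ⁻¹' hitSetBy n a) := by
  rw [leadTail, Measure.real, Measure.real,
    pathLaw_iUnion_countEq hlam h0 h1 τ fun n => measurableSet_le_lead Δ n a,
    pathLaw_iUnion_countEq hlam h0 h1 τ fun n => measurable_laggers Δ (measurableSet_hitSetBy n a)]
  simp only [pathLaw_countEq_le_lead hlam h0.le h1]

lemma pathLaw_hitSet {lam ρ Δ : ℝ} (hlam : 0 < lam) (h0 : 0 ≤ ρ) (h1 : ρ ≤ 1) (hΔ : 0 ≤ Δ)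
    (hp : 1 / 2 < ρ * Real.exp (-(lam * Δ))) (a : ℕ) :
    (pathLaw lam ρ).real (laggers Δ ⁻¹' hitSet a) = F1 a (ρ * Real.exp (-(lam * Δ))) := by
  rw [← trials_hitSet hp (mul_exp_le_one hlam h1 hΔ), ← map_laggers hlam h0 h1 hΔ,
    Measure.real, Measure.real, Measure.map_apply (measurable_laggers Δ) (measurableSet_hitSet a)]

/-- At all times, the lead is stochastically at most geometric. -/
lemma leadTail_le {lam ρ Δ : ℝ} (hlam : 0 < lam) (h0 : 0 < ρ) (h1 : ρ ≤ 1) (hΔ : 0 ≤ Δ)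
    (hp : 1 / 2 < ρ * Real.exp (-(lam * Δ))) (τ : ℝ) (a : ℕ) :
    leadTail lam ρ Δ τ a ≤ F1 a (ρ * Real.exp (-(lam * Δ))) := by
  have := isProbabilityMeasure_pathLaw hlam h0.le h1
  rw [leadTail_eq hlam h0 h1, ← pathLaw_hitSet hlam h0.le h1 hΔ hp]
  refine measureReal_mono (Set.iUnion_subset fun n x hx => ?_)
  rw [Set.mem_preimage, hitSet_eq_iUnion]
  exact Set.mem_iUnion.2 ⟨n, hx.2⟩

/-- The law of the lead converges to the geometric one. -/
lemma tendsto_leadTail {lam ρ Δ : ℝ} (hlam : 0 < lam) (h0 : 0 < ρ) (h1 : ρ ≤ 1) (hΔ : 0 ≤ Δ)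
    (hp : 1 / 2 < ρ * Real.exp (-(lam * Δ))) (a : ℕ) :
    Tendsto (fun τ => leadTail lam ρ Δ τ a) atTop
      (nhds (F1 a (ρ * Real.exp (-(lam * Δ))))) := by
  have hπ := isProbabilityMeasure_pathLaw hlam h0.le h1
  set K : ℝ → Set (ℕ → ℝ × Bool) := fun τ =>
    {x | ∃ m, arrival x m ≤ τ ∧ good (laggers Δ x) m + a ≤ bad (laggers Δ x) m} with hK
  have hmono : Monotone K := fun s t hst x ⟨m, hm, h⟩ => ⟨m, hm.trans hst, h⟩
  have hunion : ⋃ τ, K τ = laggers Δ ⁻¹' hitSet a := by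
    ext x
    simp only [hK, Set.mem_iUnion, Set.mem_ofPred_eq, Set.mem_preimage, hitSet]
    exact ⟨fun ⟨τ, m, _, h⟩ => ⟨m, h⟩, fun ⟨m, h⟩ => ⟨arrival x m, m, le_rfl, h⟩⟩
  have hlim := tendsto_measure_iUnion_atTop (μ := pathLaw lam ρ) hmono
  rw [hunion] at hlim
  have hlim' := (ENNReal.tendsto_toReal (measure_ne_top _ _)).comp hlim
  change Tendsto _ _ (nhds ((pathLaw lam ρ).real _)) at hlim'
  rw [pathLaw_hitSet hlam h0.le h1 hΔ hp] at hlim'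
  refine tendsto_of_tendsto_of_tendsto_of_le_of_le' hlim' tendsto_const_nhds ?_
    (Eventually.of_forall fun τ => leadTail_le hlam h0 h1 hΔ hp τ a)
  filter_upwards [eventually_ge_atTop 0] with τ hτ
  rw [leadTail_eq hlam h0 h1]
  refine ENNReal.toReal_mono (measure_ne_top _ _) (measure_mono_ae ?_)
  filter_upwards [ae_isRegular hlam h0 h1 hΔ] with x hx hxK
  obtain ⟨m, hm, h⟩ := hxK
  obtain ⟨l, hl1, hl2⟩ := Execution.exists_last_index hx.strictMono hx.tendsto (n := 0) (T := τ)
    (by simpa using hτ)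
  refine Set.mem_iUnion.2 ⟨0 + l, ⟨hl1, hl2⟩, m, ?_, h⟩
  have := hx.strictMono.lt_iff_lt.1 (hm.trans_lt hl2)
  omega

end Nakamoto

namespace Nakamoto

open Measure Filter

/-! ### The probability of a win at time `τ` -/

/-- The adversary, with its lead at time `τ`, wins against the laggers after time `τ`. -/
def winEvent (Δ τ : ℝ) (δ k : ℕ) : Set (ℕ → ℝ × Bool) :=
  ⋃ n, countEq τ n ∩ {x | laggersAfter Δ τ n x ∈ winSet δ k (lead (laggers Δ x) n)}

lemma measurableSet_lead_eq (Δ : ℝ) (n a : ℕ) :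
    MeasurableSet {x : ℕ → ℝ × Bool | lead (laggers Δ x) n = a} :=
  measurableSet_eq_fun ((measurable_lead n).comp (measurable_laggers Δ)) measurable_const

lemma measurableSet_laggersAfter_mem (Δ τ : ℝ) (δ k n : ℕ) :
    MeasurableSet {x | laggersAfter Δ τ n x ∈ winSet δ k (lead (laggers Δ x) n)} := by
  have : {x | laggersAfter Δ τ n x ∈ winSet δ k (lead (laggers Δ x) n)} =
      ⋃ a, ({x | lead (laggers Δ x) n = a} ∩ laggersAfter Δ τ n ⁻¹' winSet δ k a) := by
    ext x; simp
  rw [this]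
  exact .iUnion fun a => (measurableSet_lead_eq Δ n a).inter
    (measurable_laggersAfter Δ τ n (measurableSet_winSet δ k a))

lemma measurableSet_winEvent (Δ τ : ℝ) (δ k : ℕ) : MeasurableSet (winEvent Δ τ δ k) :=
  .iUnion fun n => (measurableSet_countEq τ n).inter (measurableSet_laggersAfter_mem Δ τ δ k n)

lemma pathLaw_countEq_win {lam ρ Δ : ℝ} (hlam : 0 < lam) (h0 : 0 ≤ ρ) (h1 : ρ ≤ 1)
    (hΔ : 0 ≤ Δ) (τ : ℝ) (δ k n : ℕ) :
    pathLaw lam ρ (countEq τ n ∩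
        {x | laggersAfter Δ τ n x ∈ winSet δ k (lead (laggers Δ x) n)}) =
      ∑ a ∈ Finset.range k, pathLaw lam ρ (countEq τ n ∩ {x | lead (laggers Δ x) n = a}) *
        trials (ρ * Real.exp (-(lam * Δ))) (winSet δ k a) +
      pathLaw lam ρ (countEq τ n ∩ {x | k ≤ lead (laggers Δ x) n}) := by
  have hset : countEq τ n ∩ {x | laggersAfter Δ τ n x ∈ winSet δ k (lead (laggers Δ x) n)} =
      (⋃ a ∈ Finset.range k, countEq τ n ∩ {x | lead (laggers Δ x) n = a} ∩
        laggersAfter Δ τ n ⁻¹' winSet δ k a) ∪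
      (countEq τ n ∩ {x | k ≤ lead (laggers Δ x) n}) := by
    ext x
    simp only [Set.mem_inter_iff, Set.mem_ofPred_eq, Set.mem_union, Set.mem_iUnion,
      Finset.mem_range, Set.mem_preimage, exists_prop]
    constructor
    · rintro ⟨hx, hw⟩
      rcases lt_or_ge (lead (laggers Δ x) n) k with h | h
      · exact Or.inl ⟨_, h, ⟨hx, rfl⟩, hw⟩
      · exact Or.inr ⟨hx, h⟩
    · rintro (⟨a, -, ⟨hx, rfl⟩, hw⟩ | ⟨hx, h⟩)
      · exact ⟨hx, hw⟩
      · exact ⟨hx, by rw [winSet_eq_univ h]; trivial⟩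
  rw [hset, measure_union, measure_biUnion_finset]
  · congr 1
    refine Finset.sum_congr rfl fun a _ => ?_
    refine pathLaw_countEq hlam h0 h1 hΔ τ n (measurableSet_lead_eq Δ n a) ?_
      (measurableSet_winSet δ k a)
    intro x y hxy
    have : lead (laggers Δ x) n = lead (laggers Δ y) n :=
      lead_congr fun i hi => by simp [laggers, hxy i hi]
    simp only [Set.mem_ofPred_eq, this]
  · intro a _ b _ hab
    refine Set.disjoint_left.2 fun x hxa hxb => hab ?_
    exact hxa.1.2.symm.trans hxb.1.2
  · exact fun a _ => ((measurableSet_countEq τ n).inter (measurableSet_lead_eq Δ n a)).inter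
      (measurable_laggersAfter Δ τ n (measurableSet_winSet δ k a))
  · refine Set.disjoint_left.2 fun x hx hx' => ?_
    simp only [Set.mem_iUnion, Finset.mem_range, exists_prop] at hx
    obtain ⟨a, ha, hx⟩ := hx
    have e1 : lead (laggers Δ x) n = a := hx.1.2
    have e2 : k ≤ lead (laggers Δ x) n := hx'.2
    omega
  · exact (measurableSet_countEq τ n).inter (measurableSet_le_lead Δ n k)

/-- The lead at time `τ` is independent of the laggers after time `τ`. -/
lemma pathLaw_winEvent {lam ρ Δ : ℝ} (hlam : 0 < lam) (h0 : 0 < ρ) (h1 : ρ ≤ 1)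
    (hΔ : 0 ≤ Δ) (τ : ℝ) (δ k : ℕ) :
    (pathLaw lam ρ).real (winEvent Δ τ δ k) =
      ∑ a ∈ Finset.range k, (leadTail lam ρ Δ τ a - leadTail lam ρ Δ τ (a + 1)) *
        (trials (ρ * Real.exp (-(lam * Δ)))).real (winSet δ k a) +
      leadTail lam ρ Δ τ k * (trials (ρ * Real.exp (-(lam * Δ)))).real (winSet δ k k) := by
  have hπ := isProbabilityMeasure_pathLaw hlam h0.le h1
  have := isProbabilityMeasure_trials (p := ρ * Real.exp (-(lam * Δ))) (by positivity)
    (mul_exp_le_one hlam h1 hΔ)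
  set B : ℕ → ENNReal := fun a =>
    pathLaw lam ρ (⋃ n, countEq τ n ∩ {x | lead (laggers Δ x) n = a}) with hB
  have hBT : ∀ a, (B a).toReal = leadTail lam ρ Δ τ a - leadTail lam ρ Δ τ (a + 1) := by
    intro a
    have hsplit : ∀ n, pathLaw lam ρ (countEq τ n ∩ {x | a ≤ lead (laggers Δ x) n}) =
        pathLaw lam ρ (countEq τ n ∩ {x | lead (laggers Δ x) n = a}) +
          pathLaw lam ρ (countEq τ n ∩ {x | a + 1 ≤ lead (laggers Δ x) n}) := by
      intro n
      rw [← measure_union _ ((measurableSet_countEq τ n).inter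
        (measurableSet_le_lead Δ n (a + 1))), ← Set.inter_union_distrib_left]
      · congr 2
        ext x
        simp only [Set.mem_ofPred_eq, Set.mem_union]
        omega
      · refine Set.disjoint_left.2 fun x hx hx' => ?_
        have e1 : lead (laggers Δ x) n = a := hx.2
        have e2 : a + 1 ≤ lead (laggers Δ x) n := hx'.2
        omega
    have hsum : pathLaw lam ρ (⋃ n, countEq τ n ∩ {x | a ≤ lead (laggers Δ x) n}) =
        B a + pathLaw lam ρ (⋃ n, countEq τ n ∩ {x | a + 1 ≤ lead (laggers Δ x) n}) := by
      rw [hB]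
      dsimp only
      rw [pathLaw_iUnion_countEq hlam h0 h1 τ fun n => measurableSet_le_lead Δ n a,
        pathLaw_iUnion_countEq hlam h0 h1 τ fun n => measurableSet_le_lead Δ n (a + 1),
        pathLaw_iUnion_countEq hlam h0 h1 τ fun n => measurableSet_lead_eq Δ n a,
        ← ENNReal.tsum_add]
      exact tsum_congr hsplit
    rw [leadTail, leadTail, Measure.real, Measure.real, hsum,
      ENNReal.toReal_add (measure_ne_top _ _) (measure_ne_top _ _)]
    ring
  have hwin : pathLaw lam ρ (winEvent Δ τ δ k) =
      ∑ a ∈ Finset.range k, B a * trials (ρ * Real.exp (-(lam * Δ))) (winSet δ k a) +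
        pathLaw lam ρ (⋃ n, countEq τ n ∩ {x | k ≤ lead (laggers Δ x) n}) := by
    rw [winEvent, pathLaw_iUnion_countEq hlam h0 h1 τ fun n =>
        measurableSet_laggersAfter_mem Δ τ δ k n,
      pathLaw_iUnion_countEq hlam h0 h1 τ fun n => measurableSet_le_lead Δ n k,
      tsum_congr fun n => pathLaw_countEq_win hlam h0.le h1 hΔ τ δ k n, ENNReal.tsum_add,
      Summable.tsum_finsetSum fun _ _ => ENNReal.summable]
    congr 1
    refine Finset.sum_congr rfl fun a _ => ?_
    rw [ENNReal.tsum_mul_right, hB]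
    dsimp only
    rw [pathLaw_iUnion_countEq hlam h0 h1 τ fun n => measurableSet_lead_eq Δ n a]
  rw [winSet_eq_univ le_rfl, probReal_univ, mul_one, Measure.real, hwin,
    ENNReal.toReal_add (by
      refine ENNReal.sum_ne_top.2 fun a _ => ?_
      exact ENNReal.mul_ne_top (measure_ne_top _ _) (measure_ne_top _ _)) (measure_ne_top _ _),
    ENNReal.toReal_sum fun a _ => ENNReal.mul_ne_top (measure_ne_top _ _) (measure_ne_top _ _)]
  congr 1
  refine Finset.sum_congr rfl fun a _ => ?_
  rw [ENNReal.toReal_mul, hBT]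
  rfl

lemma pathLaw_winEvent_le {lam ρ Δ : ℝ} (hlam : 0 < lam) (h0 : 0 < ρ) (h1 : ρ ≤ 1)
    (hΔ : 0 ≤ Δ) (hp : 1 / 2 < ρ * Real.exp (-(lam * Δ))) (τ : ℝ) (δ k : ℕ) :
    (pathLaw lam ρ).real (winEvent Δ τ δ k) ≤ winProb δ k (ρ * Real.exp (-(lam * Δ))) := by
  have hp1 := mul_exp_le_one hlam h1 hΔ
  have := isProbabilityMeasure_trials (by linarith : 0 ≤ ρ * Real.exp (-(lam * Δ))) hp1
  rw [pathLaw_winEvent hlam h0 h1 hΔ, winProb_eq_sum δ k (by linarith) hp1,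
    sum_tail_sub_mul (leadTail lam ρ Δ τ)
      (fun a => (trials (ρ * Real.exp (-(lam * Δ)))).real (winSet δ k a)),
    sum_tail_sub_mul (fun a => F1 a (ρ * Real.exp (-(lam * Δ))))
      (fun a => (trials (ρ * Real.exp (-(lam * Δ)))).real (winSet δ k a))]
  refine add_le_add (mul_le_mul_of_nonneg_right (leadTail_le hlam h0 h1 hΔ hp τ 0)
    measureReal_nonneg) (Finset.sum_le_sum fun a _ => mul_le_mul_of_nonneg_right
      (leadTail_le hlam h0 h1 hΔ hp τ (a + 1)) (sub_nonneg.2 ?_))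
  exact measureReal_mono (winSet_mono δ k (Nat.le_succ a))

lemma tendsto_pathLaw_winEvent {lam ρ Δ : ℝ} (hlam : 0 < lam) (h0 : 0 < ρ) (h1 : ρ ≤ 1)
    (hΔ : 0 ≤ Δ) (hp : 1 / 2 < ρ * Real.exp (-(lam * Δ))) (δ k : ℕ) :
    Tendsto (fun τ => (pathLaw lam ρ).real (winEvent Δ τ δ k)) atTop
      (nhds (winProb δ k (ρ * Real.exp (-(lam * Δ))))) := by
  simp only [pathLaw_winEvent hlam h0 h1 hΔ]
  rw [winProb_eq_sum δ k (by linarith) (mul_exp_le_one hlam h1 hΔ)]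
  have hT := tendsto_leadTail hlam h0 h1 hΔ hp
  exact (tendsto_finsetSum _ fun a _ => ((hT a).sub (hT (a + 1))).mul_const _).add
    ((hT k).mul_const _)

/-! ### From mining paths to executions -/

variable {Ω N : Type*}

/-- The gaps between the blocks of a mining path, and the types of the blocks. -/
def gaps (M : MiningPath N) : ℕ → ℝ × Bool :=
  fun j => (M.time (j + 1) - M.time j, M.honest (j + 1))

lemma arrival_gaps {M : MiningPath N} (h0 : M.time 0 = 0) : arrival (gaps M) = M.time := by
  funext n
  induction n with
  | zero => simp [h0]
  | succ n ih => rw [arrival_succ, ih]; simp [gaps]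

variable [MeasurableSpace Ω] {P : Measure Ω} {X : Ω → MiningPath N} {lam ρ : ℝ}

lemma IsPoissonMining.measurable_gaps (hX : IsPoissonMining P X lam ρ) :
    Measurable fun ω => gaps (X ω) :=
  measurable_pi_iff.2 fun j => (hX.measurable_gap j).prodMk (hX.measurable_honest j)

lemma IsPoissonMining.map_gaps (hX : IsPoissonMining P X lam ρ) :
    P.map (fun ω => gaps (X ω)) = pathLaw lam ρ := by
  have h := hX.indep.map_fun_eq_infinitePi_map
    fun j => (hX.measurable_gap j).prodMk (hX.measurable_honest j)
  simp only [hX.law] at h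
  exact h

lemma IsPoissonMining.measureReal_preimage (hX : IsPoissonMining P X lam ρ)
    {A : Set (ℕ → ℝ × Bool)} (hA : MeasurableSet A) :
    P.real ((fun ω => gaps (X ω)) ⁻¹' A) = (pathLaw lam ρ).real A := by
  rw [Measure.real, Measure.real, ← hX.map_gaps, Measure.map_apply hX.measurable_gaps hA]

lemma IsPoissonMining.ae_isRegular (hX : IsPoissonMining P X lam ρ) (hlam : 0 < lam)
    (h0 : 0 < ρ) (h1 : ρ ≤ 1) {Δ : ℝ} (hΔ : 0 ≤ Δ) : ∀ᵐ ω ∂P, IsRegular Δ (gaps (X ω)) := by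
  have h := Nakamoto.ae_isRegular hlam h0 h1 hΔ
  rw [← hX.map_gaps] at h
  exact ae_of_ae_map hX.measurable_gaps.aemeasurable h

variable {M : MiningPath N} {E : Execution N} {Δ τ : ℝ}

lemma IsRegular.exists_countEq {x : ℕ → ℝ × Bool} (hx : IsRegular Δ x) (hτ : 0 ≤ τ) :
    ∃ n, x ∈ countEq τ n := by
  obtain ⟨l, hl⟩ := Execution.exists_last_index hx.strictMono hx.tendsto (n := 0) (T := τ)
    (by simpa using hτ)
  exact ⟨0 + l, hl⟩

/-- With delays, count the laggers as good and all other blocks as bad. -/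
lemma gaps_mem_winEvent_of_violated (h0 : M.time 0 = 0) (hreg : IsRegular Δ (gaps M))
    (hΔ : 0 ≤ Δ) (hτ : 0 ≤ τ) (hE : E.Legal M Δ τ) {k : ℕ} (hk : 1 ≤ k) (hv : E.Violated k) :
    gaps M ∈ winEvent Δ τ 1 k := by
  obtain ⟨n, hn⟩ := hreg.exists_countEq hτ
  have harr := arrival_gaps h0
  have hmono := hreg.strictMono
  have hlim := hreg.tendsto
  have hn' := hn
  rw [countEq] at hn'
  rw [harr] at hmono hlim
  simp only [Set.mem_ofPred_eq, harr] at hn'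
  set G : ℕ → Bool := fun j => if j < n then laggers Δ (gaps M) j
    else laggersAfter Δ τ n (gaps M) (j - n) with hG
  have hlag : ∀ j, laggers Δ (gaps M) j = true →
      M.honest (j + 1) = true ∧ M.time j + Δ < M.time (j + 1) := by
    intro j hj
    obtain ⟨hj1, hj2⟩ := Bool.and_eq_true_iff.1 hj
    have hj2 : Δ < M.time (j + 1) - M.time j := of_decide_eq_true hj2
    exact ⟨hj1, by linarith⟩
  have hgood : ∀ j, G j = true → M.honest (j + 1) = true ∧ M.time j + Δ < M.time (j + 1) := by
    intro j hj
    simp only [hG] at hj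
    split_ifs at hj with hjn
    · exact hlag j hj
    · rcases Nat.eq_or_lt_of_le (not_lt.1 hjn) with rfl | hlt
      · simp only [laggersAfter, Nat.sub_self, if_true, harr, Bool.and_eq_true,
          decide_eq_true_eq] at hj
        exact ⟨hj.1, by linarith [hj.2, hn'.1]⟩
      · rw [laggersAfter, if_neg (by omega), Nat.add_sub_cancel' hlt.le] at hj
        exact hlag j hj
  have hw := hE.shift_mem_winSet_of_violated hΔ hmono h0 hlim hgood hk hn'.1 hn'.2 hv
  have e1 : shift n G = laggersAfter Δ τ n (gaps M) := by
    funext i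
    simp [shift, hG]
  have e2 : lead G n = lead (laggers Δ (gaps M)) n :=
    lead_congr fun i hi => by simp [hG, hi]
  rw [e1, e2] at hw
  exact Set.mem_iUnion.2 ⟨n, hn, hw⟩

/-- Without delays in the definition of laggers, all honest blocks are laggers. -/
lemma gaps_mem_winEvent_zero_iff (h0 : M.time 0 = 0) (hreg : IsRegular Δ (gaps M)) {k : ℕ} :
    gaps M ∈ winEvent 0 τ 0 k ↔ ∃ n, M.time n ≤ τ ∧ τ < M.time (n + 1) ∧
      shift n (fun j => M.honest (j + 1)) ∈
        winSet 0 k (lead (fun j => M.honest (j + 1)) n) := by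
  have harr := arrival_gaps h0
  have hlag : laggers 0 (gaps M) = fun j => M.honest (j + 1) := by
    funext j
    have := hreg.gap_pos j
    simp only [laggers, this, decide_true, Bool.and_true]
    rfl
  simp only [winEvent, Set.mem_iUnion, Set.mem_inter_iff, countEq, Set.mem_ofPred_eq, harr,
    hlag, and_assoc]
  refine exists_congr fun n => and_congr_right fun _ => and_congr_right fun hn => ?_
  have hafter : laggersAfter 0 τ n (gaps M) = shift n fun j => M.honest (j + 1) := by
    funext i
    by_cases hi : i = 0
    · subst hi
      have : 0 < M.time (n + 1) - τ := by linarith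
      simp only [laggersAfter, if_true, harr, this, decide_true, Bool.and_true]
      rfl
    · simp only [laggersAfter, if_neg hi, hlag, shift]
  rw [hafter]

lemma violated_of_gaps_mem_winEvent (h0 : M.time 0 = 0) (hreg : IsRegular Δ (gaps M))
    (hΔ : 0 ≤ Δ) (hE : E.Legal M Δ τ) {k : ℕ} (hk : 1 ≤ k) (hP : E.IsPrivateMining M Δ k)
    (hw : gaps M ∈ winEvent 0 τ 0 k) : E.Violated k := by
  obtain ⟨n, hn, hn', hw⟩ := (gaps_mem_winEvent_zero_iff h0 hreg).1 hw
  have hmono := hreg.strictMono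
  rw [arrival_gaps h0] at hmono
  refine hE.violated_of_shift_mem_winSet hP hk hΔ hmono h0 (fun i => ?_) hn hn' hw
  obtain ⟨j, hj, hj1, hj2⟩ := hreg.exists_lagger i
  simp only [gaps] at hj1 hj2
  exact ⟨j, hj, hj1, by linarith⟩

lemma gaps_mem_winEvent_zero_of_violated (h0 : M.time 0 = 0) (hreg : IsRegular 0 (gaps M))
    (hτ : 0 ≤ τ) (hE : E.Legal M 0 τ) {k : ℕ} (hP : E.IsPrivateMining M 0 k)
    (hv : E.Violated k) : gaps M ∈ winEvent 0 τ 0 k := by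
  obtain ⟨n, hn⟩ := hreg.exists_countEq hτ
  have hmono := hreg.strictMono
  have hlim := hreg.tendsto
  simp only [countEq, Set.mem_ofPred_eq, arrival_gaps h0] at hn
  rw [arrival_gaps h0] at hmono hlim
  exact (gaps_mem_winEvent_zero_iff h0 hreg).2 ⟨n, hn.1, hn.2,
    hE.shift_mem_winSet_of_privateMining hP hmono h0 hlim hn.1 hn.2 hv⟩

end Nakamoto

theorem theorem2 {Ω N : Type*} [MeasurableSpace Ω] (P : Measure Ω) [IsProbabilityMeasure P]
    (k : ℕ) (hk : 1 ≤ k) (Δ lam ρ : ℝ) (hΔ : 0 ≤ Δ) (hlam : 0 < lam) (hρ0 : 0 < ρ) (hρ1 : ρ ≤ 1)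
    (hp : 1 / 2 < ρ * Real.exp (-(lam * Δ)))
    (X : Ω → Nakamoto.MiningPath N) (hX : Nakamoto.IsPoissonMining P X lam ρ) :
    -- every attack, at every time `τ`: (outer) probability of a safety violation
    (∀ τ : ℝ, 0 ≤ τ → ∀ S : Ω → Nakamoto.Execution N,
      (∀ᵐ ω ∂P, (S ω).Legal (X ω) Δ τ) →
      P.real {ω | (S ω).Violated k} ≤
        Nakamoto.upperBound k (ρ * Real.exp (-(lam * Δ)))) ∧
    -- the private-mining attack can always be carried out
    (∀ τ : ℝ, 0 ≤ τ → ∃ S : Ω → Nakamoto.Execution N,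
      ∀ᵐ ω ∂P, (S ω).Legal (X ω) Δ τ ∧ (S ω).IsPrivateMining (X ω) Δ k) ∧
    -- its success probability as `τ → ∞`: lower bound (for the inner probability), and exact
    -- value for `Δ = 0`
    (∀ ε : ℝ, 0 < ε → ∃ τ₀ : ℝ, 0 ≤ τ₀ ∧ ∀ τ : ℝ, τ₀ ≤ τ → ∀ S : Ω → Nakamoto.Execution N,
      (∀ᵐ ω ∂P, (S ω).Legal (X ω) Δ τ ∧ (S ω).IsPrivateMining (X ω) Δ k) →
      Nakamoto.lowerBound k ρ - ε ≤ 1 - P.real {ω | ¬ (S ω).Violated k} ∧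
      (Δ = 0 → NullMeasurableSet {ω | (S ω).Violated k} P ∧
        |P.real {ω | (S ω).Violated k} - Nakamoto.lowerBound k ρ| ≤ ε)) := by
  have hreg := hX.ae_isRegular hlam hρ0 hρ1 hΔ
  refine ⟨fun τ hτ S hS => ?_, fun τ hτ => ?_, fun ε hε => ?_⟩
  · have hle : P.real {ω | (S ω).Violated k} ≤
        P.real ((fun ω => Nakamoto.gaps (X ω)) ⁻¹' Nakamoto.winEvent Δ τ 1 k) := by
      refine ENNReal.toReal_mono (measure_ne_top _ _) (measure_mono_ae ?_)
      filter_upwards [hS, hreg] with ω hω hr hv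
      exact Nakamoto.gaps_mem_winEvent_of_violated (hX.time_zero ω) hr hΔ hτ hω hk hv
    rw [hX.measureReal_preimage (Nakamoto.measurableSet_winEvent Δ τ 1 k)] at hle
    rw [← Nakamoto.winProb_one hp (Nakamoto.mul_exp_le_one hlam hρ1 hΔ)]
    exact hle.trans (Nakamoto.pathLaw_winEvent_le hlam hρ0 hρ1 hΔ hp τ 1 k)
  · have hex : ∀ ω, ∃ E : Nakamoto.Execution N, Nakamoto.IsRegular Δ (Nakamoto.gaps (X ω)) →
        E.Legal (X ω) Δ τ ∧ E.IsPrivateMining (X ω) Δ k := by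
      intro ω
      by_cases hr : Nakamoto.IsRegular Δ (Nakamoto.gaps (X ω))
      · have hmono := hr.strictMono
        rw [Nakamoto.arrival_gaps (hX.time_zero ω)] at hmono
        obtain ⟨E, hE⟩ := Nakamoto.Execution.exists_privateMining hΔ hmono (hX.time_zero ω) k τ
        exact ⟨E, fun _ => hE⟩
      · exact ⟨Nakamoto.Execution.attack (X ω) Δ τ ⊤, fun h => absurd h hr⟩
    choose S hS using hex
    exact ⟨S, hreg.mono hS⟩
  · have hexp : Real.exp (-(lam * Δ)) ≤ 1 := by
      rw [Real.exp_le_one_iff]; have := mul_nonneg hlam.le hΔ; linarith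
    have hρ : 1 / 2 < ρ := hp.trans_le (mul_le_of_le_one_right hρ0.le hexp)
    have hρe : ρ * Real.exp (-(lam * 0)) = ρ := by simp
    have hlim := Nakamoto.tendsto_pathLaw_winEvent hlam hρ0 hρ1 le_rfl (by rwa [hρe]) 0 k
    rw [hρe, Nakamoto.winProb_zero hρ hρ1] at hlim
    obtain ⟨τ₁, hτ₁⟩ := Filter.eventually_atTop.1 (Metric.tendsto_nhds.1 hlim ε hε)
    refine ⟨max τ₁ 0, le_max_right _ _, fun τ hτ S hS => ?_⟩
    have hτ0 : 0 ≤ τ := (le_max_right _ _).trans hτ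
    have hclose := (hτ₁ τ ((le_max_left _ _).trans hτ)).le
    rw [Real.dist_eq] at hclose
    have hWm := Nakamoto.measurableSet_winEvent 0 τ 0 k
    have hpre : MeasurableSet ((fun ω => Nakamoto.gaps (X ω)) ⁻¹' Nakamoto.winEvent 0 τ 0 k) :=
      hX.measurable_gaps hWm
    have hW := hX.measureReal_preimage hWm
    have hsucc : ∀ᵐ ω ∂P, Nakamoto.gaps (X ω) ∈ Nakamoto.winEvent 0 τ 0 k →
        (S ω).Violated k := by
      filter_upwards [hS, hreg] with ω hω hr hw
      exact Nakamoto.violated_of_gaps_mem_winEvent (hX.time_zero ω) hr hΔ hω.1 hk hω.2 hw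
    refine ⟨?_, fun hΔ0 => ?_⟩
    · have hle : P.real {ω | ¬ (S ω).Violated k} ≤
          P.real ((fun ω => Nakamoto.gaps (X ω)) ⁻¹' Nakamoto.winEvent 0 τ 0 k)ᶜ := by
        refine ENNReal.toReal_mono (measure_ne_top _ _) (measure_mono_ae ?_)
        filter_upwards [hsucc] with ω hω hv hw
        exact hv (hω hw)
      rw [probReal_compl_eq_one_sub hpre, hW] at hle
      have := neg_le_of_abs_le hclose
      linarith
    · subst hΔ0
      have hae : {ω | (S ω).Violated k} =ᵐ[P]
          (fun ω => Nakamoto.gaps (X ω)) ⁻¹' Nakamoto.winEvent 0 τ 0 k := by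
        rw [Filter.eventuallyEq_set]
        filter_upwards [hS, hreg, hsucc] with ω hω hr hs
        exact ⟨Nakamoto.gaps_mem_winEvent_zero_of_violated (hX.time_zero ω) hr hτ0 hω.1 hω.2, hs⟩
      refine ⟨hpre.nullMeasurableSet.congr hae.symm, ?_⟩
      rwa [measureReal_congr hae, hW]
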